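/- Let $\Gamma=\mathrm{SL}_2(\mathbb Z)$ act on the upper half-plane $\mathfrak H$, $q=e^{2\pi i z}$, $\mathbb L=\log|q|=-2\pi\,\mathrm{Im}(z)$. Let $M^!_k$ be the space of weakly holomorphic modular forms of weight $k\in\mathbb Z$ for $\Gamma$ (holomorphic on $\mathfrak H$, modular of weight $k$, with an expansion $\sum_{m\ge -N}a_mq^m$), and $S^!_k\subset M^!_k$ the subspace $a_0=0$. For $r,s\in\mathbb Z$ let $\mathcal M^!_{r,s}$ be the space of real analytic $f:\mathfrak H\to\mathbb C$ with $f(\gamma z)=(cz+d)^r(c\bar z+d)^sf(z)$ for all $\gamma=\begin{pmatrix}a&b\\c&d\end{pmatrix}\in\Gamma$, admitting an expansion $\sum_{|k|\le M}\mathbb L^k\sum_{m,n\ge -N}a^{(k)}_{m,n}q^m\bar q^n$. On functions of weights $(r,s)$ put $\partial=(z-\bar z)\frac{\partial}{\partial z}+r$, $\overline\partial=(\bar z-z)\frac{\partial}{\partial\bar z}+s$ and $\Delta=-\overline\partial\,\partial+r(s-1)$. Let $n\ge 0$ and $D=q\,\frac{d}{dq}$, so that $D^{n+1}M^!_{-n}\subset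 M^!_{n+2}$. Let $V_n$ be the space of homogeneous polynomials of degree $n$ in $X,Y$ with complex coefficients, with the right action $(X,Y)|_\gamma=(aX+bY,cX+dY)$. For $f\in M^!_{n+2}$ let $[C^f]\in H^1(\Gamma;V_n)$ be the class of $C^f_\gamma=F_f(\gamma\tau)|_\gamma-F_f(\tau)$, where $F_f(\tau)=\int_\tau^{\tau_0}(2\pi i)^{n+1}f(w)(X-wY)^n\,dw$. Let $F_\infty$ be the real Frobenius $(F_\infty C)_\gamma=C_{\varepsilon\gamma\varepsilon}|_\varepsilon$, $\varepsilon=\mathrm{diag}(1,-1)$. For $f\in M^!_{n+2}$ we say that $g\in M^!_{n+2}$ represents $\mathbf s(f)$ if $[C^g]=F_\infty[C^f]$. A form in $M^!_{n+2}$ is called reduced if its order at the cusp is at least $-\dim S_{n+2}$, where $S_{n+2}$ is the space of holomorphic cusp forms. For $f,g\in M^!_{n+2}$ consider families $\mathcal H_{r,s}\in\mathcal M^!_{r,s}$ ($r,s\ge 0$, $r+s=n$) with $$\partial\mathcal H_{r,s}=(r+1)\mathcal H_{r+1,s-1}\ (s\ge 1),\qquad \overline\partial\mathcal H_{r,s}=(s+1)\mathcal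 H_{r-1,s+1}\ (r\ge 1),\qquad \partial\mathcal H_{n,0}=\mathbb L f,\qquad \overline\partial\mathcal H_{0,n}=-\mathbb L\,\overline{g}.\tag{$*$}$$ **Theorem.** (1) Let $f$ be a holomorphic cuspidal Hecke eigenform of weight $n+2$ for $\Gamma$, normalised by $a_1=1$. Then $\mathbf s(f)$ has a unique reduced representative, and for every representative $g$ of $\mathbf s(f)$ there is a unique family $\mathcal H(f)_{r,s}$ satisfying $(*)$. (2) Let $f\in S^!_{n+2}$ and let $f^c(z)=\overline{f(-\bar z)}$ be the form with complex conjugate Fourier coefficients. There is a unique reduced form congruent to $f$ modulo $D^{n+1}M^!_{-n}$, and $\mathbf s(f^c)$ has a unique reduced representative. The representatives of $\mathbf s(f^c)$ form a single class modulo $D^{n+1}M^!_{-n}$, which depends only on the class of $f$. For every $f_1\equiv f$ modulo $D^{n+1}M^!_{-n}$ and every representative $g$ of $\mathbf s(f^c)$, the system $(*)$ for $(f_1,g)$ has a solution, and the solution is unique if $n\ge 1$. In both cases, every solution satisfies $\Delta\mathcal H_{r,s}=-n\,\mathcal H_{r,s}$ and $\Delta(\mathbb L^{-1}\mathcal H_{r,s})=0$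 for all $r+s=n$. -/

import Mathlib

open UpperHalfPlane
open scoped MatrixGroups ComplexConjugate

noncomputable section

namespace RealAnalyticCuspForms

/-! ### Modular functions on the upper half-plane -/

/-- Modularity of weights `(r, s)` for the full modular group:
`f (γ z) = (c z + d) ^ r * (c z̄ + d) ^ s * f z`. -/
def IsModularOfWeights (r s : ℤ) (f : ℍ → ℂ) : Prop :=
  ∀ (γ : SL(2, ℤ)) (z : ℍ),
    f (γ • z) = ((γ 1 0 : ℂ) * (z : ℂ) + (γ 1 1 : ℂ)) ^ r *
      ((γ 1 0 : ℂ) * conj (z : ℂ) + (γ 1 1 : ℂ)) ^ s * f z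

/-- `q = exp (2 π i z)`. -/
def nome (z : ℍ) : ℂ := Complex.exp (2 * Real.pi * Complex.I * (z : ℂ))

/-- `𝕃 = log |q| = -2 π y`. -/
def logNome (z : ℍ) : ℂ := ((-(2 * Real.pi * z.im) : ℝ) : ℂ)

/-- `f = ∑ a_m q ^ m`, the sum being over all integers `m`. -/
def HasQExpansion (f : ℍ → ℂ) (a : ℤ → ℂ) : Prop :=
  ∀ z : ℍ, HasSum (fun m : ℤ => a m * nome z ^ m) (f z)

/-- Weakly holomorphic modular forms of weight `k` (the space `M^!_k`): holomorphic on the upper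
half-plane, modular of weight `k`, with an expansion `∑_{m ≥ -N} a_m q ^ m`. -/
def IsWeaklyHolomorphic (k : ℤ) (f : ℍ → ℂ) : Prop :=
  DifferentiableOn ℂ (f ∘ ofComplex) {z : ℂ | 0 < z.im} ∧
  IsModularOfWeights k 0 f ∧
  ∃ (N : ℤ) (a : ℤ → ℂ), (∀ m : ℤ, m < -N → a m = 0) ∧ HasQExpansion f a

/-- Weakly holomorphic cusp forms of weight `k` (the space `S^!_k`): the coefficient `a_0`
vanishes. -/
def IsWeakCuspForm (k : ℤ) (f : ℍ → ℂ) : Prop :=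
  IsWeaklyHolomorphic k f ∧ ∃ a : ℤ → ℂ, HasQExpansion f a ∧ a 0 = 0

/-- The space `M^!_{r,s}`: real analytic functions on the upper half-plane which are modular of
weights `(r, s)` and admit an expansion
`∑_{|k| ≤ M} 𝕃 ^ k ∑_{m, n ≥ -N} a^{(k)}_{m,n} q ^ m q̄ ^ n`. -/
def IsRealAnalyticModular (r s : ℤ) (f : ℍ → ℂ) : Prop :=
  AnalyticOnNhd ℝ (f ∘ ofComplex) {z : ℂ | 0 < z.im} ∧
  IsModularOfWeights r s f ∧
  ∃ (M N : ℕ) (a : ℤ → ℤ → ℤ → ℂ),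
    (∀ k m n : ℤ, m < -(N : ℤ) ∨ n < -(N : ℤ) → a k m n = 0) ∧
    ∀ z : ℍ,
      (∀ k ∈ Finset.Icc (-(M : ℤ)) M,
        Summable (fun p : ℤ × ℤ => a k p.1 p.2 * nome z ^ p.1 * conj (nome z) ^ p.2)) ∧
      f z = ∑ k ∈ Finset.Icc (-(M : ℤ)) M, logNome z ^ k *
        ∑' p : ℤ × ℤ, a k p.1 p.2 * nome z ^ p.1 * conj (nome z) ^ p.2

/-! ### Differential operators -/

/-- The Wirtinger derivative `∂f/∂z`. -/
def wirtinger (f : ℍ → ℂ) (z : ℍ) : ℂ :=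
  (fderiv ℝ (f ∘ ofComplex) (z : ℂ) 1 - Complex.I * fderiv ℝ (f ∘ ofComplex) (z : ℂ) Complex.I) / 2

/-- The Wirtinger derivative `∂f/∂z̄`. -/
def wirtingerBar (f : ℍ → ℂ) (z : ℍ) : ℂ :=
  (fderiv ℝ (f ∘ ofComplex) (z : ℂ) 1 + Complex.I * fderiv ℝ (f ∘ ofComplex) (z : ℂ) Complex.I) / 2

/-- `∂_r = (z - z̄) ∂/∂z + r`. -/
def del (r : ℤ) (f : ℍ → ℂ) (z : ℍ) : ℂ :=
  ((z : ℂ) - conj (z : ℂ)) * wirtinger f z + (r : ℂ) * f z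

/-- `∂̄_s = (z̄ - z) ∂/∂z̄ + s`. -/
def delBar (s : ℤ) (f : ℍ → ℂ) (z : ℍ) : ℂ :=
  (conj (z : ℂ) - (z : ℂ)) * wirtingerBar f z + (s : ℂ) * f z

/-- The Laplacian `Δ_{r,s} = - ∂̄_{s-1} ∂_r + r (s - 1)` in weights `(r, s)`. -/
def laplacian (r s : ℤ) (f : ℍ → ℂ) (z : ℍ) : ℂ :=
  -delBar (s - 1) (del r f) z + ((r * (s - 1) : ℤ) : ℂ) * f z

/-- `u` lies in the image of `D ^ (n+1) : M^!_{-n} → M^!_{n+2}`, where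
`D = q d/dq = (2 π i)⁻¹ d/dz`. -/
def IsBolImage (n : ℕ) (u : ℍ → ℂ) : Prop :=
  ∃ h : ℍ → ℂ, IsWeaklyHolomorphic (-(n : ℤ)) h ∧
    ∀ z : ℍ, u z = (2 * Real.pi * Complex.I)⁻¹ ^ (n + 1) *
      iteratedDeriv (n + 1) (h ∘ ofComplex) (z : ℂ)

/-- Congruence modulo `D ^ (n+1) M^!_{-n}`. -/
def BolCongruent (n : ℕ) (f g : ℍ → ℂ) : Prop := IsBolImage n (fun z => g z - f z)

/-- A weakly holomorphic form of weight `n + 2` with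
`ord_∞ f ≥ - dim S_{n+2}`. -/
def IsReduced (n : ℕ) (f : ℍ → ℂ) : Prop :=
  IsWeaklyHolomorphic ((n : ℤ) + 2) f ∧
  ∃ a : ℤ → ℂ, HasQExpansion f a ∧
    ∀ m : ℤ, m < -(Module.finrank ℂ (CuspForm 𝒮ℒ ((n : ℤ) + 2)) : ℤ) → a m = 0

/-- Complex conjugation of the Fourier coefficients, `∑ a_m q ^ m ↦ ∑ (conj a_m) q ^ m`; as a
function of `z` this is `conj (f (-z̄))`. -/
def conjCoeff (f : ℍ → ℂ) (z : ℍ) : ℂ := conj (f (ofComplex (-conj (z : ℂ))))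

/-! ### Hecke eigenforms -/

/-- The Hecke operator `T_m` in weight `k`:
`T_m f (z) = m ^ (k-1) ∑_{a d = m} d ^ (-k) ∑_{0 ≤ b < d} f ((a z + b) / d)`. -/
def hecke (k : ℤ) (m : ℕ) (f : ℍ → ℂ) (z : ℍ) : ℂ :=
  (m : ℂ) ^ (k - 1) * ∑ p ∈ m.divisorsAntidiagonal, ((p.2 : ℂ) ^ k)⁻¹ *
    ∑ b ∈ Finset.range p.2, f (ofComplex (((p.1 : ℂ) * (z : ℂ) + (b : ℂ)) / (p.2 : ℂ)))

/-- A cusp form which is an eigenvector of all Hecke operators, normalised by `a_1 = 1`. -/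
def IsNormalizedHeckeEigenform {k : ℤ} (f : CuspForm 𝒮ℒ k) : Prop :=
  (qExpansion 1 (f : ℍ → ℂ)).coeff 1 = 1 ∧
  ∀ m : ℕ, 1 ≤ m → ∃ c : ℂ, ∀ z : ℍ, hecke k m f z = c * f z

/-! ### Cocycles, real Frobenius and the single-valued involution

`V_n ⊗ ℂ` is the space of homogeneous polynomials of degree `n` in `X = X 0` and `Y = X 1`. -/

/-- The right action `(X, Y)|_γ = (a X + b Y, c X + d Y)` of integral matrices on polynomials. -/
def act (P : MvPolynomial (Fin 2) ℂ) (γ : Matrix (Fin 2) (Fin 2) ℤ) : MvPolynomial (Fin 2) ℂ :=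
  MvPolynomial.aeval
    (fun i : Fin 2 => MvPolynomial.C (γ i 0 : ℂ) * MvPolynomial.X 0 +
      MvPolynomial.C (γ i 1 : ℂ) * MvPolynomial.X 1) P

/-- The integral `∫_τ^{τ₀} f(w) w ^ j dw` along the straight segment from `τ` to `τ₀`. -/
def segmentIntegral (f : ℍ → ℂ) (j : ℕ) (τ τ₀ : ℍ) : ℂ :=
  ∫ t in (0 : ℝ)..1, f (ofComplex ((τ : ℂ) + (t : ℂ) * ((τ₀ : ℂ) - (τ : ℂ)))) *
    ((τ : ℂ) + (t : ℂ) * ((τ₀ : ℂ) - (τ : ℂ))) ^ j * ((τ₀ : ℂ) - (τ : ℂ))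

/-- `F_f(τ) = ∫_τ^{τ₀} (2 π i) ^ (n+1) f(w) (X - w Y) ^ n dw`, with `(X - w Y) ^ n` expanded by the
binomial theorem. -/
def eichlerIntegral (n : ℕ) (f : ℍ → ℂ) (τ₀ τ : ℍ) : MvPolynomial (Fin 2) ℂ :=
  ∑ j ∈ Finset.range (n + 1),
    MvPolynomial.C ((2 * Real.pi * Complex.I) ^ (n + 1) * (-1) ^ j * (n.choose j : ℂ) *
      segmentIntegral f j τ τ₀) * MvPolynomial.X 0 ^ (n - j) * MvPolynomial.X 1 ^ j

/-- The cocycle `C^f_γ = F_f(γ τ)|_γ - F_f(τ)`, computed with base point `τ₀ = i` and at `τ = i`;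
the choices of `τ₀` and `τ` do not affect its cohomology class, which is the image of `f` under the
comparison isomorphism. -/
def cocycle (n : ℕ) (f : ℍ → ℂ) (γ : SL(2, ℤ)) : MvPolynomial (Fin 2) ℂ :=
  act (eichlerIntegral n f UpperHalfPlane.I (γ • UpperHalfPlane.I))
      (γ : Matrix (Fin 2) (Fin 2) ℤ) -
    eichlerIntegral n f UpperHalfPlane.I UpperHalfPlane.I

/-- Conjugation by `ε = diag(1, -1)` on `SL₂(ℤ)`. -/
def epsConj (γ : SL(2, ℤ)) : SL(2, ℤ) :=
  ⟨!![γ 0 0, -γ 0 1; -γ 1 0, γ 1 1], by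
    have h := γ.det_coe
    rw [Matrix.det_fin_two] at h
    rw [Matrix.det_fin_two_of]
    linarith⟩

/-- The (`ℂ`-linear) real Frobenius `F_∞`: conjugation by `ε` on `SL₂(ℤ)`, and the right action of
`ε` on polynomials. -/
def realFrobenius (C : SL(2, ℤ) → MvPolynomial (Fin 2) ℂ) (γ : SL(2, ℤ)) :
    MvPolynomial (Fin 2) ℂ :=
  act (C (epsConj γ)) !![1, 0; 0, -1]

/-- Two cochains differ by a coboundary `γ ↦ P|_γ - P` with `P ∈ V_n ⊗ ℂ`. -/
def Cohomologous (n : ℕ) (C C' : SL(2, ℤ) → MvPolynomial (Fin 2) ℂ) : Prop :=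
  ∃ P ∈ MvPolynomial.homogeneousSubmodule (Fin 2) ℂ n,
    ∀ γ : SL(2, ℤ), C γ - C' γ = act P (γ : Matrix (Fin 2) (Fin 2) ℤ) - P

/-- `g` represents the class `s(f)` in `M^!_{n+2} / D ^ (n+1) M^!_{-n}`, where
`s = comp⁻¹ ∘ (F_∞ ⊗ id) ∘ comp`; that is, `comp g = F_∞ (comp f)` in `H¹(SL₂(ℤ); V_n ⊗ ℂ)`. -/
def RepresentsSingleValued (n : ℕ) (f g : ℍ → ℂ) : Prop :=
  IsWeaklyHolomorphic ((n : ℤ) + 2) g ∧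
  Cohomologous n (cocycle n g) (realFrobenius (cocycle n f))

/-! ### Families of real analytic cusp forms -/

/-- Families of functions `H_{r,s}` on the upper half-plane, indexed by `r, s ≥ 0`, `r + s = n`. -/
abbrev Family (n : ℕ) : Type := (r s : ℕ) → r + s = n → ℍ → ℂ

/-- The family `H` has `H_{r,s} ∈ M^!_{r,s}` and solves
* `∂ H_{r,s} = (r + 1) H_{r+1,s-1}` for `s ≥ 1`,
* `∂̄ H_{r,s} = (s + 1) H_{r-1,s+1}` for `r ≥ 1`,
* `∂ H_{n,0} = 𝕃 f` and `∂̄ H_{0,n} = - 𝕃 conj(g)`. -/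
structure SolvesSystem (n : ℕ) (f g : ℍ → ℂ) (H : Family n) : Prop where
  mem : ∀ (r s : ℕ) (h : r + s = n), IsRealAnalyticModular r s (H r s h)
  del_eq : ∀ (r s : ℕ) (h : r + (s + 1) = n) (z : ℍ),
    del r (H r (s + 1) h) z = ((r : ℂ) + 1) * H (r + 1) s (by omega) z
  delBar_eq : ∀ (r s : ℕ) (h : (r + 1) + s = n) (z : ℍ),
    delBar s (H (r + 1) s h) z = ((s : ℂ) + 1) * H r (s + 1) (by omega) z
  del_top : ∀ z : ℍ, del n (H n 0 (by omega)) z = logNome z * f z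
  delBar_top : ∀ z : ℍ, delBar n (H 0 n (by omega)) z = -(logNome z * conj (g z))

/-- Every `H_{r,s}` satisfies `Δ H_{r,s} = - n H_{r,s}`, and `𝕃⁻¹ H_{r,s}`, which has weights
`(r + 1, s + 1)`, satisfies `Δ (𝕃⁻¹ H_{r,s}) = 0`. -/
def IsLaplaceEigenFamily (n : ℕ) (H : Family n) : Prop :=
  ∀ (r s : ℕ) (h : r + s = n) (z : ℍ),
    laplacian r s (H r s h) z = -(n : ℂ) * H r s h z ∧
    laplacian ((r : ℤ) + 1) ((s : ℤ) + 1) (fun w => (logNome w)⁻¹ * H r s h w) z = 0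

end RealAnalyticCuspForms

end

noncomputable section

namespace RealAnalyticCuspForms

open Filter Topology
open scoped Manifold ModularForm

/-! For odd n the matrix -1 forces every form of weight n + 2 to vanish, and all claims are trivial.
Let n be even.

Comparison. The map f ↦ [C^f] induces an isomorphism from M^!_{n+2} / D^{n+1} M^!_{-n} to H¹(Γ;
V_n), and every class contains exactly one reduced form. The kernel is the Bol image: the Taylor
polynomial of degree n of a form of weight -n is equivariant (`act_primPoly_derivChain`), and
conversely, if C^f is a coboundary, an (n+1)-fold primitive of f, corrected by a constant, is
modular of weight -n (`isBolImage_of_coboundary`). A reduced form D^{n+1} h vanishes, because h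
times a power of the discriminant would be holomorphic of negative weight or of weight 2
(`IsReduced.eq_zero_of_bolImage`). Surjectivity is a dimension count: a cocycle is determined by its
values at S and ST, the relations S² = (ST)³ = -1 kill certain eigencoordinates of these values, and
the number of remaining coordinates is the dimension of reduced forms plus that of V_n
(`coordMap_surjective`).

Solutions. Since z ↦ -z̄ realises conjugation by ε, F_∞ C^{f^c} is the complex conjugate of C^f
(`realFrobenius_cocycle_conjCoeff`), so g represents s(f^c) exactly when C^g is cohomologous to conj
C^f. Form the generating polynomial ∑ H_{r,s} (X - zY)^r (X - z̄Y)^s. For real analytic modular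
coefficients, system (*) amounts to saying that its z- and z̄-derivatives are πi f (X - zY)^n and πi
conj(g) (X - z̄Y)^n. Hence it must be πi (A_f + conj A_g) plus a constant polynomial, where A_f and
A_g are Eichler primitives, and modularity of the coefficients means equivariance of this
polynomial. The condition on g provides the constant: the two cocycles cancel up to a coboundary,
and T-invariance leaves only a multiple of Y^n (`exists_genPoly_equivariant`). Two solutions differ
by a Γ-invariant of V_n, which is zero for n ≥ 1 (`eq_zero_of_solvesSeq_zero`). The Laplace
equations follow by composing the equations of (*).

Eigenforms. Part (1) is the case f^c = f of part (2): Hecke eigenvalues are Fourier coefficients and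
are real because Hecke operators are self-adjoint for the Petersson product
(`conj_hecke_eigenvalue`). -/

lemma hasSum_congr_fun {ι : Type*} {f g : ι → ℂ} {s : ℂ} (h : ∀ i, f i = g i) :
    HasSum f s ↔ HasSum g s := by rw [funext h]

/-! ### Holomorphic functions and `q`-series on the upper half-plane -/

/-- `f'` is the complex derivative of `f` on the upper half-plane. -/
def HasDerivH (f f' : ℍ → ℂ) : Prop := ∀ z : ℍ, HasDerivAt (f ∘ ofComplex) (f' z) (z : ℂ)

lemma isOpen_im_pos : IsOpen {z : ℂ | 0 < z.im} := isOpen_lt continuous_const Complex.continuous_im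

lemma isPreconnected_im_pos : IsPreconnected {z : ℂ | 0 < z.im} :=
  (convex_halfSpace_im_gt 0).isPreconnected

lemma eventually_im_pos (z : ℍ) : ∀ᶠ w in 𝓝 (z : ℂ), 0 < w.im := isOpen_im_pos.mem_nhds z.im_pos

lemma coe_ofComplex {w : ℂ} (hw : 0 < w.im) : ((ofComplex w : ℍ) : ℂ) = w := by
  rw [ofComplex_apply_of_im_pos hw]

lemma HasDerivH.differentiableOn {f f' : ℍ → ℂ} (h : HasDerivH f f') :
    DifferentiableOn ℂ (f ∘ ofComplex) {z : ℂ | 0 < z.im} := fun z hz ↦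
  (h ⟨z, hz⟩).differentiableAt.differentiableWithinAt

lemma hasDerivH_of_differentiableOn {f : ℍ → ℂ}
    (h : DifferentiableOn ℂ (f ∘ ofComplex) {z : ℂ | 0 < z.im}) :
    HasDerivH f (fun z ↦ deriv (f ∘ ofComplex) z) := fun z ↦
  ((h z z.im_pos).differentiableAt (isOpen_im_pos.mem_nhds z.im_pos)).hasDerivAt

lemma HasDerivH.unique {f f' f'' : ℍ → ℂ} (h : HasDerivH f f') (h' : HasDerivH f f'') :
    f' = f'' := funext fun z ↦ (h z).unique (h' z)

lemma HasDerivH.continuous {f f' : ℍ → ℂ} (h : HasDerivH f f') : Continuous f := by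
  have : f = (f ∘ ofComplex) ∘ ((↑) : ℍ → ℂ) := by ext z; simp
  rw [this]
  exact continuous_iff_continuousAt.2 fun z ↦
    ContinuousAt.comp (h z).continuousAt continuous_coe.continuousAt

lemma HasDerivH.congr_deriv {f f' g' : ℍ → ℂ} (h : HasDerivH f f') (e : ∀ z, f' z = g' z) :
    HasDerivH f g' := fun z ↦ e z ▸ h z

lemma HasDerivH.add {f f' g g' : ℍ → ℂ} (hf : HasDerivH f f') (hg : HasDerivH g g') :
    HasDerivH (fun z ↦ f z + g z) (fun z ↦ f' z + g' z) := fun z ↦ (hf z).add (hg z)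

lemma HasDerivH.sub {f f' g g' : ℍ → ℂ} (hf : HasDerivH f f') (hg : HasDerivH g g') :
    HasDerivH (fun z ↦ f z - g z) (fun z ↦ f' z - g' z) := fun z ↦ (hf z).sub (hg z)

lemma HasDerivH.const_mul {f f' : ℍ → ℂ} (c : ℂ) (hf : HasDerivH f f') :
    HasDerivH (fun z ↦ c * f z) (fun z ↦ c * f' z) := fun z ↦ (hf z).const_mul c

lemma HasDerivH.mul {f f' g g' : ℍ → ℂ} (hf : HasDerivH f f') (hg : HasDerivH g g') :
    HasDerivH (fun z ↦ f z * g z) (fun z ↦ f' z * g z + f z * g' z) := fun z ↦ by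
  have := HasDerivAt.fun_mul (hf z) (hg z)
  simp only [Function.comp, ofComplex_apply] at this
  exact this

lemma HasDerivH.sum {ι : Type*} (s : Finset ι) {f f' : ι → ℍ → ℂ}
    (h : ∀ i ∈ s, HasDerivH (f i) (f' i)) :
    HasDerivH (fun z ↦ ∑ i ∈ s, f i z) (fun z ↦ ∑ i ∈ s, f' i z) := fun z ↦
  HasDerivAt.fun_sum fun i hi ↦ h i hi z

lemma hasDerivH_const (c : ℂ) : HasDerivH (fun _ ↦ c) (fun _ ↦ 0) := fun z ↦
  hasDerivAt_const (z : ℂ) c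

lemma hasDerivH_of_hasDerivAt {f : ℂ → ℂ} {f' : ℂ → ℂ} (h : ∀ z, HasDerivAt f (f' z) z) :
    HasDerivH (fun z ↦ f z) (fun z ↦ f' z) := fun z ↦ by
  refine (h z).congr_of_eventuallyEq ?_
  filter_upwards [eventually_im_pos z] with w hw
  simp [coe_ofComplex hw]

lemma eq_const_of_hasDerivH_zero {f : ℍ → ℂ} (h : HasDerivH f (fun _ ↦ 0)) (z w : ℍ) :
    f z = f w := by
  simpa using isOpen_im_pos.is_const_of_deriv_eq_zero isPreconnected_im_pos h.differentiableOn
    (fun x hx ↦ (h ⟨x, hx⟩).deriv) z.im_pos w.im_pos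

lemma norm_nome (z : ℍ) : ‖nome z‖ = Real.exp (-(2 * Real.pi * z.im)) := by
  rw [nome, Complex.norm_exp]
  simp

lemma nome_ne_zero (z : ℍ) : nome z ≠ 0 := Complex.exp_ne_zero _

lemma nome_eq_qParam (z : ℍ) : nome z = Function.Periodic.qParam 1 z := by
  simp [nome, Function.Periodic.qParam]

lemma nome_zpow (z : ℍ) (m : ℤ) :
    nome z ^ m = Complex.exp (2 * Real.pi * Complex.I * m * z) := by
  rw [nome, ← Complex.exp_int_mul]
  congr 1
  ring

lemma nome_vadd_one (z : ℍ) : nome ((1 : ℝ) +ᵥ z) = nome z := by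
  have : 2 * Real.pi * Complex.I * ((1 + z : ℂ)) =
    2 * Real.pi * Complex.I * z + 2 * Real.pi * Complex.I := by ring
  simp only [nome, coe_vadd, Complex.ofReal_one, this, Complex.exp_periodic _]

lemma norm_nome_zpow (z : ℍ) (m : ℤ) :
    ‖nome z ^ m‖ = Real.exp (-(2 * Real.pi * m * z.im)) := by
  rw [nome_zpow, Complex.norm_exp]
  have : (2 * Real.pi * Complex.I * m * z : ℂ) =
    ((2 * Real.pi * m : ℝ) : ℂ) * (Complex.I * z) := by push_cast; ring
  rw [this, Complex.re_ofReal_mul]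
  simp

/-- The sum of a `q`-series. -/
def qSeries (a : ℤ → ℂ) (z : ℍ) : ℂ := ∑' m : ℤ, a m * nome z ^ m

lemma HasQExpansion.eq_qSeries {f : ℍ → ℂ} {a : ℤ → ℂ} (h : HasQExpansion f a) :
    f = qSeries a := funext fun z ↦ (h z).tsum_eq.symm

lemma hasQExpansion_qSeries {a : ℤ → ℂ} (h : ∀ z : ℍ, Summable fun m : ℤ ↦ a m * nome z ^ m) :
    HasQExpansion (qSeries a) a := fun z ↦ (h z).hasSum

/-- On the strip Im z / 2 < Im w < 2 Im z each |q^m| is monotone in the height, in a direction given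
by the sign of m. So every term is bounded by the sum of its norms at the two edges, and the series
may be differentiated termwise. -/
lemma exists_hasDerivH_hasQExpansion {f : ℍ → ℂ} {a : ℤ → ℂ} (h : HasQExpansion f a) :
    ∃ f' : ℍ → ℂ, HasDerivH f f' ∧
      HasQExpansion f' (fun m ↦ 2 * Real.pi * Complex.I * m * a m) := by
  refine ⟨fun z ↦ deriv (f ∘ ofComplex) z, ?_⟩
  have key : ∀ z : ℍ, DifferentiableAt ℂ (f ∘ ofComplex) z ∧
      HasSum (fun m : ℤ ↦ 2 * Real.pi * Complex.I * m * a m * nome z ^ m)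
        (deriv (f ∘ ofComplex) z) := by
    intro z
    let U : Set ℂ := {w | z.im / 2 < w.im} ∩ {w | w.im < 2 * z.im}
    have hUo : IsOpen U := (isOpen_lt continuous_const Complex.continuous_im).inter
      (isOpen_lt Complex.continuous_im continuous_const)
    have hz0 := z.im_pos
    have hzU : (z : ℂ) ∈ U := ⟨by simp only [Set.mem_ofPred_eq, coe_im]; linarith,
      by simp only [Set.mem_ofPred_eq, coe_im]; linarith⟩
    have hUpos : ∀ w ∈ U, 0 < w.im := fun w hw ↦ by
      have := hw.1
      simp only [Set.mem_ofPred_eq] at this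
      linarith
    let z₁ : ℍ := ⟨Complex.I * (z.im / 2 : ℝ), by simpa using hz0⟩
    let z₂ : ℍ := ⟨Complex.I * (2 * z.im : ℝ), by simpa using hz0⟩
    have hz₁ : z₁.im = z.im / 2 := by simp [z₁, ← coe_im]
    have hz₂ : z₂.im = 2 * z.im := by simp [z₂, ← coe_im]
    let F : ℤ → ℂ → ℂ := fun m w ↦ a m * Complex.exp (2 * Real.pi * Complex.I * m * w)
    have hFd : ∀ m w, HasDerivAt (F m) (2 * Real.pi * Complex.I * m * a m *
        Complex.exp (2 * Real.pi * Complex.I * m * w)) w := fun m w ↦ by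
      have h1 : HasDerivAt (fun w : ℂ ↦ 2 * Real.pi * Complex.I * m * w)
        (2 * Real.pi * Complex.I * m) w := by
        simpa using (hasDerivAt_id w).const_mul (2 * Real.pi * Complex.I * m : ℂ)
      refine (h1.cexp.const_mul (a m)).congr_deriv ?_
      ring
    have hfF : ∀ w ∈ U, (f ∘ ofComplex) w = ∑' m, F m w := fun w hw ↦ by
      have := (h ⟨w, hUpos w hw⟩).tsum_eq
      rw [Function.comp, ofComplex_apply_of_im_pos (hUpos w hw), ← this]
      exact tsum_congr fun m ↦ by rw [nome_zpow]
    have hu : Summable fun m : ℤ ↦ ‖a m * nome z₁ ^ m‖ + ‖a m * nome z₂ ^ m‖ :=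
      (h z₁).summable.norm.add (h z₂).summable.norm
    have hle : ∀ (m : ℤ) (w : ℂ), w ∈ U → ‖F m w‖ ≤ ‖a m * nome z₁ ^ m‖ + ‖a m * nome z₂ ^ m‖ := by
      intro m w hw
      have hre : (2 * Real.pi * Complex.I * m * w : ℂ).re = -(2 * Real.pi * m * w.im) := by
        have : (2 * Real.pi * Complex.I * m * w : ℂ) =
          ((2 * Real.pi * m : ℝ) : ℂ) * (Complex.I * w) := by push_cast; ring
        rw [this, Complex.re_ofReal_mul]
        simp
      have hb := hw.1
      have hb' := hw.2
      simp only [Set.mem_ofPred_eq] at hb hb'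
      rw [norm_mul, norm_mul, norm_mul, norm_nome_zpow, norm_nome_zpow, Complex.norm_exp, hre,
        ← mul_add]
      refine mul_le_mul_of_nonneg_left ?_ (norm_nonneg _)
      have hp := Real.pi_pos
      rcases le_total 0 m with hm | hm
      · have hm' : (0 : ℝ) ≤ m := by exact_mod_cast hm
        refine le_add_of_le_of_nonneg (Real.exp_le_exp.2 ?_) (Real.exp_nonneg _)
        rw [hz₁, neg_le_neg_iff]
        exact mul_le_mul_of_nonneg_left hb.le (by positivity)
      · have hm' : (m : ℝ) ≤ 0 := by exact_mod_cast hm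
        refine le_add_of_nonneg_of_le (Real.exp_nonneg _) (Real.exp_le_exp.2 ?_)
        rw [hz₂, neg_le_neg_iff]
        exact mul_le_mul_of_nonpos_left hb'.le (by nlinarith)
    have hd := Complex.differentiableOn_tsum_of_summable_norm hu
      (fun m ↦ fun w _ ↦ (hFd m w).differentiableAt.differentiableWithinAt) hUo hle
    have hev : (f ∘ ofComplex) =ᶠ[𝓝 (z : ℂ)] fun w ↦ ∑' m, F m w :=
      Filter.eventually_of_mem (hUo.mem_nhds hzU) hfF
    refine ⟨((hd z hzU).differentiableAt (hUo.mem_nhds hzU)).congr_of_eventuallyEq hev, ?_⟩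
    rw [hev.deriv_eq]
    have := Complex.hasSum_deriv_of_summable_norm hu
      (fun m ↦ fun w _ ↦ (hFd m w).differentiableAt.differentiableWithinAt) hUo hle hzU
    refine (hasSum_congr_fun fun m ↦ ?_).mp this
    rw [(hFd m z).deriv, nome_zpow]
  exact ⟨fun z ↦ (key z).1.hasDerivAt, fun z ↦ (key z).2⟩

lemma HasQExpansion.differentiableOn {f : ℍ → ℂ} {a : ℤ → ℂ} (h : HasQExpansion f a) :
    DifferentiableOn ℂ (f ∘ ofComplex) {z : ℂ | 0 < z.im} := by
  obtain ⟨f', hf', -⟩ := exists_hasDerivH_hasQExpansion h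
  exact hf'.differentiableOn

lemma HasQExpansion.of_hasDerivH {f f' : ℍ → ℂ} {a : ℤ → ℂ} (h : HasQExpansion f a)
    (hf : HasDerivH f f') : HasQExpansion f' (fun m ↦ 2 * Real.pi * Complex.I * m * a m) := by
  obtain ⟨f'', h1, h2⟩ := exists_hasDerivH_hasQExpansion h
  rwa [hf.unique h1]

lemma HasQExpansion.add {f g : ℍ → ℂ} {a b : ℤ → ℂ} (hf : HasQExpansion f a)
    (hg : HasQExpansion g b) : HasQExpansion (fun z ↦ f z + g z) (fun m ↦ a m + b m) := fun z ↦ by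
  simpa [add_mul] using (hf z).add (hg z)

lemma HasQExpansion.sub {f g : ℍ → ℂ} {a b : ℤ → ℂ} (hf : HasQExpansion f a)
    (hg : HasQExpansion g b) : HasQExpansion (fun z ↦ f z - g z) (fun m ↦ a m - b m) := fun z ↦ by
  simpa [sub_mul] using (hf z).sub (hg z)

lemma HasQExpansion.const_mul {f : ℍ → ℂ} {a : ℤ → ℂ} (c : ℂ) (hf : HasQExpansion f a) :
    HasQExpansion (fun z ↦ c * f z) (fun m ↦ c * a m) := fun z ↦ by
  simpa [mul_assoc] using (hf z).mul_left c

lemma HasQExpansion.vadd_one {f : ℍ → ℂ} {a : ℤ → ℂ} (hf : HasQExpansion f a) (z : ℍ) :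
    f ((1 : ℝ) +ᵥ z) = f z := by
  have := hf ((1 : ℝ) +ᵥ z)
  simp only [nome_vadd_one] at this
  exact this.unique (hf z)

/-- The coefficients of a `k`-fold primitive of a `q`-series without constant term. -/
def primCoeff (a : ℤ → ℂ) (k : ℕ) (m : ℤ) : ℂ := a m / (2 * Real.pi * Complex.I * m) ^ k

lemma one_le_norm_two_pi_I_mul {m : ℤ} (hm : m ≠ 0) : 1 ≤ ‖(2 * Real.pi * Complex.I * m : ℂ)‖ := by
  have h1 : (1 : ℝ) ≤ |(m : ℝ)| := by exact_mod_cast Int.one_le_abs hm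
  have h2 := Real.pi_gt_three
  simp only [norm_mul, Complex.norm_ofNat, Complex.norm_real, Real.norm_eq_abs, Complex.norm_I,
    Complex.norm_intCast, abs_of_pos Real.pi_pos]
  nlinarith

/-- Since |2πi m| ≥ 1 for m ≠ 0, integration does not enlarge coefficients, so every iterated
primitive converges wherever the original series does. -/
lemma norm_primCoeff_le {a : ℤ → ℂ} (h0 : a 0 = 0) (k : ℕ) (m : ℤ) :
    ‖primCoeff a k m‖ ≤ ‖a m‖ := by
  rcases eq_or_ne m 0 with rfl | hm
  · simp [primCoeff, h0]
  · rw [primCoeff, norm_div, norm_pow]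
    exact div_le_self (norm_nonneg _) (one_le_pow₀ (one_le_norm_two_pi_I_mul hm))

lemma primCoeff_succ {a : ℤ → ℂ} (h0 : a 0 = 0) (k : ℕ) (m : ℤ) :
    2 * Real.pi * Complex.I * m * primCoeff a (k + 1) m = primCoeff a k m := by
  rcases eq_or_ne m 0 with rfl | hm
  · simp [primCoeff, h0]
  · have : (2 * Real.pi * Complex.I * m : ℂ) ≠ 0 := by
      simp [Real.pi_ne_zero, hm]
    rw [primCoeff, primCoeff, pow_succ]
    field_simp

lemma hasQExpansion_primCoeff {f : ℍ → ℂ} {a : ℤ → ℂ} (h : HasQExpansion f a) (h0 : a 0 = 0)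
    (k : ℕ) : HasQExpansion (qSeries (primCoeff a k)) (primCoeff a k) :=
  hasQExpansion_qSeries fun z ↦ (h z).summable.norm.of_norm_bounded fun m ↦ by
    rw [norm_mul, norm_mul]
    exact mul_le_mul_of_nonneg_right (norm_primCoeff_le h0 k m) (norm_nonneg _)

lemma hasDerivH_qSeries_primCoeff {f : ℍ → ℂ} {a : ℤ → ℂ} (h : HasQExpansion f a) (h0 : a 0 = 0)
    (k : ℕ) : HasDerivH (qSeries (primCoeff a (k + 1))) (qSeries (primCoeff a k)) := by
  obtain ⟨f', h1, h2⟩ := exists_hasDerivH_hasQExpansion (hasQExpansion_primCoeff h h0 (k + 1))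
  simp only [primCoeff_succ h0] at h2
  rwa [← h2.eq_qSeries]

lemma qSeries_primCoeff_zero {f : ℍ → ℂ} {a : ℤ → ℂ} (h : HasQExpansion f a) :
    qSeries (primCoeff a 0) = f := by
  have : primCoeff a 0 = a := by ext m; simp [primCoeff]
  rw [this, h.eq_qSeries]

/-- Integrating the series times exp(-2πi m x) over the horizontal unit segment through i isolates
the coefficient of index m. -/
lemma eq_zero_of_hasQExpansion_zero {a : ℤ → ℂ} (h : HasQExpansion (fun _ ↦ 0) a) : a = 0 := by
  ext m
  let z : ℝ → ℍ := fun x ↦ x +ᵥ UpperHalfPlane.I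
  have hz : ∀ (k : ℤ) (x : ℝ), nome (z x) ^ k =
      nome UpperHalfPlane.I ^ k * Complex.exp (2 * Real.pi * Complex.I * k * x) := fun k x ↦ by
    rw [nome_zpow, nome_zpow, ← Complex.exp_add]
    congr 1
    simp only [z, coe_vadd]
    ring
  have hn : ∀ (k : ℤ) (x : ℝ), ‖Complex.exp (2 * Real.pi * Complex.I * k * x)‖ = 1 := fun k x ↦ by
    have : (2 * Real.pi * Complex.I * k * x : ℂ) = ((2 * Real.pi * k * x : ℝ) : ℂ) * Complex.I := by
      push_cast; ring
    rw [this, Complex.norm_exp_ofReal_mul_I]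
  let G : ℤ → ℝ → ℂ := fun k x ↦
    a k * nome UpperHalfPlane.I ^ k * Complex.exp (2 * Real.pi * Complex.I * (k - m : ℤ) * x)
  have hG : ∀ x, HasSum (fun k ↦ G k x) 0 := fun x ↦ by
    have := (h (z x)).mul_right (Complex.exp (2 * Real.pi * Complex.I * (-m : ℤ) * x))
    rw [zero_mul] at this
    refine (hasSum_congr_fun fun k ↦ ?_).mp this
    have e : (2 * Real.pi * Complex.I * (k - m : ℤ) * x : ℂ) =
      2 * Real.pi * Complex.I * k * x + 2 * Real.pi * Complex.I * (-m : ℤ) * x := by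
      push_cast; ring
    simp only [G]
    rw [hz, e, Complex.exp_add]
    ring
  have key := intervalIntegral.hasSum_integral_of_dominated_convergence (μ := MeasureTheory.volume)
    (a := 0) (b := 1) (F := G)
    (f := fun _ ↦ 0) (fun k _ ↦ ‖a k * nome UpperHalfPlane.I ^ k‖)
    (fun k ↦ (by fun_prop : Continuous (G k)).aestronglyMeasurable)
    (fun k ↦ Filter.Eventually.of_forall fun x _ ↦ by
      simp only [G]; rw [norm_mul, hn, mul_one])
    (Filter.Eventually.of_forall fun x _ ↦ (h UpperHalfPlane.I).summable.norm)
    (by simp)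
    (Filter.Eventually.of_forall fun x _ ↦ hG x)
  have hint : ∀ k, ∫ x in (0 : ℝ)..1, G k x =
      if k = m then a m * nome UpperHalfPlane.I ^ m else 0 := by
    intro k
    simp only [G]
    rw [intervalIntegral.integral_const_mul]
    split_ifs with hk
    · subst hk
      simp
    · have hc : (2 * Real.pi * Complex.I * (k - m : ℤ) : ℂ) ≠ 0 := by
        simp [Real.pi_ne_zero]
        exact_mod_cast sub_ne_zero.2 hk
      rw [integral_exp_mul_complex hc]
      have : Complex.exp (2 * Real.pi * Complex.I * (k - m : ℤ) * (1 : ℝ)) = 1 := by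
        rw [Complex.exp_eq_one_iff]
        exact ⟨k - m, by push_cast; ring⟩
      rw [this]
      simp
  simp only [hint, intervalIntegral.integral_zero] at key
  have := key.unique (hasSum_ite_eq m _)
  simpa [nome_ne_zero, zpow_ne_zero] using this.symm

lemma HasQExpansion.unique {f : ℍ → ℂ} {a b : ℤ → ℂ} (ha : HasQExpansion f a)
    (hb : HasQExpansion f b) : a = b := by
  have := ha.sub hb
  simp only [sub_self] at this
  exact sub_eq_zero.1 (eq_zero_of_hasQExpansion_zero this)

/-- Multiplication by q^N passes from a Laurent series to a power series in q, the form used by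
`qExpansion`. -/
lemma hasSum_int_iff_nat {a : ℤ → ℂ} {N : ℤ} (ha : ∀ m < -N, a m = 0) (z : ℍ) (s : ℂ) :
    HasSum (fun m : ℤ ↦ a m * nome z ^ m) s ↔
      HasSum (fun k : ℕ ↦ a (k - N) * nome z ^ k) (nome z ^ N * s) := by
  have hinj : Function.Injective fun k : ℕ ↦ (k : ℤ) - N := fun i j hij ↦ by
    simpa using hij
  rw [← hinj.hasSum_iff, ← hasSum_mul_left_iff (zpow_ne_zero N (nome_ne_zero z))]
  · refine hasSum_congr_fun fun k ↦ ?_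
    simp only [Function.comp]
    rw [mul_left_comm, ← zpow_add₀ (nome_ne_zero z)]
    simp
  · intro m hm
    rw [ha, zero_mul]
    by_contra! hc
    refine hm ⟨(m + N).toNat, ?_⟩
    simp only
    omega

lemma isBoundedAtImInfty_of_hasQExpansion {f : ℍ → ℂ} {a : ℤ → ℂ} {N : ℤ}
    (ha : ∀ m < -N, a m = 0) (h : HasQExpansion f a) :
    IsBoundedAtImInfty (fun z ↦ nome z ^ N * f z) := by
  refine isBoundedAtImInfty_of_hasSum_qExpansion (c := fun k ↦ a (k - N)) one_pos fun z ↦ ?_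
  simpa [nome_eq_qParam] using (hasSum_int_iff_nat ha z (f z)).1 (h z)

/-- After multiplication by q^N the function is holomorphic, 1-periodic and bounded near the cusp,
hence a power series in q. Meromorphy at the cusp can thus be tested by growth alone. -/
lemma exists_hasQExpansion_of_isBoundedAtImInfty {f : ℍ → ℂ}
    (hd : DifferentiableOn ℂ (f ∘ ofComplex) {z : ℂ | 0 < z.im})
    (hper : ∀ z : ℍ, f ((1 : ℝ) +ᵥ z) = f z) (N : ℤ)
    (hb : IsBoundedAtImInfty (fun z ↦ nome z ^ N * f z)) :
    ∃ a : ℤ → ℂ, (∀ m < -N, a m = 0) ∧ HasQExpansion f a := by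
  set g : ℍ → ℂ := fun z ↦ nome z ^ N * f z with hg
  have hgd : MDiff g := by
    rw [UpperHalfPlane.mdifferentiable_iff]
    refine DifferentiableOn.mul (a := fun w ↦ (fun z : ℍ ↦ nome z ^ N) (ofComplex w)) ?_ hd
    have : HasDerivH (fun z ↦ nome z ^ N) _ := hasDerivH_of_hasDerivAt
      (f := fun w ↦ Complex.exp (2 * Real.pi * Complex.I * N * w)) (f' := fun w ↦ _) (fun w ↦
        (((hasDerivAt_id w).const_mul (2 * Real.pi * Complex.I * N : ℂ)).cexp)) |> fun h ↦ by
          simpa only [nome_zpow] using h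
    exact this.differentiableOn
  have hgp : Function.Periodic (g ∘ ofComplex) ((1 : ℝ) : ℂ) := by
    intro w
    by_cases hw : 0 < w.im
    · have h1 : 0 < (w + (1 : ℝ)).im := by simpa using hw
      have h2 : ofComplex (w + (1 : ℝ)) = (1 : ℝ) +ᵥ ofComplex w := by
        ext
        rw [coe_ofComplex h1, coe_vadd, coe_ofComplex hw]
        ring
      simp only [Function.comp, h2, hg, hper, nome_vadd_one]
    · have h1 : (w + (1 : ℝ)).im ≤ 0 := by simpa using hw
      simp only [Function.comp]
      rw [ofComplex_apply_eq_of_im_nonpos h1 (not_lt.1 hw)]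
  have key := hasSum_qExpansion one_pos hgp hgd hb
  let a : ℤ → ℂ := fun m ↦ if m < -N then 0 else (qExpansion 1 g).coeff (m + N).toNat
  have ha : ∀ m < -N, a m = 0 := fun m hm ↦ if_pos hm
  refine ⟨a, ha, fun z ↦ (hasSum_int_iff_nat ha z (f z)).2 ?_⟩
  refine (hasSum_congr_fun fun k ↦ ?_).mp (key z)
  have : ¬ ((k : ℤ) - N < -N) := by omega
  simp [a, nome_eq_qParam]

/-! ### Modularity -/

/-- The automorphy factor `c z + d`. -/
def aut (γ : SL(2, ℤ)) (z : ℍ) : ℂ := (γ 1 0 : ℂ) * z + (γ 1 1 : ℂ)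

lemma aut_eq_denom (γ : SL(2, ℤ)) (z : ℍ) : aut γ z = denom γ z :=
  (ModularGroup.denom_apply γ z).symm

lemma aut_ne_zero (γ : SL(2, ℤ)) (z : ℍ) : aut γ z ≠ 0 := by
  rw [aut_eq_denom]
  exact denom_ne_zero _ z

lemma coe_smul (γ : SL(2, ℤ)) (z : ℍ) :
    ((γ • z : ℍ) : ℂ) = ((γ 0 0 : ℂ) * z + (γ 0 1 : ℂ)) / aut γ z := by
  rw [specialLinearGroup_apply]
  simp [aut]

lemma det_eq_one (γ : SL(2, ℤ)) : (γ 0 0 : ℂ) * γ 1 1 - γ 0 1 * γ 1 0 = 1 := by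
  have := γ.det_coe
  rw [Matrix.det_fin_two] at this
  exact_mod_cast this

lemma isModularOfWeights_iff {r s : ℤ} {f : ℍ → ℂ} : IsModularOfWeights r s f ↔
    ∀ (γ : SL(2, ℤ)) (z : ℍ), f (γ • z) = aut γ z ^ r * conj (aut γ z) ^ s * f z := by
  simp [IsModularOfWeights, aut]

lemma isModularOfWeights_zero_iff {k : ℤ} {f : ℍ → ℂ} : IsModularOfWeights k 0 f ↔
    ∀ (γ : SL(2, ℤ)) (z : ℍ), f (γ • z) = aut γ z ^ k * f z := by
  simp [isModularOfWeights_iff]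

lemma isModularOfWeights_iff_slash {k : ℤ} {f : ℍ → ℂ} : IsModularOfWeights k 0 f ↔
    ∀ γ : SL(2, ℤ), f ∣[k] γ = f := by
  rw [isModularOfWeights_zero_iff]
  refine forall_congr' fun γ ↦ ?_
  rw [funext_iff]
  refine forall_congr' fun z ↦ ?_
  rw [ModularForm.SL_slash_apply, ← aut_eq_denom, zpow_neg,
    mul_inv_eq_iff_eq_mul₀ (zpow_ne_zero _ (aut_ne_zero γ z)), mul_comm (f z)]

lemma IsModularOfWeights.vadd_one {r s : ℤ} {f : ℍ → ℂ} (h : IsModularOfWeights r s f) (z : ℍ) :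
    f ((1 : ℝ) +ᵥ z) = f z := by
  have := h ModularGroup.T z
  rw [modular_T_smul] at this
  simpa [ModularGroup.T] using this

/-- The matrix -1 acts trivially on the upper half-plane but has automorphy factor (-1)^(r+s). -/
lemma IsModularOfWeights.eq_zero_of_odd {r s : ℤ} {f : ℍ → ℂ} (h : IsModularOfWeights r s f)
    (hrs : Odd (r + s)) : f = 0 := by
  ext z
  have := h (-1) z
  rw [ModularGroup.SL_neg_smul, one_smul] at this
  simp only [Matrix.SpecialLinearGroup.coe_neg, Matrix.SpecialLinearGroup.coe_one, Matrix.neg_apply,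
    Matrix.one_apply_eq, ne_eq, one_ne_zero, not_false_eq_true, Matrix.one_apply_ne, neg_zero,
    Int.cast_zero, zero_mul, Int.cast_neg, Int.cast_one, zero_add] at this
  rw [← zpow_add₀ (by norm_num), hrs.neg_one_zpow, neg_one_mul, self_eq_neg] at this
  simpa using this

lemma IsModularOfWeights.mul {r s r' s' : ℤ} {f g : ℍ → ℂ} (hf : IsModularOfWeights r s f)
    (hg : IsModularOfWeights r' s' g) : IsModularOfWeights (r + r') (s + s') (fun z ↦ f z * g z) := by
  rw [isModularOfWeights_iff] at *
  intro γ z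
  have h1 := aut_ne_zero γ z
  have h2 : conj (aut γ z) ≠ 0 := by simpa using h1
  rw [hf, hg, zpow_add₀ h1, zpow_add₀ h2]
  ring

lemma IsModularOfWeights.pow {r s : ℤ} {f : ℍ → ℂ} (hf : IsModularOfWeights r s f) (n : ℕ) :
    IsModularOfWeights (r * n) (s * n) (fun z ↦ f z ^ n) := by
  rw [isModularOfWeights_iff] at *
  intro γ z
  rw [hf, mul_pow, mul_pow, ← zpow_natCast, ← zpow_natCast, zpow_mul, zpow_mul]

lemma IsModularOfWeights.inv {r s : ℤ} {f : ℍ → ℂ} (hf : IsModularOfWeights r s f) :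
    IsModularOfWeights (-r) (-s) (fun z ↦ (f z)⁻¹) := by
  rw [isModularOfWeights_iff] at *
  intro γ z
  rw [hf, mul_inv, mul_inv, zpow_neg, zpow_neg]

lemma IsModularOfWeights.add {r s : ℤ} {f g : ℍ → ℂ} (hf : IsModularOfWeights r s f)
    (hg : IsModularOfWeights r s g) : IsModularOfWeights r s (fun z ↦ f z + g z) := fun γ z ↦ by
  simp only
  rw [hf, hg, mul_add]

lemma IsModularOfWeights.const_mul {r s : ℤ} {f : ℍ → ℂ} (c : ℂ) (hf : IsModularOfWeights r s f) :
    IsModularOfWeights r s (fun z ↦ c * f z) := fun γ z ↦ by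
  simp only
  rw [hf]
  ring

lemma hasDerivH_comp_smul {f f' : ℍ → ℂ} (h : HasDerivH f f') (γ : SL(2, ℤ)) :
    HasDerivH (fun z ↦ f (γ • z)) (fun z ↦ f' (γ • z) / aut γ z ^ 2) := fun z ↦ by
  let m : ℂ → ℂ := fun w ↦ ((γ 0 0 : ℂ) * w + γ 0 1) / ((γ 1 0 : ℂ) * w + γ 1 1)
  have hz : (γ 1 0 : ℂ) * z + γ 1 1 ≠ 0 := aut_ne_zero γ z
  have hm : HasDerivAt m (1 / aut γ z ^ 2) z := by
    refine (((hasDerivAt_id (z : ℂ)).const_mul (γ 0 0 : ℂ)).add_const (γ 0 1 : ℂ) |>.div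
      (((hasDerivAt_id (z : ℂ)).const_mul (γ 1 0 : ℂ)).add_const (γ 1 1 : ℂ)) hz).congr_deriv ?_
    simp only [id, aut]
    congr 1
    linear_combination det_eq_one γ
  have hmz : m z = ((γ • z : ℍ) : ℂ) := by rw [coe_smul]; rfl
  have hd := h (γ • z)
  rw [← hmz] at hd
  refine ((hd.comp (z : ℂ) hm).congr_deriv (by ring)).congr_of_eventuallyEq ?_
  filter_upwards [eventually_im_pos z] with w hw
  have : m w = ((γ • ofComplex w : ℍ) : ℂ) := by
    rw [coe_smul, aut, coe_ofComplex hw]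
  simp [this]

/-! ### Weakly holomorphic forms -/

lemma isWeaklyHolomorphic_of_isBoundedAtImInfty {k : ℤ} {f : ℍ → ℂ}
    (hd : DifferentiableOn ℂ (f ∘ ofComplex) {z : ℂ | 0 < z.im}) (hm : IsModularOfWeights k 0 f)
    (N : ℤ) (hb : IsBoundedAtImInfty (fun z ↦ nome z ^ N * f z)) : IsWeaklyHolomorphic k f :=
  ⟨hd, hm, N, exists_hasQExpansion_of_isBoundedAtImInfty hd hm.vadd_one N hb⟩

lemma IsWeaklyHolomorphic.eq_zero_of_odd {k : ℤ} {f : ℍ → ℂ} (h : IsWeaklyHolomorphic k f)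
    (hk : Odd k) : f = 0 := h.2.1.eq_zero_of_odd (by simpa using hk)

lemma IsWeaklyHolomorphic.add {k : ℤ} {f g : ℍ → ℂ} (hf : IsWeaklyHolomorphic k f)
    (hg : IsWeaklyHolomorphic k g) : IsWeaklyHolomorphic k (fun z ↦ f z + g z) := by
  obtain ⟨hf1, hf2, N, a, ha, ha'⟩ := hf
  obtain ⟨hg1, hg2, M, b, hb, hb'⟩ := hg
  refine ⟨hf1.add hg1, hf2.add hg2, max N M, _, fun m hm ↦ ?_, ha'.add hb'⟩
  rw [ha m (by omega), hb m (by omega), add_zero]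

lemma IsWeaklyHolomorphic.const_mul {k : ℤ} {f : ℍ → ℂ} (c : ℂ) (hf : IsWeaklyHolomorphic k f) :
    IsWeaklyHolomorphic k (fun z ↦ c * f z) := by
  obtain ⟨hf1, hf2, N, a, ha, ha'⟩ := hf
  refine ⟨hf1.const_mul c, hf2.const_mul c, N, _, fun m hm ↦ ?_, ha'.const_mul c⟩
  rw [ha m hm, mul_zero]

lemma IsWeaklyHolomorphic.sub {k : ℤ} {f g : ℍ → ℂ} (hf : IsWeaklyHolomorphic k f)
    (hg : IsWeaklyHolomorphic k g) : IsWeaklyHolomorphic k (fun z ↦ f z - g z) := by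
  simpa [sub_eq_add_neg] using hf.add (hg.const_mul (-1))

lemma isWeaklyHolomorphic_zero (k : ℤ) : IsWeaklyHolomorphic k (0 : ℍ → ℂ) :=
  ⟨differentiableOn_const 0, fun _ _ ↦ by simp, 0, 0, by simp, fun _ ↦ by simp⟩

/-! ### Comparison with holomorphic modular forms and cusp forms -/

lemma modularForm_isModularOfWeights {k : ℤ} (F : ModularForm 𝒮ℒ k) :
    IsModularOfWeights k 0 F :=
  isModularOfWeights_iff_slash.2 fun γ ↦ F.slash_action_eq' _ ⟨γ, rfl⟩

lemma exists_modularForm_eq {k : ℤ} {f : ℍ → ℂ}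
    (hd : DifferentiableOn ℂ (f ∘ ofComplex) {z : ℂ | 0 < z.im}) (hm : IsModularOfWeights k 0 f)
    (hb : IsBoundedAtImInfty f) : ∃ F : ModularForm 𝒮ℒ k, (F : ℍ → ℂ) = f := by
  have hs := isModularOfWeights_iff_slash.1 hm
  refine ⟨{ toFun := f
            slash_action_eq' := fun _ ⟨γ, hγ⟩ ↦ hγ ▸ hs γ
            holo' := UpperHalfPlane.mdifferentiable_iff.2 hd
            bdd_at_cusps' := fun {c} hc ↦ ?_ }, rfl⟩
  -- All cusps are equivalent to infinity and f is invariant under slashing, so boundedness at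
  -- infinity gives boundedness at every cusp.
  rw [Subgroup.IsArithmetic.isCusp_iff_isCusp_SL2Z] at hc
  rw [OnePoint.isBoundedAt_iff_forall_SL2Z hc]
  intro γ _
  simpa [hs γ] using! hb

lemma modularForm_differentiableOn {k : ℤ} (F : ModularForm 𝒮ℒ k) :
    DifferentiableOn ℂ ((F : ℍ → ℂ) ∘ ofComplex) {z : ℂ | 0 < z.im} :=
  UpperHalfPlane.mdifferentiable_iff.1 F.holo'

lemma modularForm_isBoundedAtImInfty {k : ℤ} (F : ModularForm 𝒮ℒ k) :
    IsBoundedAtImInfty (F : ℍ → ℂ) := ModularFormClass.bdd_at_infty F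

lemma hasQExpansion_cuspForm {k : ℤ} (f : CuspForm 𝒮ℒ k) : HasQExpansion f
    fun m ↦ if 0 ≤ m then (qExpansion 1 (f : ℍ → ℂ)).coeff m.toNat else 0 := fun z ↦ by
  rw [hasSum_int_iff_nat (N := 0) (fun m hm ↦ if_neg (by omega))]
  simpa [nome_eq_qParam] using
    ModularForm.hasSum_qExpansion f one_pos one_mem_strictPeriods_SL z

lemma cuspForm_isWeakCuspForm {k : ℤ} (f : CuspForm 𝒮ℒ k) : IsWeakCuspForm k f := by
  have hd : DifferentiableOn ℂ ((f : ℍ → ℂ) ∘ ofComplex) {z : ℂ | 0 < z.im} :=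
    UpperHalfPlane.mdifferentiable_iff.1 f.holo'
  have hm : IsModularOfWeights k 0 f :=
    isModularOfWeights_iff_slash.2 fun γ ↦ f.slash_action_eq' _ ⟨γ, rfl⟩
  have hb : IsBoundedAtImInfty (fun z ↦ nome z ^ (0 : ℤ) * f z) := by
    simpa using ModularFormClass.bdd_at_infty f
  refine ⟨isWeaklyHolomorphic_of_isBoundedAtImInfty hd hm 0 hb, _, hasQExpansion_cuspForm f, ?_⟩
  simpa using CuspFormClass.qExpansion_coeff_zero f one_pos one_mem_strictPeriods_SL

/-! ### Division by powers of the discriminant -/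

local notation "Δ" => ModularForm.discriminant

lemma discriminant_isModularOfWeights : IsModularOfWeights 12 0 Δ :=
  (cuspForm_isWeakCuspForm CuspForm.discriminant).1.2.1

lemma discriminant_differentiableOn :
    DifferentiableOn ℂ ((Δ : ℍ → ℂ) ∘ ofComplex) {z : ℂ | 0 < z.im} :=
  (cuspForm_isWeakCuspForm CuspForm.discriminant).1.1

lemma isBoundedAtImInfty_nome_mul_inv_discriminant :
    IsBoundedAtImInfty (fun z ↦ nome z * (Δ z)⁻¹) := by
  have h : nome =O[atImInfty] Δ :=
    (Asymptotics.isBigO_of_le _ fun z ↦ by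
      rw [norm_nome, Real.norm_eq_abs, Real.abs_exp]
      exact Real.exp_le_exp.2 (by linarith)).trans ModularForm.exp_isBigO_discriminant
  refine (h.mul (Asymptotics.isBigO_refl (fun z ↦ (Δ z)⁻¹) _)).trans
    (Asymptotics.isBigO_of_le _ fun z ↦ ?_)
  simp [mul_inv_cancel₀ (ModularForm.discriminant_ne_zero z)]

lemma isBoundedAtImInfty_inv_nome_mul_discriminant :
    IsBoundedAtImInfty (fun z ↦ (nome z)⁻¹ * Δ z) := by
  have := isBoundedAtImInfty_of_hasQExpansion (N := -1) (fun m hm ↦ ?_)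
    (hasQExpansion_cuspForm CuspForm.discriminant)
  · simpa using! this
  · rcases lt_or_ge m 0 with h | h
    · simp [h]
    · obtain rfl : m = 0 := by omega
      simpa using CuspFormClass.qExpansion_coeff_zero CuspForm.discriminant one_pos
        one_mem_strictPeriods_SL

lemma isBoundedAtImInfty_pow {f : ℍ → ℂ} (hf : IsBoundedAtImInfty f) (n : ℕ) :
    IsBoundedAtImInfty (fun z ↦ f z ^ n) := by
  induction n with
  | zero => simpa only [pow_zero] using! const_boundedAtFilter atImInfty (1 : ℂ)
  | succ n ih => simpa only [pow_succ] using! ih.mul hf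

/-- The form `F / Δ ^ d`. -/
def divDiscPow (d : ℕ) (F : ℍ → ℂ) (z : ℍ) : ℂ := F z * (Δ z)⁻¹ ^ d

/-- The discriminant has no zeros in the upper half-plane and a simple zero at the cusp. Together
with `exists_modularForm_of_order` this identifies forms of weight k with a pole of order at most d
with the finite-dimensional space of holomorphic forms of weight k + 12 d. -/
lemma isWeaklyHolomorphic_divDiscPow {k : ℤ} (d : ℕ) (F : ModularForm 𝒮ℒ (k + 12 * d)) :
    IsWeaklyHolomorphic k (divDiscPow d F) ∧
      ∃ a : ℤ → ℂ, HasQExpansion (divDiscPow d F) a ∧ ∀ m < -(d : ℤ), a m = 0 := by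
  have hd : DifferentiableOn ℂ (divDiscPow d F ∘ ofComplex) {z : ℂ | 0 < z.im} :=
    (modularForm_differentiableOn F).mul ((discriminant_differentiableOn.inv
      fun z _ ↦ ModularForm.discriminant_ne_zero _).pow d)
  have hm : IsModularOfWeights k 0 (divDiscPow d F) := by
    have := (modularForm_isModularOfWeights F).mul (discriminant_isModularOfWeights.inv.pow d)
    convert! this using 1 <;> ring
  have hb : IsBoundedAtImInfty (fun z ↦ nome z ^ (d : ℤ) * divDiscPow d F z) := by
    have := (modularForm_isBoundedAtImInfty F).mul
      (isBoundedAtImInfty_pow isBoundedAtImInfty_nome_mul_inv_discriminant d)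
    refine this.congr_left fun z ↦ ?_
    simp only [Pi.mul_apply, divDiscPow, mul_pow, zpow_natCast]
    ring
  obtain ⟨a, ha, ha'⟩ := exists_hasQExpansion_of_isBoundedAtImInfty hd hm.vadd_one d hb
  exact ⟨⟨hd, hm, d, a, ha, ha'⟩, a, ha', ha⟩

lemma exists_modularForm_of_order {k : ℤ} {d : ℕ} {f : ℍ → ℂ} (hf : IsWeaklyHolomorphic k f)
    {a : ℤ → ℂ} (ha : HasQExpansion f a) (h0 : ∀ m < -(d : ℤ), a m = 0) :
    ∃ F : ModularForm 𝒮ℒ (k + 12 * d), f = divDiscPow d F := by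
  obtain ⟨F, hF⟩ := exists_modularForm_eq (k := k + 12 * d) (f := fun z ↦ f z * Δ z ^ d)
    (hf.1.mul (discriminant_differentiableOn.pow d))
    (by
      have := hf.2.1.mul (discriminant_isModularOfWeights.pow d)
      convert! this using 1
      ring)
    (by
      have := (isBoundedAtImInfty_of_hasQExpansion h0 ha).mul
        (isBoundedAtImInfty_pow isBoundedAtImInfty_inv_nome_mul_discriminant d)
      refine this.congr_left fun z ↦ ?_
      have := nome_ne_zero z
      simp only [Pi.mul_apply, mul_pow, zpow_natCast, inv_pow]
      field_simp)
  refine ⟨F, funext fun z ↦ ?_⟩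
  have := ModularForm.discriminant_ne_zero z
  rw [divDiscPow, hF]
  simp only
  rw [mul_assoc, ← mul_pow, mul_inv_cancel₀ this, one_pow, mul_one]

/-! ### The action on polynomials -/

/-- Evaluation of a polynomial at `(X, Y) = (x, y)`. -/
def ev (x y : ℂ) (P : MvPolynomial (Fin 2) ℂ) : ℂ := MvPolynomial.eval ![x, y] P

/-- The substitution `(X, Y) ↦ M (X, Y)` for a complex matrix `M`. -/
def actC (M : Matrix (Fin 2) (Fin 2) ℂ) : MvPolynomial (Fin 2) ℂ →ₐ[ℂ] MvPolynomial (Fin 2) ℂ :=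
  MvPolynomial.aeval
    (fun i : Fin 2 ↦ MvPolynomial.C (M i 0) * MvPolynomial.X 0 +
      MvPolynomial.C (M i 1) * MvPolynomial.X 1)

lemma act_eq_actC (P : MvPolynomial (Fin 2) ℂ) (γ : Matrix (Fin 2) (Fin 2) ℤ) :
    act P γ = actC (γ.map (Int.castRingHom ℂ)) P := rfl

lemma ext_ev {P Q : MvPolynomial (Fin 2) ℂ} (h : ∀ x y, ev x y P = ev x y Q) : P = Q := by
  refine MvPolynomial.funext fun v ↦ ?_
  have : v = ![v 0, v 1] := by ext i; fin_cases i <;> rfl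
  rw [this]
  exact h _ _

@[simp] lemma ev_add (x y : ℂ) (P Q : MvPolynomial (Fin 2) ℂ) :
    ev x y (P + Q) = ev x y P + ev x y Q := map_add _ _ _

@[simp] lemma ev_sub (x y : ℂ) (P Q : MvPolynomial (Fin 2) ℂ) :
    ev x y (P - Q) = ev x y P - ev x y Q := map_sub _ _ _

@[simp] lemma ev_mul (x y : ℂ) (P Q : MvPolynomial (Fin 2) ℂ) :
    ev x y (P * Q) = ev x y P * ev x y Q := map_mul _ _ _

@[simp] lemma ev_pow (x y : ℂ) (P : MvPolynomial (Fin 2) ℂ) (n : ℕ) :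
    ev x y (P ^ n) = ev x y P ^ n := map_pow _ _ _

@[simp] lemma ev_zero (x y : ℂ) : ev x y 0 = 0 := map_zero _

@[simp] lemma ev_smul (x y c : ℂ) (P : MvPolynomial (Fin 2) ℂ) :
    ev x y (c • P) = c * ev x y P := MvPolynomial.smul_eval _ _ _

@[simp] lemma ev_C (x y c : ℂ) : ev x y (MvPolynomial.C c) = c := MvPolynomial.eval_C _

@[simp] lemma ev_X_zero (x y : ℂ) : ev x y (MvPolynomial.X 0) = x := by simp [ev]

@[simp] lemma ev_X_one (x y : ℂ) : ev x y (MvPolynomial.X 1) = y := by simp [ev]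

@[simp] lemma ev_sum {ι : Type*} (s : Finset ι) (x y : ℂ) (P : ι → MvPolynomial (Fin 2) ℂ) :
    ev x y (∑ i ∈ s, P i) = ∑ i ∈ s, ev x y (P i) := map_sum _ _ _

@[simp] lemma ev_actC (x y : ℂ) (M : Matrix (Fin 2) (Fin 2) ℂ) (P : MvPolynomial (Fin 2) ℂ) :
    ev x y (actC M P) = ev (M 0 0 * x + M 0 1 * y) (M 1 0 * x + M 1 1 * y) P := by
  rw [ev, actC, MvPolynomial.aeval_def, MvPolynomial.eval₂_eq_eval_map]
  induction P using MvPolynomial.induction_on with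
  | C a => simp [ev]
  | add p q hp hq => simp only [map_add, hp, hq, ev_add]
  | mul_X p i hp =>
    simp only [map_mul, hp, ev_mul]
    congr 1
    fin_cases i <;> simp [ev]

@[simp] lemma ev_act (x y : ℂ) (γ : Matrix (Fin 2) (Fin 2) ℤ) (P : MvPolynomial (Fin 2) ℂ) :
    ev x y (act P γ) = ev (γ 0 0 * x + γ 0 1 * y) (γ 1 0 * x + γ 1 1 * y) P := by
  simp [act_eq_actC]

lemma actC_actC (M N : Matrix (Fin 2) (Fin 2) ℂ) (P : MvPolynomial (Fin 2) ℂ) :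
    actC N (actC M P) = actC (M * N) P := ext_ev fun x y ↦ by
  simp only [ev_actC, Matrix.mul_apply, Fin.sum_univ_two]
  congr 1 <;> ring

lemma act_act (γ δ : Matrix (Fin 2) (Fin 2) ℤ) (P : MvPolynomial (Fin 2) ℂ) :
    act (act P γ) δ = act P (γ * δ) := by
  simp only [act_eq_actC, actC_actC, Matrix.map_mul]

lemma act_one (P : MvPolynomial (Fin 2) ℂ) : act P 1 = P := ext_ev fun x y ↦ by simp

lemma act_add (P Q : MvPolynomial (Fin 2) ℂ) (γ : Matrix (Fin 2) (Fin 2) ℤ) :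
    act (P + Q) γ = act P γ + act Q γ := by
  simp only [act_eq_actC, map_add]

lemma act_sub (P Q : MvPolynomial (Fin 2) ℂ) (γ : Matrix (Fin 2) (Fin 2) ℤ) :
    act (P - Q) γ = act P γ - act Q γ := by
  simp only [act_eq_actC, map_sub]

lemma act_smul (c : ℂ) (P : MvPolynomial (Fin 2) ℂ) (γ : Matrix (Fin 2) (Fin 2) ℤ) :
    act (c • P) γ = c • act P γ := by
  simp only [act_eq_actC, map_smul]

lemma act_zero (γ : Matrix (Fin 2) (Fin 2) ℤ) : act 0 γ = 0 := by
  simp only [act_eq_actC, map_zero]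

/-- The space `V_n` of homogeneous polynomials of degree `n`. -/
abbrev homog (n : ℕ) : Submodule ℂ (MvPolynomial (Fin 2) ℂ) :=
  MvPolynomial.homogeneousSubmodule (Fin 2) ℂ n

lemma C_mul_mem_homog {n : ℕ} {P : MvPolynomial (Fin 2) ℂ} (c : ℂ) (h : P ∈ homog n) :
    MvPolynomial.C c * P ∈ homog n := by
  rw [← MvPolynomial.smul_eq_C_mul]
  exact Submodule.smul_mem _ _ h

lemma linear_mem_homog (a b : ℂ) : MvPolynomial.C a * MvPolynomial.X 0 +
    MvPolynomial.C b * MvPolynomial.X 1 ∈ homog 1 :=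
  Submodule.add_mem _ (C_mul_mem_homog _ (MvPolynomial.isHomogeneous_X ..))
    (C_mul_mem_homog _ (MvPolynomial.isHomogeneous_X ..))

lemma monomial_mul_mem_homog {n j : ℕ} (hj : j ≤ n) {P Q : MvPolynomial (Fin 2) ℂ}
    (hP : P ∈ homog 1) (hQ : Q ∈ homog 1) : P ^ (n - j) * Q ^ j ∈ homog n := by
  have hP' : MvPolynomial.IsHomogeneous P 1 := hP
  have hQ' : MvPolynomial.IsHomogeneous Q 1 := hQ
  have := (hP'.pow (n - j)).mul (hQ'.pow j)
  rwa [show 1 * (n - j) + 1 * j = n by omega] at this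

lemma actC_mem_homog {n : ℕ} {P : MvPolynomial (Fin 2) ℂ} (M : Matrix (Fin 2) (Fin 2) ℂ)
    (h : P ∈ homog n) : actC M P ∈ homog n := by
  have := MvPolynomial.IsHomogeneous.aeval (n := 1) (show MvPolynomial.IsHomogeneous P n from h)
    (fun i : Fin 2 ↦ MvPolynomial.C (M i 0) * MvPolynomial.X 0 +
      MvPolynomial.C (M i 1) * MvPolynomial.X 1) (fun i ↦ linear_mem_homog _ _)
  rwa [one_mul] at this

lemma act_mem_homog {n : ℕ} {P : MvPolynomial (Fin 2) ℂ} (γ : Matrix (Fin 2) (Fin 2) ℤ)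
    (h : P ∈ homog n) : act P γ ∈ homog n := by
  rw [act_eq_actC]
  exact actC_mem_homog _ h

lemma ev_homog {n : ℕ} {P : MvPolynomial (Fin 2) ℂ} (h : P ∈ homog n) (t x y : ℂ) :
    ev (t * x) (t * y) P = t ^ n * ev x y P := by
  rw [ev, ev, MvPolynomial.eval_eq', MvPolynomial.eval_eq', Finset.mul_sum]
  refine Finset.sum_congr rfl fun d hd ↦ ?_
  have hdn : d 0 + d 1 = n := by
    have := MvPolynomial.IsHomogeneous.degree_eq_sum_deg_support
      (show MvPolynomial.IsHomogeneous P n from h) hd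
    rw [Finset.sum_subset (Finset.subset_univ d.support)
      (fun i _ hi ↦ Finsupp.notMem_support_iff.1 hi), Fin.sum_univ_two] at this
    exact this.symm
  simp only [Fin.prod_univ_two, Matrix.cons_val_zero, Matrix.cons_val_one, mul_pow, ← hdn, pow_add]
  ring

/-! ### Primitives of `f(z) (X - z Y) ^ n` -/

/-- `B` is a primitive of `f(z) (X - z Y) ^ n dz`. -/
def IsPrimitive (n : ℕ) (f : ℍ → ℂ) (B : ℍ → ℂ → ℂ → ℂ) : Prop :=
  ∀ x y : ℂ, HasDerivH (fun z ↦ B z x y) (fun z ↦ f z * (x - z * y) ^ n)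

lemma segment_im_pos (τ τ₀ : ℍ) {t : ℝ} (ht : t ∈ Set.Icc (0 : ℝ) 1) :
    0 < ((τ : ℂ) + (t : ℂ) * ((τ₀ : ℂ) - (τ : ℂ))).im := by
  have h1 := τ.im_pos
  have h2 := τ₀.im_pos
  simp only [Complex.add_im, Complex.im_ofReal_mul, Complex.sub_im, coe_im]
  obtain ⟨h3, h4⟩ := ht
  rcases eq_or_lt_of_le h3 with rfl | h3
  · simpa
  · nlinarith [mul_pos h3 h2, mul_nonneg (sub_nonneg.2 h4) h1.le]

lemma continuousOn_segment {φ : ℍ → ℂ} (hφ : Continuous φ) (τ τ₀ : ℍ) :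
    ContinuousOn (fun t : ℝ ↦ φ (ofComplex ((τ : ℂ) + (t : ℂ) * ((τ₀ : ℂ) - (τ : ℂ)))))
      (Set.Icc 0 1) := by
  refine hφ.comp_continuousOn ?_
  intro t ht
  have h1 := (contMDiffAt_ofComplex (n := 0) (segment_im_pos τ τ₀ ht)).continuousAt
  exact (ContinuousAt.comp (f := fun t : ℝ ↦ (τ : ℂ) + (t : ℂ) * ((τ₀ : ℂ) - (τ : ℂ))) h1
    (by fun_prop)).continuousWithinAt

lemma integral_segment_eq {φ Φ : ℍ → ℂ} (h : HasDerivH Φ φ) (hφ : Continuous φ) (τ τ₀ : ℍ) :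
    ∫ t in (0 : ℝ)..1, φ (ofComplex ((τ : ℂ) + (t : ℂ) * ((τ₀ : ℂ) - (τ : ℂ)))) *
      ((τ₀ : ℂ) - (τ : ℂ)) = Φ τ₀ - Φ τ := by
  have hu : Set.uIcc (0 : ℝ) 1 = Set.Icc 0 1 := Set.uIcc_of_le zero_le_one
  rw [intervalIntegral.integral_eq_sub_of_hasDerivAt
    (f := fun t : ℝ ↦ Φ (ofComplex ((τ : ℂ) + (t : ℂ) * ((τ₀ : ℂ) - (τ : ℂ)))))]
  · simp
  · intro t ht
    rw [hu] at ht
    have h1 : HasDerivAt (fun t : ℝ ↦ (τ : ℂ) + (t : ℂ) * ((τ₀ : ℂ) - (τ : ℂ)))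
        ((τ₀ : ℂ) - (τ : ℂ)) t := by
      simpa using ((hasDerivAt_id t).ofReal_comp.mul_const ((τ₀ : ℂ) - (τ : ℂ))).const_add (τ : ℂ)
    have h2 := h (ofComplex ((τ : ℂ) + (t : ℂ) * ((τ₀ : ℂ) - (τ : ℂ))))
    rw [coe_ofComplex (segment_im_pos τ τ₀ ht)] at h2
    exact h2.comp t h1
  · refine ContinuousOn.intervalIntegrable ?_
    rw [hu]
    exact (continuousOn_segment hφ τ τ₀).mul continuousOn_const

lemma intervalIntegrable_segmentIntegrand {f : ℍ → ℂ} (hf : Continuous f) (j : ℕ) (τ τ₀ : ℍ) :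
    IntervalIntegrable (fun t : ℝ ↦ f (ofComplex ((τ : ℂ) + (t : ℂ) * ((τ₀ : ℂ) - (τ : ℂ)))) *
    ((τ : ℂ) + (t : ℂ) * ((τ₀ : ℂ) - (τ : ℂ))) ^ j * ((τ₀ : ℂ) - (τ : ℂ)))
      MeasureTheory.volume 0 1 := by
  refine ContinuousOn.intervalIntegrable ?_
  rw [Set.uIcc_of_le zero_le_one]
  exact ((continuousOn_segment hf τ τ₀).mul (by fun_prop)).mul continuousOn_const

/-- Replaces the path integral by the difference of any primitive, so that later arguments need only
differentiate. -/
lemma ev_eichlerIntegral {n : ℕ} {f : ℍ → ℂ} (hf : Continuous f) {B : ℍ → ℂ → ℂ → ℂ}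
    (hB : IsPrimitive n f B) (x y : ℂ) (τ₀ τ : ℍ) :
    ev x y (eichlerIntegral n f τ₀ τ) =
      (2 * Real.pi * Complex.I) ^ (n + 1) * (B τ₀ x y - B τ x y) := by
  rw [← integral_segment_eq (hB x y) (by fun_prop), eichlerIntegral]
  simp only [ev_sum, ev_mul, ev_C, ev_pow, ev_X_zero, ev_X_one, segmentIntegral]
  simp_rw [mul_assoc _ (x ^ _) (y ^ _), mul_right_comm _ (∫ _ in _.._, _),
    ← intervalIntegral.integral_const_mul]
  rw [← intervalIntegral.integral_finsetSum fun j _ ↦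
    (intervalIntegrable_segmentIntegrand hf j τ τ₀).const_mul _]
  refine intervalIntegral.integral_congr fun t ht ↦ ?_
  rw [Set.uIcc_of_le zero_le_one] at ht
  rw [coe_ofComplex (segment_im_pos τ τ₀ ht), sub_eq_add_neg x, add_comm x, add_pow,
    Finset.mul_sum, Finset.sum_mul, Finset.mul_sum]
  refine Finset.sum_congr rfl fun j _ ↦ ?_
  rw [neg_pow (_ * y), mul_pow _ y]
  ring

lemma eichlerIntegral_mem_homog (n : ℕ) (f : ℍ → ℂ) (τ₀ τ : ℍ) :
    eichlerIntegral n f τ₀ τ ∈ homog n := by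
  refine Submodule.sum_mem _ fun j hj ↦ ?_
  rw [mul_assoc]
  exact C_mul_mem_homog _ (monomial_mul_mem_homog (by simpa [Nat.lt_succ_iff] using hj)
    (MvPolynomial.isHomogeneous_X ..) (MvPolynomial.isHomogeneous_X ..))

lemma cocycle_mem_homog (n : ℕ) (f : ℍ → ℂ) (γ : SL(2, ℤ)) : cocycle n f γ ∈ homog n :=
  Submodule.sub_mem _ (act_mem_homog _ (eichlerIntegral_mem_homog ..))
    (eichlerIntegral_mem_homog ..)

/-- The polynomial `∑_k n! / (n - k)! φ_{k+1}(z) Y ^ k (X - z Y) ^ (n - k)`. -/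
def primPoly (n : ℕ) (φ : ℕ → ℍ → ℂ) (z : ℍ) : MvPolynomial (Fin 2) ℂ :=
  ∑ k ∈ Finset.range (n + 1), MvPolynomial.C ((n.descFactorial k : ℂ) * φ (k + 1) z) *
    ((MvPolynomial.C 1 * MvPolynomial.X 0 + MvPolynomial.C (-(z : ℂ)) * MvPolynomial.X 1) ^ (n - k) *
      MvPolynomial.X 1 ^ k)

lemma primPoly_mem_homog (n : ℕ) (φ : ℕ → ℍ → ℂ) (z : ℍ) : primPoly n φ z ∈ homog n :=
  Submodule.sum_mem _ fun j hj ↦ C_mul_mem_homog _ (monomial_mul_mem_homog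
    (by simpa [Nat.lt_succ_iff] using hj) (linear_mem_homog _ _) (MvPolynomial.isHomogeneous_X ..))

lemma ev_primPoly (n : ℕ) (φ : ℕ → ℍ → ℂ) (z : ℍ) (x y : ℂ) : ev x y (primPoly n φ z) =
    ∑ k ∈ Finset.range (n + 1),
      (n.descFactorial k : ℂ) * φ (k + 1) z * ((x - z * y) ^ (n - k) * y ^ k) := by
  simp only [primPoly, ev_sum, ev_mul, ev_C, ev_pow, ev_add, ev_X_zero, ev_X_one, one_mul, neg_mul,
    sub_eq_add_neg]

lemma hasDerivH_coe : HasDerivH (fun z ↦ (z : ℂ)) (fun _ ↦ 1) :=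
  hasDerivH_of_hasDerivAt (f := id) (f' := fun _ ↦ 1) fun z ↦ hasDerivAt_id z

lemma hasDerivH_sub_mul_pow (x y : ℂ) (j : ℕ) : HasDerivH (fun z ↦ (x - z * y) ^ j)
    (fun z ↦ -(j * y * (x - z * y) ^ (j - 1))) := by
  refine hasDerivH_of_hasDerivAt (f := fun z ↦ (x - z * y) ^ j)
    (f' := fun z ↦ -(j * y * (x - z * y) ^ (j - 1))) fun z ↦ ?_
  refine (((hasDerivAt_id z).mul_const y).const_sub x |>.pow j).congr_deriv ?_
  simp only [id]
  ring

/-- Repeated integration by parts: φ_{k+1} is a primitive of φ_k, and each differentiation of (x - z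
y)^(n-k) lowers the exponent, so the derivative telescopes. -/
lemma isPrimitive_primPoly {n : ℕ} {φ : ℕ → ℍ → ℂ}
    (h : ∀ k ≤ n, HasDerivH (φ (k + 1)) (φ k)) :
    IsPrimitive n (φ 0) (fun z x y ↦ ev x y (primPoly n φ z)) := by
  intro x y
  simp only [ev_primPoly]
  -- T 0 is the integrand, and T (n + 1) vanishes because n.descFactorial (n + 1) = 0.
  let T : ℕ → ℍ → ℂ := fun k z ↦ (n.descFactorial k : ℂ) * φ k z * ((x - z * y) ^ (n - k) * y ^ k)
  refine (HasDerivH.sum (Finset.range (n + 1)) (f' := fun k z ↦ T k z - T (k + 1) z)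
    fun k hk ↦ ?_).congr_deriv fun z ↦ ?_
  · have hk' : k ≤ n := by simpa [Nat.lt_succ_iff] using hk
    refine (((h k hk').const_mul (n.descFactorial k : ℂ)).mul
      ((hasDerivH_sub_mul_pow x y (n - k)).mul (hasDerivH_const (y ^ k)))).congr_deriv fun z ↦ ?_
    simp only [T, Nat.descFactorial_succ, Nat.sub_sub]
    push_cast
    ring
  · rw [Finset.sum_range_sub']
    simp [T]

/-- A primitive of `(x - z y) ^ n`. -/
lemma exists_isPrimitive_one (n : ℕ) : ∃ E : ℍ → ℂ → ℂ → ℂ, IsPrimitive n (fun _ ↦ 1) E ∧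
    ∀ z, E z 1 0 = z := by
  refine ⟨fun z x y ↦ ∑ j ∈ Finset.range (n + 1),
    ((n.choose j : ℂ) * x ^ (n - j) * (-y) ^ j / (j + 1)) * (z : ℂ) ^ (j + 1), fun x y ↦ ?_,
    fun z ↦ ?_⟩
  · have hp : ∀ j : ℕ, HasDerivH (fun z ↦ (z : ℂ) ^ (j + 1)) (fun z ↦ (j + 1) * (z : ℂ) ^ j) :=
      fun j ↦ hasDerivH_of_hasDerivAt (f := fun z ↦ z ^ (j + 1)) (f' := fun z ↦ (j + 1) * z ^ j)
        fun z ↦ by simpa using hasDerivAt_pow (j + 1) z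
    refine (HasDerivH.sum (Finset.range (n + 1)) fun j _ ↦ (hp j).const_mul _).congr_deriv
      fun z ↦ ?_
    rw [one_mul, sub_eq_add_neg, add_comm x, add_pow]
    refine Finset.sum_congr rfl fun j _ ↦ ?_
    have : (j + 1 : ℂ) ≠ 0 := by exact_mod_cast Nat.succ_ne_zero j
    rw [neg_pow (_ * y), neg_pow y, mul_pow]
    field_simp
  · simp only
    rw [Finset.sum_range_succ']
    simp

lemma IsPrimitive.add {n : ℕ} {f g : ℍ → ℂ} {B E : ℍ → ℂ → ℂ → ℂ} (hf : IsPrimitive n f B)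
    (hg : IsPrimitive n g E) :
    IsPrimitive n (fun z ↦ f z + g z) (fun z x y ↦ B z x y + E z x y) := fun x y ↦
  ((hf x y).add (hg x y)).congr_deriv fun z ↦ by ring

lemma IsPrimitive.const_mul {n : ℕ} {f : ℍ → ℂ} {B : ℍ → ℂ → ℂ → ℂ} (c : ℂ)
    (hf : IsPrimitive n f B) : IsPrimitive n (fun z ↦ c * f z) (fun z x y ↦ c * B z x y) :=
  fun x y ↦ ((hf x y).const_mul c).congr_deriv fun z ↦ by ring

/-- The series without constant term has a periodic primitive at (1, 0), while the constant a 0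
contributes a 0 * z. The increment under z ↦ z + 1 therefore detects the constant term; it will be
read off from the cocycle at T. -/
lemma exists_isPrimitive {f : ℍ → ℂ} {a : ℤ → ℂ} (hf : HasQExpansion f a) (n : ℕ) :
    ∃ B, IsPrimitive n f B ∧ ∀ z, B ((1 : ℝ) +ᵥ z) 1 0 - B z 1 0 = a 0 := by
  have hc : HasQExpansion (fun _ ↦ a 0) (fun m ↦ if m = 0 then a 0 else 0) := fun z ↦ by
    refine (hasSum_congr_fun fun m ↦ ?_).mp (hasSum_ite_eq (0 : ℤ) (a 0))
    split_ifs with h <;> simp [h]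
  have hg := hf.sub hc
  obtain ⟨E, hE, hE'⟩ := exists_isPrimitive_one n
  have h1 := isPrimitive_primPoly (n := n) (φ := fun k ↦ qSeries (primCoeff
    (fun m ↦ a m - if m = 0 then a 0 else 0) k)) fun k _ ↦ hasDerivH_qSeries_primCoeff hg (by simp) k
  rw [qSeries_primCoeff_zero hg] at h1
  refine ⟨_, by simpa using h1.add (hE.const_mul (a 0)), fun z ↦ ?_⟩
  have hp : ∀ z, ev 1 0 (primPoly n (fun k ↦ qSeries (primCoeff
      (fun m ↦ a m - if m = 0 then a 0 else 0) k)) z) =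
      qSeries (primCoeff (fun m ↦ a m - if m = 0 then a 0 else 0) 1) z := fun z ↦ by
    rw [ev_primPoly, Finset.sum_range_succ']
    simp
  rw [hp, hp, (hasQExpansion_primCoeff hg (by simp) 1).vadd_one, hE', hE']
  simp
  ring

lemma IsWeaklyHolomorphic.continuous {k : ℤ} {f : ℍ → ℂ} (h : IsWeaklyHolomorphic k f) :
    Continuous f := (hasDerivH_of_differentiableOn h.1).continuous

/-! ### The cocycle attached to a primitive -/

/-- The form X - zY transforms with weight -1 under the joint action on z and (X, Y). This is the
source of all equivariance below. -/
lemma linear_smul (γ : SL(2, ℤ)) (z : ℍ) (x y : ℂ) :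
    (γ 0 0 * x + γ 0 1 * y) - (γ • z : ℍ) * (γ 1 0 * x + γ 1 1 * y) = (x - z * y) / aut γ z := by
  rw [coe_smul, eq_div_iff (aut_ne_zero γ z), sub_mul, div_mul_eq_mul_div, div_mul_cancel₀ _
    (aut_ne_zero γ z), aut]
  linear_combination (x - z * y) * det_eq_one γ

lemma IsPrimitive.smul_sub {n : ℕ} {f : ℍ → ℂ} {B : ℍ → ℂ → ℂ → ℂ} (hB : IsPrimitive n f B)
    (γ : SL(2, ℤ)) (x y : ℂ) :
    HasDerivH (fun z ↦ B (γ • z) (γ 0 0 * x + γ 0 1 * y) (γ 1 0 * x + γ 1 1 * y) - B z x y)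
      (fun z ↦ (f (γ • z) / aut γ z ^ (n + 2) - f z) * (x - z * y) ^ n) := by
  refine ((hasDerivH_comp_smul (hB (γ 0 0 * x + γ 0 1 * y) (γ 1 0 * x + γ 1 1 * y)) γ).sub
    (hB x y)).congr_deriv fun z ↦ ?_
  have := aut_ne_zero γ z
  rw [linear_smul, div_pow]
  field_simp
  ring

/-- Weight n + 2 of f cancels the weight -n of (X - zY)^n and the factor (cz + d)^(-2) from dz, so
the derivative vanishes. This gives independence of the base point and the cocycle relation. -/
lemma IsPrimitive.smul_sub_eq {n : ℕ} {f : ℍ → ℂ} {B : ℍ → ℂ → ℂ → ℂ} (hB : IsPrimitive n f B)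
    (hf : IsModularOfWeights (n + 2) 0 f) (γ : SL(2, ℤ)) (x y : ℂ) (z w : ℍ) :
    B (γ • z) (γ 0 0 * x + γ 0 1 * y) (γ 1 0 * x + γ 1 1 * y) - B z x y =
      B (γ • w) (γ 0 0 * x + γ 0 1 * y) (γ 1 0 * x + γ 1 1 * y) - B w x y := by
  refine eq_const_of_hasDerivH_zero ((hB.smul_sub γ x y).congr_deriv fun z ↦ ?_) z w
  rw [isModularOfWeights_zero_iff.1 hf, ← Nat.cast_two, ← Nat.cast_add, zpow_natCast,
    mul_div_cancel_left₀ _ (pow_ne_zero _ (aut_ne_zero γ z)), sub_self, zero_mul]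

lemma ev_cocycle {n : ℕ} {f : ℍ → ℂ} (hf : Continuous f) {B : ℍ → ℂ → ℂ → ℂ}
    (hB : IsPrimitive n f B) (γ : SL(2, ℤ)) (x y : ℂ) :
    ev x y (cocycle n f γ) = (2 * Real.pi * Complex.I) ^ (n + 1) *
      (B UpperHalfPlane.I (γ 0 0 * x + γ 0 1 * y) (γ 1 0 * x + γ 1 1 * y) -
        B (γ • UpperHalfPlane.I) (γ 0 0 * x + γ 0 1 * y) (γ 1 0 * x + γ 1 1 * y)) := by
  simp [cocycle, ev_eichlerIntegral hf hB]

/-- The cocycle condition for the right action on polynomials. -/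
def IsCocycle (C : SL(2, ℤ) → MvPolynomial (Fin 2) ℂ) : Prop :=
  ∀ γ δ : SL(2, ℤ), C (γ * δ) = act (C γ) (δ : Matrix (Fin 2) (Fin 2) ℤ) + C δ

lemma isCocycle_cocycle {n : ℕ} {f : ℍ → ℂ} (hf : IsWeaklyHolomorphic (n + 2) f) :
    IsCocycle (cocycle n f) := fun γ δ ↦ ext_ev fun x y ↦ by
  obtain ⟨N, a, -, ha⟩ := hf.2.2
  obtain ⟨B, hB, -⟩ := exists_isPrimitive ha n
  rw [ev_add, ev_act, ev_cocycle hf.continuous hB, ev_cocycle hf.continuous hB,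
    ev_cocycle hf.continuous hB]
  have h := hB.smul_sub_eq hf.2.1 γ (δ 0 0 * x + δ 0 1 * y) (δ 1 0 * x + δ 1 1 * y)
    UpperHalfPlane.I (δ • UpperHalfPlane.I)
  have e0 : ((γ * δ) 0 0 : ℂ) * x + (γ * δ) 0 1 * y =
      γ 0 0 * (δ 0 0 * x + δ 0 1 * y) + γ 0 1 * (δ 1 0 * x + δ 1 1 * y) := by
    simp [Matrix.mul_apply, Fin.sum_univ_two]
    ring
  have e1 : ((γ * δ) 1 0 : ℂ) * x + (γ * δ) 1 1 * y =
      γ 1 0 * (δ 0 0 * x + δ 0 1 * y) + γ 1 1 * (δ 1 0 * x + δ 1 1 * y) := by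
    simp [Matrix.mul_apply, Fin.sum_univ_two]
    ring
  rw [e0, e1, mul_smul]
  linear_combination (2 * Real.pi * Complex.I) ^ (n + 1) * h

/-! ### Dehomogenisation -/

lemma exists_dehomog {n : ℕ} {P : MvPolynomial (Fin 2) ℂ} (h : P ∈ homog n) :
    ∃ p : Polynomial ℂ, p.natDegree ≤ n ∧ ∀ x, p.eval x = ev x 1 P := by
  refine ⟨∑ d ∈ P.support, Polynomial.C (P.coeff d) * Polynomial.X ^ d 0,
    Polynomial.natDegree_sum_le_of_forall_le _ _ fun d hd ↦ ?_, fun x ↦ ?_⟩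
  · refine (Polynomial.natDegree_C_mul_X_pow_le _ _).trans ?_
    have := MvPolynomial.IsHomogeneous.degree_eq_sum_deg_support
      (show MvPolynomial.IsHomogeneous P n from h) hd
    rw [Finset.sum_subset (Finset.subset_univ d.support)
      (fun i _ hi ↦ Finsupp.notMem_support_iff.1 hi), Fin.sum_univ_two] at this
    omega
  · rw [ev, MvPolynomial.eval_eq', Polynomial.eval_finsetSum]
    simp [Fin.prod_univ_two]

lemma homog_eq_zero {n : ℕ} {P : MvPolynomial (Fin 2) ℂ} (h : P ∈ homog n)
    (h0 : ∀ x, ev x 1 P = 0) : P = 0 := by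
  -- The factor Y takes care of y = 0, where the dehomogenised polynomial gives no direct
  -- information.
  have : P * MvPolynomial.X 1 = 0 := ext_ev fun x y ↦ by
    rcases eq_or_ne y 0 with rfl | hy
    · simp
    · have := ev_homog h y (x / y) 1
      rw [h0, mul_div_cancel₀ _ hy, mul_one, mul_zero] at this
      simp [this]
  exact (mul_eq_zero.1 this).resolve_right (MvPolynomial.X_ne_zero 1)

lemma homog_ext {n : ℕ} {P Q : MvPolynomial (Fin 2) ℂ} (hP : P ∈ homog n) (hQ : Q ∈ homog n)
    (h : ∀ x, ev x 1 P = ev x 1 Q) : P = Q :=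
  sub_eq_zero.1 (homog_eq_zero (Submodule.sub_mem _ hP hQ) fun x ↦ by rw [ev_sub, h, sub_self])

lemma polynomial_eq_zero_of_isBigO {z : ℂ} (m : ℕ) {p : Polynomial ℂ} (hp : p.natDegree < m)
    (h : (fun x ↦ p.eval x) =O[𝓝[≠] z] fun x ↦ (x - z) ^ m) : p = 0 := by
  induction m generalizing p with
  | zero => exact absurd hp (Nat.not_lt_zero _)
  | succ m ih =>
    have hz : p.IsRoot z := by
      have h1 : Tendsto (fun x ↦ (x - z) ^ (m + 1)) (𝓝[≠] z) (𝓝 0) := by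
        refine tendsto_nhdsWithin_of_tendsto_nhds ?_
        have : Continuous fun x : ℂ ↦ (x - z) ^ (m + 1) := by fun_prop
        simpa using this.tendsto z
      exact tendsto_nhds_unique (tendsto_nhdsWithin_of_tendsto_nhds p.continuous.continuousAt)
        (h.trans_tendsto h1)
    have hpr := Polynomial.mul_divByMonic_eq_iff_isRoot.2 hz
    set r := p /ₘ (Polynomial.X - Polynomial.C z) with hr
    have hr0 : r.natDegree = p.natDegree - 1 := by
      rw [hr, Polynomial.natDegree_divByMonic _ (Polynomial.monic_X_sub_C z),
        Polynomial.natDegree_X_sub_C]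
    rcases Nat.eq_zero_or_pos m with rfl | hm
    · have hc := Polynomial.eq_C_of_natDegree_eq_zero (Nat.lt_one_iff.1 hp)
      rw [hc] at hz ⊢
      simpa using hz
    have : r = 0 := by
      refine ih (by omega) ?_
      have h2 := h.mul (Asymptotics.isBigO_refl (fun x ↦ (x - z)⁻¹) (𝓝[≠] z))
      refine (h2.congr' ?_ ?_)
      · filter_upwards [self_mem_nhdsWithin] with x hx
        have hx' : x - z ≠ 0 := sub_ne_zero.2 hx
        rw [← hpr, Polynomial.eval_mul]
        simp only [Polynomial.eval_sub, Polynomial.eval_X, Polynomial.eval_C]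
        field_simp
      · filter_upwards [self_mem_nhdsWithin] with x hx
        have hx' : x - z ≠ 0 := sub_ne_zero.2 hx
        rw [pow_succ, mul_assoc, mul_inv_cancel₀ hx', mul_one]
    rw [← hpr, this, mul_zero]

lemma homog_eq_zero_of_isBigO {n : ℕ} {P : MvPolynomial (Fin 2) ℂ} (hP : P ∈ homog n) {z : ℂ}
    (h : (fun x ↦ ev x 1 P) =O[𝓝 z] fun x ↦ (x - z) ^ (n + 1)) : P = 0 := by
  obtain ⟨p, hpn, hp⟩ := exists_dehomog hP
  have : p = 0 := polynomial_eq_zero_of_isBigO (z := z) (n + 1) (by omega)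
    (by simpa only [hp] using h.mono nhdsWithin_le_nhds)
  exact homog_eq_zero hP fun x ↦ by rw [← hp, this, Polynomial.eval_zero]

/-- The polynomial P(x, 1) is invariant under x ↦ x + 1, so it takes one value at all natural
numbers and is constant. By homogeneity P is then a multiple of Y^n. -/
lemma exists_eq_const_of_T_invariant {n : ℕ} {P : MvPolynomial (Fin 2) ℂ} (hP : P ∈ homog n)
    (h : act P (ModularGroup.T : Matrix (Fin 2) (Fin 2) ℤ) = P) : ∃ κ, ∀ x, ev x 1 P = κ := by
  obtain ⟨p, -, hp⟩ := exists_dehomog hP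
  have h1 : ∀ x, ev (x + 1) 1 P = ev x 1 P := fun x ↦ by
    conv_rhs => rw [← h]
    simp [ModularGroup.T]
  have h2 : ∀ k : ℕ, ev k 1 P = ev 0 1 P := fun k ↦ by
    induction k with
    | zero => simp
    | succ k ih => rw [Nat.cast_succ, h1, ih]
  have : p = Polynomial.C (ev 0 1 P) := Polynomial.eq_of_infinite_eval_eq _ _ <|
    (Set.infinite_range_of_injective (Nat.cast_injective (R := ℂ))).mono <| by
      rintro _ ⟨k, rfl⟩
      simp [hp, h2]
  exact ⟨ev 0 1 P, fun x ↦ by rw [← hp, this, Polynomial.eval_C]⟩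

/-! ### Iterated derivatives and Bol's identity -/

lemma differentiableOn_iteratedDeriv {f : ℍ → ℂ}
    (h : DifferentiableOn ℂ (f ∘ ofComplex) {z : ℂ | 0 < z.im}) (k : ℕ) :
    DifferentiableOn ℂ (iteratedDeriv k (f ∘ ofComplex)) {z : ℂ | 0 < z.im} := by
  induction k with
  | zero => simpa
  | succ k ih =>
    rw [iteratedDeriv_succ]
    exact ih.deriv isOpen_im_pos

lemma hasDerivH_iteratedDeriv {f : ℍ → ℂ}
    (h : DifferentiableOn ℂ (f ∘ ofComplex) {z : ℂ | 0 < z.im}) (k : ℕ) :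
    HasDerivH (fun z ↦ iteratedDeriv k (f ∘ ofComplex) z)
      (fun z ↦ iteratedDeriv (k + 1) (f ∘ ofComplex) z) := fun z ↦ by
  have h1 := ((differentiableOn_iteratedDeriv h k z z.im_pos).differentiableAt
    (isOpen_im_pos.mem_nhds z.im_pos)).hasDerivAt
  rw [iteratedDeriv_succ]
  refine h1.congr_of_eventuallyEq ?_
  filter_upwards [eventually_im_pos z] with w hw
  simp [coe_ofComplex hw]

lemma iteratedDeriv_eq_of_chain {ψ : ℕ → ℍ → ℂ} (N : ℕ)
    (h : ∀ k < N, HasDerivH (ψ k) (ψ (k + 1))) (z : ℍ) :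
    iteratedDeriv N (ψ 0 ∘ ofComplex) z = ψ N z := by
  induction N generalizing z with
  | zero => simp
  | succ N ih =>
    rw [iteratedDeriv_succ]
    have : iteratedDeriv N (ψ 0 ∘ ofComplex) =ᶠ[𝓝 (z : ℂ)] ψ N ∘ ofComplex := by
      filter_upwards [eventually_im_pos z] with w hw
      have := ih (fun k hk ↦ h k (hk.trans N.lt_succ_self)) (ofComplex w)
      rwa [coe_ofComplex hw] at this
    rw [this.deriv_eq]
    exact (h N N.lt_succ_self z).deriv

/-- The chain of iterated derivatives, in decreasing order. -/
def derivChain (n : ℕ) (h : ℍ → ℂ) (k : ℕ) (z : ℍ) : ℂ :=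
  iteratedDeriv (n + 1 - k) (h ∘ ofComplex) z

lemma hasDerivH_derivChain {n : ℕ} {h : ℍ → ℂ}
    (hd : DifferentiableOn ℂ (h ∘ ofComplex) {z : ℂ | 0 < z.im}) {k : ℕ} (hk : k ≤ n) :
    HasDerivH (derivChain n h (k + 1)) (derivChain n h k) := by
  have := hasDerivH_iteratedDeriv hd (n - k)
  rw [show n - k + 1 = n + 1 - k by omega] at this
  rwa [show n - k = n + 1 - (k + 1) by omega] at this

/-- At (x, 1) the polynomial `primPoly n (derivChain n h) z` is n! times the Taylor polynomial of
degree n of h at z; the index k there corresponds to the Taylor term of order n - k. -/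
lemma isBigO_taylor {n : ℕ} {h : ℍ → ℂ}
    (hd : DifferentiableOn ℂ (h ∘ ofComplex) {z : ℂ | 0 < z.im}) (z : ℍ) :
    (fun x : ℂ ↦ n.factorial * h (ofComplex x) - ev x 1 (primPoly n (derivChain n h) z)) =O[𝓝 (z : ℂ)]
      fun x ↦ (x - z) ^ (n + 1) := by
  have ha : AnalyticAt ℂ (h ∘ ofComplex) z := hd.analyticAt (isOpen_im_pos.mem_nhds z.im_pos)
  have h1 := ha.hasFPowerSeriesAt.isBigO_sub_partialSum_pow (n + 1)
  have ht : Tendsto (fun x : ℂ ↦ x - z) (𝓝 (z : ℂ)) (𝓝 0) := by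
    have : Continuous fun x : ℂ ↦ x - z := by fun_prop
    simpa using this.tendsto z
  have h2 := (h1.comp_tendsto ht).const_mul_left (n.factorial : ℂ)
  refine (h2.congr_left fun x ↦ ?_).trans (Asymptotics.isBigO_of_le _ fun x ↦ by simp)
  simp only [Function.comp, add_sub_cancel, mul_sub, FormalMultilinearSeries.partialSum,
    FormalMultilinearSeries.ofScalars_apply_eq, ev_primPoly, derivChain]
  congr 1
  rw [Finset.mul_sum, ← Finset.sum_range_reflect]
  refine Finset.sum_congr rfl fun k hk ↦ ?_
  have hk' : k ≤ n := by simpa [Nat.lt_succ_iff] using hk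
  rw [show n + 1 - 1 - k = n - k by omega, show n + 1 - (k + 1) = n - k by omega]
  have : (n.descFactorial k : ℂ) * (n - k).factorial = n.factorial := by
    rw [mul_comm]
    exact_mod_cast Nat.factorial_mul_descFactorial hk'
  have h3 : ((n - k).factorial : ℂ) ≠ 0 := by exact_mod_cast Nat.factorial_ne_zero _
  rw [← this]
  simp only [Function.comp_def, smul_eq_mul, mul_one, one_pow]
  field_simp

/-- The content of Bol's identity. Weight -n means (cx + d)^n h(γx) = h(x), so both sides,
dehomogenised, are polynomials of degree at most n that agree with n! h(x) up to O((x - z)^(n+1));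
hence they coincide. -/
lemma act_primPoly_derivChain {n : ℕ} {h : ℍ → ℂ}
    (hd : DifferentiableOn ℂ (h ∘ ofComplex) {z : ℂ | 0 < z.im})
    (hm : IsModularOfWeights (-n) 0 h) (γ : SL(2, ℤ)) (z : ℍ) :
    act (primPoly n (derivChain n h) (γ • z)) (γ : Matrix (Fin 2) (Fin 2) ℤ) =
      primPoly n (derivChain n h) z := by
  set A := primPoly n (derivChain n h) with hA
  have hAm : ∀ z, A z ∈ homog n := primPoly_mem_homog n _
  refine sub_eq_zero.1 (homog_eq_zero_of_isBigO (n := n) (z := z)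
    (Submodule.sub_mem _ (act_mem_homog _ (hAm _)) (hAm _)) ?_)
  let m : ℂ → ℂ := fun w ↦ ((γ 0 0 : ℂ) * w + γ 0 1) / ((γ 1 0 : ℂ) * w + γ 1 1)
  have hmz : m z = ((γ • z : ℍ) : ℂ) := by rw [coe_smul]; rfl
  have hz : (γ 1 0 : ℂ) * z + γ 1 1 ≠ 0 := aut_ne_zero γ z
  have hmd : DifferentiableAt ℂ m z := by
    refine DifferentiableAt.div ?_ ?_ hz <;> fun_prop
  have h1 := isBigO_taylor (n := n) hd z
  have h2 := (isBigO_taylor (n := n) hd (γ • z)).comp_tendsto (k := m)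
    (by rw [← hmz]; exact hmd.continuousAt)
  have h3 : ((fun x : ℂ ↦ (x - (γ • z : ℍ)) ^ (n + 1)) ∘ m) =O[𝓝 (z : ℂ)]
      fun x ↦ (x - z) ^ (n + 1) := by
    have := (hmd.hasDerivAt.isBigO_sub).pow (n + 1)
    rwa [hmz] at this
  have h4 : (fun x : ℂ ↦ ((γ 1 0 : ℂ) * x + γ 1 1) ^ n) =O[𝓝 (z : ℂ)] fun _ ↦ (1 : ℂ) := by
    have : ContinuousAt (fun x : ℂ ↦ ((γ 1 0 : ℂ) * x + γ 1 1) ^ n) z := by fun_prop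
    exact this.isBigO_one ℂ
  have h5 := h1.sub ((h4.mul (h2.trans h3)).congr_right fun x ↦ one_mul _)
  refine h5.congr' ?_ EventuallyEq.rfl
  have hne : ∀ᶠ x in 𝓝 (z : ℂ), (γ 1 0 : ℂ) * x + γ 1 1 ≠ 0 := by
    have : ContinuousAt (fun x : ℂ ↦ (γ 1 0 : ℂ) * x + γ 1 1) z := by fun_prop
    exact this.eventually_ne hz
  filter_upwards [hne, eventually_im_pos z] with x hx hxi
  have hmx : m x = ((γ • ofComplex x : ℍ) : ℂ) := by
    rw [coe_smul, aut, coe_ofComplex hxi]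
  have haut : aut γ (ofComplex x) = (γ 1 0 : ℂ) * x + γ 1 1 := by rw [aut, coe_ofComplex hxi]
  have e1 : ev (γ 0 0 * x + γ 0 1 * 1) (γ 1 0 * x + γ 1 1 * 1) (A (γ • z)) =
      ((γ 1 0 : ℂ) * x + γ 1 1) ^ n * ev (m x) 1 (A (γ • z)) := by
    rw [← ev_homog (hAm _)]
    congr 1
    · rw [mul_one, mul_div_cancel₀ _ hx]
    · ring
  simp only [Function.comp, ev_sub, ev_act]
  rw [e1, hmx, ofComplex_apply, isModularOfWeights_zero_iff.1 hm, haut, ← hmx, zpow_neg,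
    zpow_natCast]
  field_simp
  ring

/-- A multiple of the Taylor polynomial is a primitive of u (X - zY)^n. Its equivariance yields
weight n + 2 after differentiation, and makes the cocycle the coboundary of its value at i. -/
lemma isWeaklyHolomorphic_of_isBolImage {n : ℕ} {h u : ℍ → ℂ} (hh : IsWeaklyHolomorphic (-n) h)
    (hu : ∀ z : ℍ, u z = (2 * Real.pi * Complex.I)⁻¹ ^ (n + 1) *
      iteratedDeriv (n + 1) (h ∘ ofComplex) (z : ℂ)) :
    IsWeaklyHolomorphic (n + 2) u ∧ (∀ a, HasQExpansion h a →
        HasQExpansion u (fun m ↦ (m : ℂ) ^ (n + 1) * a m)) ∧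
      ∃ P ∈ homog n, ∀ γ : SL(2, ℤ),
        cocycle n u γ = act P (γ : Matrix (Fin 2) (Fin 2) ℤ) - P := by
  set c : ℂ := (2 * Real.pi * Complex.I)⁻¹ ^ (n + 1) with hc
  have hpi : (2 * Real.pi * Complex.I : ℂ) ≠ 0 := by simp [Real.pi_ne_zero]
  have hc1 : (2 * Real.pi * Complex.I) ^ (n + 1) * c = 1 := by
    rw [hc, ← mul_pow, mul_inv_cancel₀ hpi, one_pow]
  have hu' : u = fun z ↦ c * derivChain n h 0 z := funext hu
  have hexp : ∀ a, HasQExpansion h a → HasQExpansion u (fun m ↦ (m : ℂ) ^ (n + 1) * a m) := by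
    intro a ha
    have key : ∀ k : ℕ, HasQExpansion (fun z ↦ iteratedDeriv k (h ∘ ofComplex) z)
        (fun m ↦ (2 * Real.pi * Complex.I * m) ^ k * a m) := by
      intro k
      induction k with
      | zero => simpa using ha
      | succ k ih =>
        have := ih.of_hasDerivH (hasDerivH_iteratedDeriv hh.1 k)
        simpa only [pow_succ', mul_assoc] using this
    have := (key (n + 1)).const_mul c
    rw [hu']
    convert! this using 1
    ext m
    rw [mul_pow, ← mul_assoc, ← mul_assoc, mul_comm c, hc1, one_mul]
  have hB := (isPrimitive_primPoly (n := n) (fun k hk ↦ hasDerivH_derivChain hh.1 hk)).const_mul c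
  rw [← hu'] at hB
  have heq : ∀ (γ : SL(2, ℤ)) (z : ℍ) (x y : ℂ), ev (γ 0 0 * x + γ 0 1 * y) (γ 1 0 * x + γ 1 1 * y)
      (primPoly n (derivChain n h) (γ • z)) = ev x y (primPoly n (derivChain n h) z) := by
    intro γ z x y
    rw [← act_primPoly_derivChain hh.1 hh.2.1 γ z, ev_act]
  have hmod : IsModularOfWeights (n + 2) 0 u := by
    rw [isModularOfWeights_zero_iff]
    intro γ z
    -- At (x, y) = (z + 1, 1) the factor (x - z y)^n equals 1, leaving the transformation law of u
    -- alone.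
    have h1 := hB.smul_sub γ (z + 1) 1
    simp only [heq, sub_self] at h1
    have h2 := congrFun (h1.unique (hasDerivH_const 0)) z
    simp only [mul_one, add_sub_cancel_left, one_pow, sub_eq_zero] at h2
    rw [div_eq_iff (pow_ne_zero _ (aut_ne_zero γ z))] at h2
    rw [h2, show (n : ℤ) + 2 = ((n + 2 : ℕ) : ℤ) by push_cast; ring, zpow_natCast, mul_comm]
  obtain ⟨N, a, ha0, ha⟩ := hh.2.2
  have hw : IsWeaklyHolomorphic (n + 2) u :=
    ⟨(hexp a ha).differentiableOn, hmod, N, _, fun m hm ↦ by rw [ha0 m hm, mul_zero], hexp a ha⟩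
  refine ⟨hw, hexp, primPoly n (derivChain n h) (UpperHalfPlane.I), primPoly_mem_homog _ _ _,
    fun γ ↦ ext_ev fun x y ↦ ?_⟩
  rw [ev_cocycle hw.continuous hB, heq, ev_sub, ev_act, ← mul_sub, ← mul_assoc, hc1, one_mul]

lemma coeff_zero_of_coboundary {n : ℕ} {f : ℍ → ℂ} (hf : IsWeaklyHolomorphic (n + 2) f)
    {a : ℤ → ℂ} (ha : HasQExpansion f a)
    (h0 : ev 1 0 (cocycle n f ModularGroup.T) = 0) : a 0 = 0 := by
  obtain ⟨B, hB, hB'⟩ := exists_isPrimitive ha n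
  have hpi : (2 * Real.pi * Complex.I : ℂ) ^ (n + 1) ≠ 0 :=
    pow_ne_zero _ (by simp [Real.pi_ne_zero])
  rw [ev_cocycle hf.continuous hB, modular_T_smul] at h0
  have := (mul_eq_zero.1 h0).resolve_left hpi
  simp only [ModularGroup.T] at this
  simp at this
  rw [← hB' UpperHalfPlane.I, sub_eq_zero]
  exact (sub_eq_zero.1 this).symm

/-- Subtracting a constant polynomial Q makes the primitive A(z) equivariant. Evaluating A(z) - Q at
(X, Y) = (z, 1), where X - zY vanishes, gives a function of weight -n; it equals n! φ_{n+1} minus a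
constant, so its derivative of order n + 1 is n! f. -/
lemma isBolImage_of_coboundary {n : ℕ} {f : ℍ → ℂ} (hf : IsWeaklyHolomorphic (n + 2) f)
    {P : MvPolynomial (Fin 2) ℂ} (hP : P ∈ homog n)
    (h : ∀ γ : SL(2, ℤ), cocycle n f γ = act P (γ : Matrix (Fin 2) (Fin 2) ℤ) - P) :
    IsBolImage n f := by
  obtain ⟨N, a, ha0, ha⟩ := hf.2.2
  have h0 : a 0 = 0 := coeff_zero_of_coboundary hf ha (by rw [h]; simp [ModularGroup.T])
  have hpi : (2 * Real.pi * Complex.I : ℂ) ≠ 0 := by simp [Real.pi_ne_zero]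
  set φ : ℕ → ℍ → ℂ := fun k ↦ qSeries (primCoeff a k) with hφ
  have hφd : ∀ k, HasDerivH (φ (k + 1)) (φ k) := hasDerivH_qSeries_primCoeff ha h0
  have hφ0 : φ 0 = f := qSeries_primCoeff_zero ha
  have hB := isPrimitive_primPoly (n := n) fun k _ ↦ hφd k
  rw [hφ0] at hB
  set A := primPoly n φ with hA
  set c : ℂ := ((2 * Real.pi * Complex.I) ^ (n + 1))⁻¹ with hc
  have hc1 : c * (2 * Real.pi * Complex.I) ^ (n + 1) = 1 := inv_mul_cancel₀ (pow_ne_zero _ hpi)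
  let Q : MvPolynomial (Fin 2) ℂ := A UpperHalfPlane.I - c • P
  have hQ : Q ∈ homog n :=
    Submodule.sub_mem _ (primPoly_mem_homog _ _ _) (Submodule.smul_mem _ _ hP)
  have heq : ∀ (γ : SL(2, ℤ)) (z : ℍ) (x y : ℂ), ev (γ 0 0 * x + γ 0 1 * y) (γ 1 0 * x + γ 1 1 * y)
      (A (γ • z) - Q) = ev x y (A z - Q) := by
    intro γ z x y
    have h1 := hB.smul_sub_eq hf.2.1 γ x y z UpperHalfPlane.I
    have h2 := ev_cocycle hf.continuous hB γ x y
    rw [h, ev_sub, ev_act] at h2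
    simp only [Q, ev_sub, ev_smul]
    linear_combination h1 + c * h2 + (ev (γ 0 0 * x + γ 0 1 * y) (γ 1 0 * x + γ 1 1 * y)
      (A UpperHalfPlane.I) - ev (γ 0 0 * x + γ 0 1 * y) (γ 1 0 * x + γ 1 1 * y)
      (A (γ • UpperHalfPlane.I))) * hc1
  have hper : ∀ (k : ℕ) (z : ℍ), φ k ((1 : ℝ) +ᵥ z) = φ k z := fun k z ↦
    (hasQExpansion_primCoeff ha h0 k).vadd_one z
  have hAT : ∀ (z : ℍ) (x y : ℂ), ev (x + y) y (A ((1 : ℝ) +ᵥ z)) = ev x y (A z) := fun z x y ↦ by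
    simp only [hA, ev_primPoly, hper, coe_vadd]
    refine Finset.sum_congr rfl fun k _ ↦ ?_
    congr 3
    push_cast
    ring
  -- Both A and A - Q are equivariant under T, the first by periodicity of the q-series. So Q is
  -- T-invariant, and it changes only the constant term of the q-expansion.
  obtain ⟨κ, hκ⟩ := exists_eq_const_of_T_invariant hQ (ext_ev fun x y ↦ by
    have h1 := heq ModularGroup.T UpperHalfPlane.I x y
    rw [modular_T_smul] at h1
    simp only [ModularGroup.T] at h1
    simp [ModularGroup.T] at h1 ⊢
    rw [hAT] at h1
    linear_combination -h1)
  have hAz : ∀ z : ℍ, ev z 1 (A z) = n.factorial * φ (n + 1) z := fun z ↦ by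
    rw [hA, ev_primPoly, Finset.sum_range_succ, Finset.sum_eq_zero]
    · simp [Nat.descFactorial_self]
    · intro k hk
      have : n - k ≠ 0 := by
        have := Finset.mem_range.1 hk
        omega
      simp [this]
  let g : ℍ → ℂ := fun z ↦ n.factorial * φ (n + 1) z - κ
  have hg : ∀ z, g z = ev z 1 (A z - Q) := fun z ↦ by rw [ev_sub, hAz, hκ]
  have hconst : HasQExpansion (fun _ ↦ κ) (fun m ↦ if m = 0 then κ else 0) := fun z ↦ by
    refine (hasSum_congr_fun fun m ↦ ?_).mp (hasSum_ite_eq (0 : ℤ) κ)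
    split_ifs with h <;> simp [h]
  have hgq := ((hasQExpansion_primCoeff ha h0 (n + 1)).const_mul n.factorial).sub hconst
  have hgm : IsModularOfWeights (-n) 0 g := by
    rw [isModularOfWeights_zero_iff]
    intro γ z
    have hz := aut_ne_zero γ z
    rw [hg, hg, ← heq γ z, zpow_neg, zpow_natCast, eq_inv_mul_iff_mul_eq₀ (pow_ne_zero _ hz),
      ← ev_homog (Submodule.sub_mem _ (primPoly_mem_homog _ _ _) hQ), coe_smul,
      mul_div_cancel₀ _ hz]
    congr 1
    · ring
    · rw [aut]; ring
  have hgw : IsWeaklyHolomorphic (-n) g := by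
    -- N may be negative, whereas the constant κ occupies index 0.
    refine ⟨hgq.differentiableOn, hgm, max N 0, _, fun m hm ↦ ?_, hgq⟩
    have : m ≠ 0 := by omega
    simp [primCoeff, ha0 m (by omega), this]
  let C : ℂ := (2 * Real.pi * Complex.I) ^ (n + 1) / n.factorial
  have hfac : (n.factorial : ℂ) ≠ 0 := by exact_mod_cast n.factorial_ne_zero
  refine ⟨fun z ↦ C * g z, hgw.const_mul C, fun z ↦ ?_⟩
  let ψ : ℕ → ℍ → ℂ := fun k z ↦ if k = 0 then C * g z else
    (2 * Real.pi * Complex.I) ^ (n + 1) * φ (n + 1 - k) z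
  have hψ := iteratedDeriv_eq_of_chain (ψ := ψ) (n + 1) (fun k hk ↦ ?_) z
  · have e : ψ 0 = fun z ↦ C * g z := by simp [ψ]
    rw [← e, hψ]
    simp only [ψ, n.succ_ne_zero, if_false, Nat.sub_self, hφ0]
    rw [← mul_assoc, ← mul_pow, inv_mul_cancel₀ hpi, one_pow, one_mul]
  · rcases Nat.eq_zero_or_pos k with rfl | hk0
    · refine ((((hφd n).const_mul (n.factorial : ℂ)).sub (hasDerivH_const κ)).const_mul C
        ).congr_deriv fun z ↦ ?_
      simp only [ψ, C]
      simp
      field_simp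
    · have := (hφd (n - k)).const_mul ((2 * Real.pi * Complex.I) ^ (n + 1))
      simp only [ψ, hk0.ne', if_false, Nat.succ_ne_zero]
      rwa [show n - k + 1 = n + 1 - k by omega, show n - k = n + 1 - (k + 1) by omega] at this

/-! ### Cocycles on the generators -/

lemma IsCocycle.one {C : SL(2, ℤ) → MvPolynomial (Fin 2) ℂ} (hC : IsCocycle C) : C 1 = 0 := by
  have := hC 1 1
  rw [one_mul, Matrix.SpecialLinearGroup.coe_one, act_one] at this
  simpa using this

/-- S and ST generate the group. ST is preferred to T because it has finite order, which restricts
the value of a cocycle there. -/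
lemma IsCocycle.eq_zero {C : SL(2, ℤ) → MvPolynomial (Fin 2) ℂ} (hC : IsCocycle C)
    (hS : C ModularGroup.S = 0) (hU : C (ModularGroup.S * ModularGroup.T) = 0) (γ : SL(2, ℤ)) :
    C γ = 0 := by
  have hT : C ModularGroup.T = 0 := by
    rw [hC, hS, act_zero, zero_add] at hU
    exact hU
  have hγ : γ ∈ Subgroup.closure {ModularGroup.S, ModularGroup.T} := by
    rw [SpecialLinearGroup.SL2Z_generators]
    trivial
  induction hγ using Subgroup.closure_induction with
  | mem x hx => rcases hx with rfl | rfl <;> assumption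
  | one => exact hC.one
  | mul x y _ _ hx hy => rw [hC, hx, hy, act_zero, zero_add]
  | inv x _ hx =>
    have := hC x x⁻¹
    rw [mul_inv_cancel, hC.one, hx, act_zero, zero_add] at this
    exact this.symm

lemma act_neg_one {n : ℕ} (hn : Even n) {P : MvPolynomial (Fin 2) ℂ} (hP : P ∈ homog n) :
    act P (-1) = P := ext_ev fun x y ↦ by
  have := ev_homog hP (-1) x y
  rw [hn.neg_one_pow, one_mul] at this
  rw [ev_act, ← this]
  simp

lemma IsCocycle.neg_one {n : ℕ} (hn : Even n) {C : SL(2, ℤ) → MvPolynomial (Fin 2) ℂ}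
    (hC : IsCocycle C) (hCn : ∀ γ, C γ ∈ homog n) : C (-1) = 0 := by
  have := hC (-1) (-1)
  rw [neg_mul_neg, one_mul, hC.one, Matrix.SpecialLinearGroup.coe_neg,
    Matrix.SpecialLinearGroup.coe_one, act_neg_one hn (hCn _), ← two_mul] at this
  simpa using this.symm

/-- This and `IsCocycle.apply_ST` spell out S² = -1 and (ST)³ = -1, using that a cocycle vanishes at
-1 in even degree. -/
lemma IsCocycle.apply_S {n : ℕ} (hn : Even n) {C : SL(2, ℤ) → MvPolynomial (Fin 2) ℂ}
    (hC : IsCocycle C) (hCn : ∀ γ, C γ ∈ homog n) :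
    act (C ModularGroup.S) (ModularGroup.S : SL(2, ℤ)) + C ModularGroup.S = 0 := by
  rw [← hC, ← hC.neg_one hn hCn]
  congr 1
  ext i j
  fin_cases i <;> fin_cases j <;> rfl

lemma IsCocycle.apply_ST {n : ℕ} (hn : Even n) {C : SL(2, ℤ) → MvPolynomial (Fin 2) ℂ}
    (hC : IsCocycle C) (hCn : ∀ γ, C γ ∈ homog n) {U : SL(2, ℤ)}
    (hU : U = ModularGroup.S * ModularGroup.T) :
    act (act (C U) U) U + act (C U) U + C U = 0 := by
  rw [← act_add, ← hC, ← hC, ← hC.neg_one hn hCn]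
  congr 1
  ext i j
  subst hU
  fin_cases i <;> fin_cases j <;> rfl

lemma IsCocycle.sub {C D : SL(2, ℤ) → MvPolynomial (Fin 2) ℂ} (hC : IsCocycle C)
    (hD : IsCocycle D) : IsCocycle fun γ ↦ C γ - D γ := fun γ δ ↦ by
  simp only [hC γ δ, hD γ δ, act_sub]
  ring

lemma isCocycle_coboundary (P : MvPolynomial (Fin 2) ℂ) :
    IsCocycle fun γ ↦ act P (γ : Matrix (Fin 2) (Fin 2) ℤ) - P := fun γ δ ↦ by
  simp only [act_sub, act_act, Matrix.SpecialLinearGroup.coe_mul]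
  ring

lemma IsCocycle.add {C D : SL(2, ℤ) → MvPolynomial (Fin 2) ℂ} (hC : IsCocycle C)
    (hD : IsCocycle D) : IsCocycle fun γ ↦ C γ + D γ := fun γ δ ↦ by
  simp only [hC γ δ, hD γ δ, act_add]
  ring

lemma coboundary_mem_homog {n : ℕ} {P : MvPolynomial (Fin 2) ℂ} (hP : P ∈ homog n)
    (γ : Matrix (Fin 2) (Fin 2) ℤ) : act P γ - P ∈ homog n :=
  Submodule.sub_mem _ (act_mem_homog _ hP) hP

/-! ### Coefficients in an eigenbasis -/

/-- The exponent of `X ^ (n - j) * Y ^ j`. -/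
def expo (n j : ℕ) : Fin 2 →₀ ℕ := Finsupp.single 0 (n - j) + Finsupp.single 1 j

lemma homog_eq_zero_of_coeff {n : ℕ} {P : MvPolynomial (Fin 2) ℂ} (hP : P ∈ homog n)
    (h : ∀ j ≤ n, P.coeff (expo n j) = 0) : P = 0 := by
  ext e
  by_contra he
  have hd := hP he
  rw [Finsupp.weight_apply, Finsupp.sum_fintype _ _ (by simp)] at hd
  simp only [Fin.sum_univ_two, Pi.one_apply, smul_eq_mul, mul_one] at hd
  apply he
  rw [MvPolynomial.coeff_zero, ← h (e 1) (by omega)]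
  congr 1
  ext i
  fin_cases i <;> simp [expo]
  omega

lemma coeff_actC_diagonal (lam mu : ℂ) (P : MvPolynomial (Fin 2) ℂ) (e : Fin 2 →₀ ℕ) :
    (actC !![lam, 0; 0, mu] P).coeff e = lam ^ e 0 * mu ^ e 1 * P.coeff e := by
  induction P using MvPolynomial.induction_on' with
  | monomial u a =>
    have : actC !![lam, 0; 0, mu] (MvPolynomial.monomial u a) =
        MvPolynomial.monomial u (lam ^ u 0 * mu ^ u 1 * a) := ext_ev fun x y ↦ by
      simp only [ev_actC]
      simp only [ev, MvPolynomial.eval_monomial, Finsupp.prod_fintype _ _ (fun _ ↦ pow_zero _),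
        Fin.prod_univ_two]
      simp [mul_pow]
      ring
    rw [this, MvPolynomial.coeff_monomial, MvPolynomial.coeff_monomial]
    split_ifs with h
    · rw [h]
    · simp
  | add p q hp hq => rw [map_add, MvPolynomial.coeff_add, hp, hq, MvPolynomial.coeff_add, mul_add]

/-- The matrix of eigenvectors of `!![0, -1; 1, lam + mu]`, where `lam * mu = 1`. -/
def eigMat (lam mu : ℂ) : Matrix (Fin 2) (Fin 2) ℂ := !![1, 1; -lam, -mu]

/-- Diagonalises S for t = 0 and ST for t = 1, so the group relations become scalar conditions on
each monomial coefficient. -/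
lemma actC_eigMat_act {lam mu : ℂ} {t : ℤ} (hs : lam + mu = t) (hp : lam * mu = 1)
    (P : MvPolynomial (Fin 2) ℂ) : actC (eigMat lam mu) (act P !![0, -1; 1, t]) =
      actC !![lam, 0; 0, mu] (actC (eigMat lam mu) P) := by
  rw [act_eq_actC, actC_actC, actC_actC]
  congr 2
  ext i j
  fin_cases i <;> fin_cases j <;> simp [eigMat, Matrix.mul_apply, Fin.sum_univ_two, ← hs]
  · linear_combination -hp
  · linear_combination -hp

lemma actC_one (P : MvPolynomial (Fin 2) ℂ) : actC 1 P = P := ext_ev fun x y ↦ by simp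

lemma actC_eigMat_injective {lam mu : ℂ} (h : lam ≠ mu) {P : MvPolynomial (Fin 2) ℂ}
    (hP : actC (eigMat lam mu) P = 0) : P = 0 := by
  have hdet : IsUnit (eigMat lam mu).det := by
    rw [isUnit_iff_ne_zero, eigMat, Matrix.det_fin_two_of]
    intro h0
    apply h
    linear_combination h0
  have := actC_actC (eigMat lam mu) (eigMat lam mu)⁻¹ P
  rwa [Matrix.mul_nonsing_inv _ hdet, actC_one, hP, map_zero, eq_comm] at this

lemma expo_zero (n j : ℕ) : expo n j 0 = n - j := by simp [expo]

lemma expo_one (n j : ℕ) : expo n j 1 = j := by simp [expo]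

/-- The eigenvalue on the monomial with exponents (2m - j, j) is lam^(2m - 2j), written here without
negative exponents. -/
lemma eig_pow {lam mu : ℂ} (hp : lam * mu = 1) {m j : ℕ} (hj : j ≤ 2 * m) :
    lam ^ (2 * m - j) * mu ^ j * lam ^ (2 * j) = lam ^ (2 * m) := by
  have : lam ^ (2 * m) = lam ^ (2 * m - j) * lam ^ j := by rw [← pow_add]; congr 1; omega
  rw [this, two_mul j, pow_add]
  have h : mu ^ j * lam ^ j = 1 := by rw [← mul_pow, mul_comm, hp, one_pow]
  linear_combination lam ^ (2 * m - j) * lam ^ j * h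

/-- The coordinate indices on which a cocycle may be nonzero at `S`. -/
def indS (m : ℕ) : Finset ℕ := (Finset.range (2 * m + 1)).filter fun j ↦ (m + j) % 2 = 1

/-- The coordinate indices on which a cocycle may be nonzero at `S * T`. -/
def indU (m : ℕ) : Finset ℕ := (Finset.range (2 * m + 1)).filter fun j ↦ (j + 2 * m) % 3 ≠ 0

/-- A primitive sixth root of unity. -/
def rootU : ℂ := (1 + Real.sqrt 3 * Complex.I) / 2

lemma rootU_sq : rootU ^ 2 = rootU - 1 := by
  have : ((Real.sqrt 3 : ℝ) : ℂ) ^ 2 = 3 := by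
    rw [← Complex.ofReal_pow, Real.sq_sqrt (by norm_num)]; norm_num
  rw [rootU]
  linear_combination (Complex.I ^ 2 / 4) * this + (3 / 4) * Complex.I_sq

lemma rootU_pow_two_mul (k : ℕ) :
    1 + rootU ^ (2 * k) + rootU ^ (4 * k) = 0 ∨ k % 3 = 0 := by
  have h3 : (rootU ^ 2) ^ 3 = 1 := by
    linear_combination (rootU ^ 4 + rootU ^ 3 - rootU - 1) * rootU_sq
  have key : 1 + rootU ^ 2 + rootU ^ 4 = 0 := by
    linear_combination (rootU ^ 2 + rootU + 1) * rootU_sq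
  have e2 : ∀ k, rootU ^ (2 * k) = (rootU ^ 2) ^ (k % 3) := fun k ↦ by
    conv_lhs => rw [pow_mul, ← Nat.div_add_mod k 3, pow_add, pow_mul, h3, one_pow, one_mul]
  have : k % 3 = 0 ∨ k % 3 = 1 ∨ k % 3 = 2 := by omega
  rcases this with h | h | h
  · exact Or.inr h
  · left
    rw [show 4 * k = 2 * (2 * k) by ring, e2, e2, h, show 2 * k % 3 = 2 by omega]
    linear_combination key
  · left
    rw [show 4 * k = 2 * (2 * k) by ring, e2, e2, h, show 2 * k % 3 = 1 by omega]
    linear_combination key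

/-- S acts on coordinate j by (-1)^(m-j), and the relation C|S + C = 0 permits only the eigenvalue
-1, that is, m + j odd. -/
lemma IsCocycle.coeff_S {m : ℕ} {C : SL(2, ℤ) → MvPolynomial (Fin 2) ℂ}
    (hC : IsCocycle C) (hCn : ∀ γ, C γ ∈ homog (2 * m)) {j : ℕ} (hj : j ≤ 2 * m)
    (hj' : j ∉ indS m) : (actC (eigMat Complex.I (-Complex.I)) (C ModularGroup.S)).coeff
      (expo (2 * m) j) = 0 := by
  have h1 := hC.apply_S (even_two_mul m) hCn
  have h2 := actC_eigMat_act (lam := Complex.I) (mu := -Complex.I) (t := 0) (by simp)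
    (by simp) (C ModularGroup.S)
  have h3 := congrArg (fun P ↦ (actC (eigMat Complex.I (-Complex.I)) P).coeff (expo (2 * m) j)) h1
  simp only [map_add, map_zero, MvPolynomial.coeff_add, MvPolynomial.coeff_zero] at h3
  rw [show ((ModularGroup.S : SL(2, ℤ)) : Matrix (Fin 2) (Fin 2) ℤ) = !![0, -1; 1, 0] from rfl, h2,
    coeff_actC_diagonal, expo_zero, expo_one] at h3
  have h4 := eig_pow (lam := Complex.I) (mu := -Complex.I) (by simp) hj
  have hne : Complex.I ^ (2 * j) ≠ 0 := pow_ne_zero _ Complex.I_ne_zero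
  have hpar : Complex.I ^ (2 * m) = Complex.I ^ (2 * j) := by
    rw [pow_mul, pow_mul, Complex.I_sq]
    simp only [indS, Finset.mem_filter, Finset.mem_range] at hj'
    exact neg_one_pow_congr (by simp only [Nat.even_iff]; omega)
  rw [hpar] at h4
  rw [(mul_eq_right₀ hne).1 h4, one_mul, ← two_mul] at h3
  simpa using h3

/-- ST acts on coordinate j by a cube root of unity λ with (1 + λ + λ²) times the coordinate equal
to 0. The coordinate vanishes when λ = 1, which holds for j ≡ m mod 3. -/
lemma IsCocycle.coeff_U {m : ℕ} {C : SL(2, ℤ) → MvPolynomial (Fin 2) ℂ}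
    (hC : IsCocycle C) (hCn : ∀ γ, C γ ∈ homog (2 * m)) {j : ℕ} (hj : j ≤ 2 * m)
    (hj' : j ∉ indU m) : (actC (eigMat rootU (1 - rootU)) (C (ModularGroup.S * ModularGroup.T))).coeff
      (expo (2 * m) j) = 0 := by
  have hp : rootU * (1 - rootU) = 1 := by linear_combination -rootU_sq
  have h1 := hC.apply_ST (even_two_mul m) hCn rfl
  have h2 := fun P ↦ actC_eigMat_act (lam := rootU) (mu := 1 - rootU) (t := 1) (by simp) hp P
  have h3 := congrArg (fun P ↦ (actC (eigMat rootU (1 - rootU)) P).coeff (expo (2 * m) j)) h1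
  simp only [map_add, map_zero, MvPolynomial.coeff_add, MvPolynomial.coeff_zero] at h3
  have e : ((ModularGroup.S * ModularGroup.T : SL(2, ℤ)) : Matrix (Fin 2) (Fin 2) ℤ) =
      !![0, -1; 1, 1] := by
    ext i j
    fin_cases i <;> fin_cases j <;> rfl
  rw [e] at h3
  rw [h2, h2, coeff_actC_diagonal, coeff_actC_diagonal, expo_zero, expo_one] at h3
  have h4 := eig_pow hp hj
  have h5 := rootU_pow_two_mul
  have h6 : (rootU ^ 2) ^ 3 = 1 := by
    linear_combination (rootU ^ 4 + rootU ^ 3 - rootU - 1) * rootU_sq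
  have hne : rootU ^ (2 * j) ≠ 0 := by
    refine pow_ne_zero _ fun h ↦ ?_
    rw [h] at hp
    simp at hp
  have hpar : rootU ^ (2 * m) = rootU ^ (2 * j) := by
    simp only [indU, Finset.mem_filter, Finset.mem_range] at hj'
    have : m % 3 = j % 3 := by omega
    rw [pow_mul, pow_mul, ← Nat.div_add_mod m 3, ← Nat.div_add_mod j 3, pow_add, pow_add, pow_mul,
      pow_mul _ 3, h6, one_pow, one_pow, this]
  rw [hpar] at h4
  rw [(mul_eq_right₀ hne).1 h4, one_mul, one_mul] at h3
  have : (3 : ℂ) * (actC (eigMat rootU (1 - rootU))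
    (C (ModularGroup.S * ModularGroup.T))).coeff (expo (2 * m) j) = 0 := by linear_combination h3
  simpa using this

lemma rootU_ne : rootU ≠ 1 - rootU := fun h ↦ by
  have h3 : (3 : ℂ) = 0 := by
    linear_combination 4 * rootU_sq + (-2 * rootU + 1) * h
  norm_num at h3

/-- A cocycle with values in binary forms of even degree is determined by some of the eigenbasis
coordinates of its values at `S` and `S * T`. -/
lemma IsCocycle.eq_zero_of_coeff {m : ℕ} {C : SL(2, ℤ) → MvPolynomial (Fin 2) ℂ}
    (hC : IsCocycle C) (hCn : ∀ γ, C γ ∈ homog (2 * m))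
    (hS : ∀ j ∈ indS m, (actC (eigMat Complex.I (-Complex.I)) (C ModularGroup.S)).coeff
      (expo (2 * m) j) = 0)
    (hU : ∀ j ∈ indU m, (actC (eigMat rootU (1 - rootU)) (C (ModularGroup.S * ModularGroup.T))).coeff
      (expo (2 * m) j) = 0) (γ : SL(2, ℤ)) : C γ = 0 := by
  refine hC.eq_zero ?_ ?_ γ
  · refine actC_eigMat_injective (lam := Complex.I) (mu := -Complex.I) (fun h ↦ ?_)
      (homog_eq_zero_of_coeff (actC_mem_homog _ (hCn _)) fun j hj ↦ ?_)
    · simpa using congrArg Complex.im (eq_neg_iff_add_eq_zero.1 h)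
    · by_cases h : j ∈ indS m
      · exact hS j h
      · exact hC.coeff_S hCn hj h
  · refine actC_eigMat_injective rootU_ne
      (homog_eq_zero_of_coeff (actC_mem_homog _ (hCn _)) fun j hj ↦ ?_)
    by_cases h : j ∈ indU m
    · exact hU j h
    · exact hC.coeff_U hCn hj h

lemma card_indS (m : ℕ) : (indS m).card = 2 * ((m + 1) / 2) := by
  have := Nat.count_modEq_card (2 * m + 1) (r := 2) (by norm_num) (m + 1)
  rw [Nat.count_eq_card_filter_range] at this
  rw [indS, Finset.filter_congr (q := fun j ↦ j ≡ m + 1 [MOD 2]), this]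
  · split_ifs <;> omega
  · intro j _
    simp only [Nat.ModEq]
    omega

lemma card_indU (m : ℕ) : (indU m).card + 2 * (m / 3) = 2 * m := by
  have h := Nat.count_modEq_card (2 * m + 1) (r := 3) (by norm_num) m
  rw [Nat.count_eq_card_filter_range] at h
  have h2 := Finset.card_filter_add_card_filter_not (s := Finset.range (2 * m + 1))
    (fun j ↦ j ≡ m [MOD 3])
  rw [h, Finset.card_range] at h2
  rw [indU, Finset.filter_congr (q := fun j ↦ ¬ j ≡ m [MOD 3])]
  · split_ifs at h2 <;> omega
  · intro j _
    simp only [Nat.ModEq]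
    omega

/-! ### Linearity of the comparison map -/

lemma cocycle_add {n : ℕ} {f g : ℍ → ℂ} (hf : IsWeaklyHolomorphic (n + 2) f)
    (hg : IsWeaklyHolomorphic (n + 2) g) (γ : SL(2, ℤ)) :
    cocycle n (fun z ↦ f z + g z) γ = cocycle n f γ + cocycle n g γ := ext_ev fun x y ↦ by
  obtain ⟨_, a, -, ha⟩ := hf.2.2
  obtain ⟨B, hB, -⟩ := exists_isPrimitive ha n
  obtain ⟨_, b, -, hb⟩ := hg.2.2
  obtain ⟨E, hE, -⟩ := exists_isPrimitive hb n
  rw [ev_add, ev_cocycle hf.continuous hB, ev_cocycle hg.continuous hE,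
    ev_cocycle (hf.add hg).continuous (hB.add hE)]
  ring

lemma cocycle_const_mul {n : ℕ} {f : ℍ → ℂ} (c : ℂ) (hf : IsWeaklyHolomorphic (n + 2) f)
    (γ : SL(2, ℤ)) : cocycle n (fun z ↦ c * f z) γ = c • cocycle n f γ := ext_ev fun x y ↦ by
  obtain ⟨_, a, -, ha⟩ := hf.2.2
  obtain ⟨B, hB, -⟩ := exists_isPrimitive ha n
  rw [ev_smul, ev_cocycle hf.continuous hB, ev_cocycle (hf.const_mul c).continuous (hB.const_mul c)]
  ring

lemma cocycle_sub {n : ℕ} {f g : ℍ → ℂ} (hf : IsWeaklyHolomorphic (n + 2) f)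
    (hg : IsWeaklyHolomorphic (n + 2) g) (γ : SL(2, ℤ)) :
    cocycle n (fun z ↦ f z - g z) γ = cocycle n f γ - cocycle n g γ := by
  have := cocycle_add (hf.sub hg) hg γ
  simp only [sub_add_cancel] at this
  rw [this, add_sub_cancel_right]

lemma bolImage_iff_coboundary {n : ℕ} {f : ℍ → ℂ} (hf : IsWeaklyHolomorphic (n + 2) f) :
    IsBolImage n f ↔ ∃ P ∈ homog n, ∀ γ : SL(2, ℤ),
      cocycle n f γ = act P (γ : Matrix (Fin 2) (Fin 2) ℤ) - P :=
  ⟨fun ⟨_, hh, hu⟩ ↦ (isWeaklyHolomorphic_of_isBolImage hh hu).2.2,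
    fun ⟨_, hP, h⟩ ↦ isBolImage_of_coboundary hf hP h⟩

lemma IsBolImage.isWeaklyHolomorphic {n : ℕ} {f : ℍ → ℂ} (hf : IsBolImage n f) :
    IsWeaklyHolomorphic (n + 2) f := by
  obtain ⟨h, hh, hu⟩ := hf
  exact (isWeaklyHolomorphic_of_isBolImage hh hu).1

lemma bolCongruent_iff {n : ℕ} {f g : ℍ → ℂ} (hf : IsWeaklyHolomorphic (n + 2) f)
    (hg : IsWeaklyHolomorphic (n + 2) g) :
    BolCongruent n f g ↔ Cohomologous n (cocycle n g) (cocycle n f) := by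
  rw [BolCongruent, bolImage_iff_coboundary (hg.sub hf)]
  simp only [cocycle_sub hg hf]
  rfl

lemma BolCongruent.isWeaklyHolomorphic {n : ℕ} {f g : ℍ → ℂ} (hf : IsWeaklyHolomorphic (n + 2) f)
    (h : BolCongruent n f g) : IsWeaklyHolomorphic (n + 2) g := by
  have := hf.add (IsBolImage.isWeaklyHolomorphic h)
  simpa using this

lemma Cohomologous.symm {n : ℕ} {C D : SL(2, ℤ) → MvPolynomial (Fin 2) ℂ}
    (h : Cohomologous n C D) : Cohomologous n D C := by
  obtain ⟨P, hP, h⟩ := h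
  refine ⟨-P, Submodule.neg_mem _ hP, fun γ ↦ ?_⟩
  have := h γ
  have e : act (-P) (γ : Matrix (Fin 2) (Fin 2) ℤ) = -act P γ := by
    simpa using act_smul (-1) P (γ : Matrix (Fin 2) (Fin 2) ℤ)
  rw [e]
  linear_combination -this

lemma Cohomologous.trans {n : ℕ} {C D E : SL(2, ℤ) → MvPolynomial (Fin 2) ℂ}
    (h : Cohomologous n C D) (h' : Cohomologous n D E) : Cohomologous n C E := by
  obtain ⟨P, hP, h⟩ := h
  obtain ⟨Q, hQ, h'⟩ := h'
  refine ⟨P + Q, Submodule.add_mem _ hP hQ, fun γ ↦ ?_⟩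
  rw [act_add]
  linear_combination h γ + h' γ

/-! ### Reduced forms -/

/-- The dimension of the space of cusp forms of weight `n + 2`. -/
def cuspDim (n : ℕ) : ℕ := Module.finrank ℂ (CuspForm 𝒮ℒ ((n : ℤ) + 2))

lemma isReduced_iff {n : ℕ} {f : ℍ → ℂ} : IsReduced n f ↔
    ∃ F : ModularForm 𝒮ℒ ((n : ℤ) + 2 + 12 * cuspDim n), f = divDiscPow (cuspDim n) F := by
  constructor
  · rintro ⟨hf, a, ha, h0⟩
    exact exists_modularForm_of_order hf ha h0
  · rintro ⟨F, rfl⟩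
    obtain ⟨h, a, ha, h0⟩ := isWeaklyHolomorphic_divDiscPow (cuspDim n) F
    exact ⟨h, a, ha, h0⟩

lemma finrank_modularForm {k : ℕ} (hk : Even k) :
    (k % 12 = 2 → Module.finrank ℂ (ModularForm 𝒮ℒ (k : ℤ)) = k / 12) ∧
    (k % 12 ≠ 2 → Module.finrank ℂ (ModularForm 𝒮ℒ (k : ℤ)) = k / 12 + 1) := by
  have h := ModularForm.dimension_level_one k hk
  refine ⟨fun h2 ↦ Module.finrank_eq_of_rank_eq ?_, fun h2 ↦ Module.finrank_eq_of_rank_eq ?_⟩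
  · rw [h, if_pos (show k ≡ 2 [MOD 12] from h2)]
  · rw [h, if_neg (show ¬ k ≡ 2 [MOD 12] from h2)]

/-- The dimension of all forms of weight n + 2 exceeds that of cusp forms by one; n ≡ 0 mod 12 is
the exceptional weight class 2 mod 12. -/
lemma cuspDim_eq {n : ℕ} (hn : Even n) (h1 : 1 ≤ n) :
    (n % 12 = 0 → cuspDim n + 1 = (n + 2) / 12) ∧
    (n % 12 ≠ 0 → cuspDim n + 1 = (n + 2) / 12 + 1) := by
  have hk : Even (n + 2) := by simpa [Nat.even_add]
  have h := ModularForm.rank_eq_one_add_rank_cuspForm (k := n + 2) (by omega) hk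
  have h2 := finrank_modularForm hk
  have hfin : Module.rank ℂ (CuspForm 𝒮ℒ ((n + 2 : ℕ) : ℤ)) < Cardinal.aleph0 := by
    refine lt_of_le_of_lt (self_le_add_left _ 1) ?_
    rw [← h]
    exact Module.rank_lt_aleph0 ℂ _
  have h3 := congrArg Cardinal.toNat h
  rw [Cardinal.toNat_add Cardinal.one_lt_aleph0 hfin, map_one] at h3
  change Module.finrank ℂ _ = 1 + Module.finrank ℂ (CuspForm 𝒮ℒ ((n + 2 : ℕ) : ℤ)) at h3
  have h4 : cuspDim n = Module.finrank ℂ (CuspForm 𝒮ℒ ((n + 2 : ℕ) : ℤ)) := by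
    rw [cuspDim, Nat.cast_add, Nat.cast_two]
  rw [← h4] at h3
  change Module.finrank ℂ _ = _ at h3
  rw [h3] at h2
  omega

lemma cuspDim_zero : cuspDim 0 = 0 := by
  have := CuspForm.rank_eq_zero_of_weight_lt_twelve (k := ((0 : ℕ) : ℤ) + 2) (by norm_num)
  rw [cuspDim, Module.finrank, this, map_zero]

/-- With d the dimension of cusp forms, raising the weight by 12 d raises the dimension d + 1 by d.
-/
lemma finrank_reduced {n : ℕ} (hn : Even n) (h1 : 1 ≤ n) :
    Module.finrank ℂ (ModularForm 𝒮ℒ ((n : ℤ) + 2 + 12 * cuspDim n)) = 2 * cuspDim n + 1 := by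
  have hk : Even (n + 2 + 12 * cuspDim n) := by simp [Nat.even_add, hn, show Even 12 by decide]
  rw [show (n : ℤ) + 2 + 12 * cuspDim n = ((n + 2 + 12 * cuspDim n : ℕ) : ℤ) by push_cast; ring]
  have h2 := finrank_modularForm hk
  have h := cuspDim_eq hn h1
  omega

lemma modularForm_eq_zero_of_weight {k : ℤ} (hk : k < 0 ∨ k = 2) (F : ModularForm 𝒮ℒ k) : F = 0 := by
  refine rank_zero_iff_forall_zero (R := ℂ) |>.mp ?_ F
  rcases hk with h | rfl
  · exact ModularForm.levelOne_neg_weight_rank_zero h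
  · exact ModularForm.levelOne_weight_two_rank_zero

lemma divDiscPow_zero (d : ℕ) : divDiscPow d 0 = 0 := funext fun z ↦ by simp [divDiscPow]

/-- For g = D^{n+1} h the coefficients satisfy a_m = m^(n+1) b_m, so h has no larger pole than
allowed to g. Multiplying h by the d-th power of the discriminant gives weight -n + 12 d, which is
negative or equal to 2, and no nonzero holomorphic form has such a weight. In degree n = 0 a reduced
form is itself holomorphic of weight 2. -/
lemma IsReduced.eq_zero_of_bolImage {n : ℕ} (hn : Even n) {g : ℍ → ℂ} (hg : IsReduced n g)
    (hb : IsBolImage n g) : g = 0 := by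
  rcases Nat.eq_zero_or_pos n with rfl | h1
  · obtain ⟨F, hF⟩ := isReduced_iff.1 hg
    have : F = 0 := modularForm_eq_zero_of_weight (by simp [cuspDim_zero]) F
    rw [hF, this]
    exact divDiscPow_zero _
  · obtain ⟨h, hh, hu⟩ := hb
    obtain ⟨N, b, -, hb⟩ := hh.2.2
    obtain ⟨_, a, ha, h0⟩ := hg
    have hab := ha.unique ((isWeaklyHolomorphic_of_isBolImage hh hu).2.1 b hb)
    have hb0 : ∀ m < -(cuspDim n : ℤ), b m = 0 := fun m hm ↦ by
      have := h0 m hm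
      rw [hab] at this
      have hm' : (m : ℂ) ≠ 0 := by exact_mod_cast (by omega : m ≠ 0)
      exact (mul_eq_zero.1 this).resolve_left (pow_ne_zero _ hm')
    obtain ⟨F, hF⟩ := exists_modularForm_of_order hh hb hb0
    have hF0 : F = 0 := by
      refine modularForm_eq_zero_of_weight ?_ F
      have := cuspDim_eq hn h1
      rw [Nat.even_iff] at hn
      omega
    have hh0 : h = 0 := by
      rw [hF, hF0]
      exact divDiscPow_zero _
    have hzero := (isWeaklyHolomorphic_of_isBolImage hh hu).2.1 0 (fun z ↦ by simp [hh0])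
    funext z
    refine (hzero z).unique ?_
    simp

/-! ### Surjectivity of the comparison map -/

/-- The binary form with coefficients `a`. -/
def ofCoeffs (n : ℕ) (a : Fin (n + 1) → ℂ) : MvPolynomial (Fin 2) ℂ :=
  ∑ j : Fin (n + 1), MvPolynomial.monomial (expo n j) (a j)

lemma ofCoeffs_mem_homog {n : ℕ} (a : Fin (n + 1) → ℂ) : ofCoeffs n a ∈ homog n := by
  refine Submodule.sum_mem _ fun j _ ↦ MvPolynomial.isHomogeneous_monomial _ ?_
  have := j.2
  rw [expo, map_add, Finsupp.degree_single, Finsupp.degree_single]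
  omega

lemma coeff_ofCoeffs {n : ℕ} (a : Fin (n + 1) → ℂ) (j : Fin (n + 1)) :
    (ofCoeffs n a).coeff (expo n j) = a j := by
  rw [ofCoeffs, MvPolynomial.coeff_sum, Finset.sum_eq_single j]
  · rw [MvPolynomial.coeff_monomial, if_pos rfl]
  · intro i _ hij
    rw [MvPolynomial.coeff_monomial, if_neg]
    intro h
    have := DFunLike.congr_fun h 1
    rw [expo_one, expo_one] at this
    exact hij (Fin.ext this)
  · simp

lemma ofCoeffs_add {n : ℕ} (a b : Fin (n + 1) → ℂ) :
    ofCoeffs n (a + b) = ofCoeffs n a + ofCoeffs n b := by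
  simp [ofCoeffs, Finset.sum_add_distrib]

lemma ofCoeffs_smul {n : ℕ} (c : ℂ) (a : Fin (n + 1) → ℂ) :
    ofCoeffs n (c • a) = c • ofCoeffs n a := by
  simp [ofCoeffs, Finset.smul_sum, MvPolynomial.smul_monomial]

/-- The cocycle of the reduced form `F / Δ ^ d` plus a coboundary. -/
def totalCocycle (n : ℕ) (p : ModularForm 𝒮ℒ ((n : ℤ) + 2 + 12 * cuspDim n) × (Fin (n + 1) → ℂ))
    (γ : SL(2, ℤ)) : MvPolynomial (Fin 2) ℂ :=
  cocycle n (divDiscPow (cuspDim n) p.1) γ +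
    (act (ofCoeffs n p.2) (γ : Matrix (Fin 2) (Fin 2) ℤ) - ofCoeffs n p.2)

lemma totalCocycle_add {n : ℕ}
    (p q : ModularForm 𝒮ℒ ((n : ℤ) + 2 + 12 * cuspDim n) × (Fin (n + 1) → ℂ)) (γ : SL(2, ℤ)) :
    totalCocycle n (p + q) γ = totalCocycle n p γ + totalCocycle n q γ := by
  have e : divDiscPow (cuspDim n) (p + q).1 =
      fun z ↦ divDiscPow (cuspDim n) p.1 z + divDiscPow (cuspDim n) q.1 z := by
    funext z
    simp [divDiscPow, add_mul]
  rw [totalCocycle, e, cocycle_add (isWeaklyHolomorphic_divDiscPow _ _).1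
    (isWeaklyHolomorphic_divDiscPow _ _).1, Prod.snd_add, ofCoeffs_add, act_add, totalCocycle,
    totalCocycle]
  ring

lemma totalCocycle_smul {n : ℕ} (c : ℂ)
    (p : ModularForm 𝒮ℒ ((n : ℤ) + 2 + 12 * cuspDim n) × (Fin (n + 1) → ℂ)) (γ : SL(2, ℤ)) :
    totalCocycle n (c • p) γ = c • totalCocycle n p γ := by
  have e : divDiscPow (cuspDim n) (c • p).1 = fun z ↦ c * divDiscPow (cuspDim n) p.1 z := by
    funext z
    simp [divDiscPow, mul_assoc]
  rw [totalCocycle, e, cocycle_const_mul c (isWeaklyHolomorphic_divDiscPow _ _).1, Prod.smul_snd,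
    ofCoeffs_smul, act_smul, totalCocycle, smul_add, smul_sub]

lemma isCocycle_totalCocycle {n : ℕ}
    (p : ModularForm 𝒮ℒ ((n : ℤ) + 2 + 12 * cuspDim n) × (Fin (n + 1) → ℂ)) :
    IsCocycle (totalCocycle n p) :=
  (isCocycle_cocycle (isWeaklyHolomorphic_divDiscPow _ _).1).add (isCocycle_coboundary _)

lemma totalCocycle_mem_homog {n : ℕ}
    (p : ModularForm 𝒮ℒ ((n : ℤ) + 2 + 12 * cuspDim n) × (Fin (n + 1) → ℂ)) (γ : SL(2, ℤ)) :
    totalCocycle n p γ ∈ homog n :=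
  Submodule.add_mem _ (cocycle_mem_homog _ _ _) (coboundary_mem_homog (ofCoeffs_mem_homog _) _)

/-- The eigenbasis coordinates at `S` and `S * T`. -/
def coordMap (m : ℕ) : (ModularForm 𝒮ℒ (((2 * m : ℕ) : ℤ) + 2 + 12 * cuspDim (2 * m)) ×
    (Fin (2 * m + 1) → ℂ)) →ₗ[ℂ] (indS m → ℂ) × (indU m → ℂ) where
  toFun p := (fun j ↦ (actC (eigMat Complex.I (-Complex.I))
      (totalCocycle (2 * m) p ModularGroup.S)).coeff (expo (2 * m) j),
    fun j ↦ (actC (eigMat rootU (1 - rootU))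
      (totalCocycle (2 * m) p (ModularGroup.S * ModularGroup.T))).coeff (expo (2 * m) j))
  map_add' p q := by
    simp only [totalCocycle_add, map_add, MvPolynomial.coeff_add]
    rfl
  map_smul' c p := by
    simp only [totalCocycle_smul, map_smul, MvPolynomial.coeff_smul]
    rfl

lemma cocycle_zero (n : ℕ) (γ : SL(2, ℤ)) : cocycle n 0 γ = 0 := by
  have := cocycle_const_mul 0 (isWeaklyHolomorphic_zero (n + 2)) γ
  simpa [← Pi.zero_def] using this

/-- Binary forms of positive degree have no invariants. -/
lemma homog_eq_zero_of_invariant {n : ℕ} (hn : 1 ≤ n) {P : MvPolynomial (Fin 2) ℂ}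
    (hP : P ∈ homog n)
    (h : ∀ γ : SL(2, ℤ), act P (γ : Matrix (Fin 2) (Fin 2) ℤ) = P) : P = 0 := by
  obtain ⟨κ, hκ⟩ := exists_eq_const_of_T_invariant hP (h ModularGroup.T)
  have hPy : ∀ x y, ev x y P = y ^ n * κ := by
    intro x y
    have hQ : MvPolynomial.C κ * MvPolynomial.X 1 ^ n ∈ homog n := by
      refine C_mul_mem_homog _ ?_
      simpa using (MvPolynomial.isHomogeneous_X ℂ (1 : Fin 2)).pow n
    have : P = MvPolynomial.C κ * MvPolynomial.X 1 ^ n := homog_ext hP hQ fun x ↦ by simp [hκ]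
    rw [this]
    simp
    ring
  -- T-invariance leaves κ Y^n, which S sends to κ X^n; comparing values at (1, 0) gives κ = 0.
  have h1 : ev 1 0 (act P (ModularGroup.S : SL(2, ℤ))) = ev 1 0 P := by rw [h]
  rw [ev_act, hPy, hPy] at h1
  have hn0 : n ≠ 0 := by omega
  simp [ModularGroup.S] at h1
  rw [zero_pow hn0, zero_mul] at h1
  exact ext_ev fun x y ↦ by rw [hPy, h1]; simp

/-- In the kernel the total cocycle vanishes, so the reduced form has a coboundary as cocycle and is
zero. The remaining polynomial is then invariant, hence zero in positive degree. -/
lemma coordMap_injective {m : ℕ} (hm : 1 ≤ m) : Function.Injective (coordMap m) := by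
  rw [← LinearMap.ker_eq_bot, LinearMap.ker_eq_bot']
  rintro ⟨F, a⟩ h
  have h0 := (isCocycle_totalCocycle (n := 2 * m) (F, a)).eq_zero_of_coeff
    (totalCocycle_mem_homog _)
    (fun j hj ↦ congrFun (congrArg Prod.fst h) ⟨j, hj⟩)
    (fun j hj ↦ congrFun (congrArg Prod.snd h) ⟨j, hj⟩)
  simp only [totalCocycle] at h0
  have hb : IsBolImage (2 * m) (divDiscPow (cuspDim (2 * m)) F) := by
    refine isBolImage_of_coboundary (isWeaklyHolomorphic_divDiscPow _ _).1
      (Submodule.neg_mem _ (ofCoeffs_mem_homog a)) fun γ ↦ ?_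
    have e : act (-ofCoeffs (2 * m) a) (γ : Matrix (Fin 2) (Fin 2) ℤ) =
        -act (ofCoeffs (2 * m) a) γ := by
      simpa using act_smul (-1) (ofCoeffs (2 * m) a) (γ : Matrix (Fin 2) (Fin 2) ℤ)
    rw [e]
    linear_combination h0 γ
  have hz := (isReduced_iff.2 ⟨F, rfl⟩).eq_zero_of_bolImage (even_two_mul m) hb
  have ha : ofCoeffs (2 * m) a = 0 := by
    refine homog_eq_zero_of_invariant (by omega) (ofCoeffs_mem_homog a) fun γ ↦ ?_
    have := h0 γ
    rw [hz, cocycle_zero, zero_add] at this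
    exact sub_eq_zero.1 this
  refine Prod.ext (DFunLike.ext _ _ fun z ↦ ?_) (funext fun j ↦ ?_)
  · have := congrFun hz z
    simpa [divDiscPow, ModularForm.discriminant_ne_zero] using this
  · change a j = 0
    rw [← coeff_ofCoeffs a j, ha]
    rfl

/-- An injective map between spaces of equal dimension: (2d + 1) + (2m + 1), for reduced forms and
V_n with n = 2m, equals the number of admissible coordinates at S and ST. For m = 0 the target is
the zero space. -/
lemma coordMap_surjective (m : ℕ) : Function.Surjective (coordMap m) := by
  rcases Nat.eq_zero_or_pos m with rfl | hm
  · have h1 := card_indS 0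
    have h2 := card_indU 0
    have : IsEmpty (indS 0) := ⟨fun x ↦ by
      have := Finset.card_eq_zero.1 h1
      simpa [this] using x.2⟩
    have : IsEmpty (indU 0) := ⟨fun x ↦ by
      have := Finset.card_eq_zero.1 (by simpa using h2)
      simpa [this] using x.2⟩
    exact fun q ↦ ⟨0, Subsingleton.elim _ _⟩
  · rw [← LinearMap.range_eq_top]
    refine Submodule.eq_top_of_finrank_eq (le_antisymm (Submodule.finrank_le _) ?_)
    rw [LinearMap.finrank_range_of_inj (coordMap_injective hm), Module.finrank_prod,
      Module.finrank_prod, finrank_reduced (even_two_mul m) (by omega)]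
    simp only [Module.finrank_fintype_fun_eq_card, Fintype.card_coe, Fintype.card_fin]
    have h1 := card_indS m
    have h2 := card_indU m
    have h3 := cuspDim_eq (even_two_mul m) (by omega)
    omega

/-- A total cocycle with the same admissible coordinates as C differs from C by a cocycle with all
coordinates zero, hence equals C. -/
theorem exists_reduced_cohomologous {n : ℕ} (hn : Even n)
    {C : SL(2, ℤ) → MvPolynomial (Fin 2) ℂ} (hC : IsCocycle C) (hCn : ∀ γ, C γ ∈ homog n) :
    ∃ g, IsReduced n g ∧ Cohomologous n (cocycle n g) C := by
  obtain ⟨m, rfl⟩ := hn.exists_two_nsmul n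
  rw [smul_eq_mul] at *
  obtain ⟨⟨F, a⟩, hp⟩ := coordMap_surjective m
    (fun j ↦ (actC (eigMat Complex.I (-Complex.I)) (C ModularGroup.S)).coeff (expo (2 * m) j),
    fun j ↦ (actC (eigMat rootU (1 - rootU))
      (C (ModularGroup.S * ModularGroup.T))).coeff (expo (2 * m) j))
  have h0 := ((isCocycle_totalCocycle (n := 2 * m) (F, a)).sub hC).eq_zero_of_coeff
    (fun γ ↦ Submodule.sub_mem _ (totalCocycle_mem_homog _ _) (hCn γ))
    (fun j hj ↦ by
      rw [map_sub, MvPolynomial.coeff_sub, sub_eq_zero]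
      exact congrFun (congrArg Prod.fst hp) ⟨j, hj⟩)
    (fun j hj ↦ by
      rw [map_sub, MvPolynomial.coeff_sub, sub_eq_zero]
      exact congrFun (congrArg Prod.snd hp) ⟨j, hj⟩)
  refine ⟨_, isReduced_iff.2 ⟨F, rfl⟩, Cohomologous.symm ⟨_, ofCoeffs_mem_homog a, fun γ ↦ ?_⟩⟩
  have := h0 γ
  simp only [totalCocycle] at this
  linear_combination -this

theorem existsUnique_reduced_cohomologous {n : ℕ} (hn : Even n)
    {C : SL(2, ℤ) → MvPolynomial (Fin 2) ℂ} (hC : IsCocycle C) (hCn : ∀ γ, C γ ∈ homog n) :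
    ∃! g, IsReduced n g ∧ Cohomologous n (cocycle n g) C := by
  obtain ⟨g, hg, h⟩ := exists_reduced_cohomologous hn hC hCn
  refine ⟨g, ⟨hg, h⟩, fun g' ⟨hg', h'⟩ ↦ ?_⟩
  have hb := (bolCongruent_iff hg.1 hg'.1).2 (h'.trans h.symm)
  obtain ⟨F, rfl⟩ := isReduced_iff.1 hg
  obtain ⟨F', rfl⟩ := isReduced_iff.1 hg'
  have hr : IsReduced n (divDiscPow (cuspDim n) (F' - F : ModularForm 𝒮ℒ _)) :=
    isReduced_iff.2 ⟨_, rfl⟩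
  have e : divDiscPow (cuspDim n) (F' - F : ModularForm 𝒮ℒ _) =
      fun z ↦ divDiscPow (cuspDim n) F' z - divDiscPow (cuspDim n) F z := by
    funext z
    simp [divDiscPow, sub_mul]
  have := hr.eq_zero_of_bolImage hn (by rw [e]; exact hb)
  rw [e] at this
  exact funext fun z ↦ sub_eq_zero.1 (congrFun this z)

/-! ### Complex conjugation and the real Frobenius -/

/-- The reflection `z ↦ -z̄` of the upper half-plane. -/
def negConj (z : ℍ) : ℍ := ofComplex (-conj (z : ℂ))

lemma coe_negConj (z : ℍ) : (negConj z : ℂ) = -conj (z : ℂ) :=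
  coe_ofComplex (by simpa using z.im_pos)

lemma negConj_I : negConj UpperHalfPlane.I = UpperHalfPlane.I := by
  ext
  rw [coe_negConj]
  simp

lemma aut_epsConj_negConj (γ : SL(2, ℤ)) (z : ℍ) :
    aut (epsConj γ) (negConj z) = conj (aut γ z) := by
  simp [aut, epsConj, coe_negConj]

/-- Conjugation by ε is realised geometrically by the reflection z ↦ -z̄. -/
lemma epsConj_smul_negConj (γ : SL(2, ℤ)) (z : ℍ) :
    epsConj γ • negConj z = negConj (γ • z) := by
  ext
  rw [coe_smul, aut_epsConj_negConj, coe_negConj, coe_negConj, coe_smul]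
  simp [epsConj]
  ring

lemma hasDerivH_conj_negConj {f f' : ℍ → ℂ} (h : HasDerivH f f') :
    HasDerivH (fun z ↦ conj (f (negConj z))) (fun z ↦ -conj (f' (negConj z))) := fun z ↦ by
  have h1 := h (negConj z)
  rw [coe_negConj, ← map_neg] at h1
  have h2 := h1.conj_conj
  rw [Complex.conj_conj] at h2
  have h3 := h2.scomp (z : ℂ) (hasDerivAt_neg (z : ℂ))
  refine (h3.congr_deriv (by simp)).congr_of_eventuallyEq ?_
  filter_upwards [eventually_im_pos z] with w hw
  simp [negConj, coe_ofComplex hw]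

/-- Complex conjugation of the coefficients of a polynomial. -/
def conjPoly : MvPolynomial (Fin 2) ℂ →+* MvPolynomial (Fin 2) ℂ := MvPolynomial.map (starRingEnd ℂ)

@[simp] lemma ev_conjPoly (x y : ℂ) (P : MvPolynomial (Fin 2) ℂ) :
    ev x y (conjPoly P) = conj (ev (conj x) (conj y) P) := by
  induction P using MvPolynomial.induction_on with
  | C a => simp [conjPoly]
  | add p q hp hq => simp [hp, hq]
  | mul_X p i hp =>
    rw [map_mul, ev_mul, hp]
    fin_cases i <;> simp [conjPoly]

lemma conjPoly_mem_homog {n : ℕ} {P : MvPolynomial (Fin 2) ℂ} (hP : P ∈ homog n) :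
    conjPoly P ∈ homog n := hP.map _

lemma conjPoly_act (P : MvPolynomial (Fin 2) ℂ) (γ : Matrix (Fin 2) (Fin 2) ℤ) :
    conjPoly (act P γ) = act (conjPoly P) γ := ext_ev fun x y ↦ by simp

lemma IsCocycle.conj {C : SL(2, ℤ) → MvPolynomial (Fin 2) ℂ} (hC : IsCocycle C) :
    IsCocycle fun γ ↦ conjPoly (C γ) := fun γ δ ↦ by
  simp only [hC γ δ, map_add, conjPoly_act]

lemma Cohomologous.conj {n : ℕ} {C D : SL(2, ℤ) → MvPolynomial (Fin 2) ℂ}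
    (h : Cohomologous n C D) :
    Cohomologous n (fun γ ↦ conjPoly (C γ)) (fun γ ↦ conjPoly (D γ)) := by
  obtain ⟨P, hP, h⟩ := h
  exact ⟨conjPoly P, conjPoly_mem_homog hP, fun γ ↦ by
    rw [← map_sub, h, map_sub, conjPoly_act]⟩

lemma nome_negConj (z : ℍ) : nome (negConj z) = conj (nome z) := by
  rw [nome, nome, coe_negConj, ← Complex.exp_conj]
  congr 1
  simp [map_ofNat]

lemma HasQExpansion.conjCoeff {f : ℍ → ℂ} {a : ℤ → ℂ} (h : HasQExpansion f a) :
    HasQExpansion (conjCoeff f) (fun m ↦ conj (a m)) := fun z ↦ by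
  have := (h (negConj z)).map (starRingEnd ℂ) Complex.continuous_conj
  refine (hasSum_congr_fun fun m ↦ ?_).mp this
  simp [nome_negConj]

lemma IsWeaklyHolomorphic.conjCoeff {k : ℤ} {f : ℍ → ℂ} (h : IsWeaklyHolomorphic k f) :
    IsWeaklyHolomorphic k (conjCoeff f) := by
  obtain ⟨-, hm, N, a, h0, ha⟩ := h
  refine ⟨ha.conjCoeff.differentiableOn, isModularOfWeights_zero_iff.2 fun γ z ↦ ?_, N, _,
    fun m hm ↦ by rw [h0 m hm, map_zero], ha.conjCoeff⟩
  change starRingEnd ℂ (f (negConj (γ • z))) = _ * starRingEnd ℂ (f (negConj z))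
  rw [← epsConj_smul_negConj, isModularOfWeights_zero_iff.1 hm, aut_epsConj_negConj]
  simp

/-- A primitive for f^c is minus the conjugate of one for f pulled back by z ↦ -z̄. This sign
cancels that of conj((2πi)^(n+1)) = -(2πi)^(n+1), valid for even n. So the condition defining s(f^c)
becomes plain complex conjugation of cocycles. -/
lemma realFrobenius_cocycle_conjCoeff {n : ℕ} (hn : Even n) {f : ℍ → ℂ}
    (hf : IsWeaklyHolomorphic (n + 2) f) (γ : SL(2, ℤ)) :
    realFrobenius (cocycle n (conjCoeff f)) γ = conjPoly (cocycle n f γ) := ext_ev fun x y ↦ by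
  obtain ⟨_, a, -, ha⟩ := hf.2.2
  obtain ⟨B, hB, -⟩ := exists_isPrimitive ha n
  have hB' : IsPrimitive n (conjCoeff f)
      (fun z x y ↦ -1 * starRingEnd ℂ (B (negConj z) (conj x) (-conj y))) := fun x y ↦ by
    refine ((hasDerivH_conj_negConj (hB (conj x) (-conj y))).const_mul (-1)).congr_deriv fun z ↦ ?_
    simp [coe_negConj]
    left
    rfl
  rw [realFrobenius, ev_act, ev_cocycle hf.conjCoeff.continuous hB', ev_conjPoly,
    ev_cocycle hf.continuous hB]
  have e := epsConj_smul_negConj γ UpperHalfPlane.I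
  rw [negConj_I] at e
  have e' : negConj (epsConj γ • UpperHalfPlane.I) = γ • UpperHalfPlane.I := by
    rw [e]
    ext
    simp [coe_negConj]
  rw [e', negConj_I]
  have hpi : conj ((2 * Real.pi * Complex.I : ℂ) ^ (n + 1)) = -(2 * Real.pi * Complex.I) ^ (n + 1) := by
    rw [map_pow, ← hn.add_one.neg_pow]
    simp [map_ofNat]
  rw [map_mul, hpi]
  simp [epsConj]
  ring_nf

lemma representsSingleValued_conjCoeff_iff {n : ℕ} (hn : Even n) {f g : ℍ → ℂ}
    (hf : IsWeaklyHolomorphic (n + 2) f) : RepresentsSingleValued n (conjCoeff f) g ↔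
      IsWeaklyHolomorphic (n + 2) g ∧
        Cohomologous n (cocycle n g) (fun γ ↦ conjPoly (cocycle n f γ)) := by
  rw [RepresentsSingleValued, show realFrobenius (cocycle n (conjCoeff f)) = _ from
    funext fun γ ↦ realFrobenius_cocycle_conjCoeff hn hf γ]

/-! ### Wirtinger calculus -/

/-- The real-linear map `h ↦ a * h + b * h̄`. -/
def wirtCLM (a b : ℂ) : ℂ →L[ℝ] ℂ :=
  a • ContinuousLinearMap.id ℝ ℂ + b • (Complex.conjCLE : ℂ →L[ℝ] ℂ)

@[simp] lemma wirtCLM_apply (a b h : ℂ) : wirtCLM a b h = a * h + b * conj h := by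
  simp [wirtCLM]

lemma eq_wirtCLM (L : ℂ →L[ℝ] ℂ) :
    L = wirtCLM ((L 1 - Complex.I * L Complex.I) / 2) ((L 1 + Complex.I * L Complex.I) / 2) := by
  ext h
  have e : h = h.re • (1 : ℂ) + h.im • Complex.I := by
    apply Complex.ext <;> simp
  have e2 : L h = h.re * L 1 + h.im * L Complex.I := by
    conv_lhs => rw [e, map_add, map_smul, map_smul]
    simp
  have e3 : h = h.re + h.im * Complex.I := (Complex.re_add_im h).symm
  have e4 : conj h = h.re - h.im * Complex.I := by
    apply Complex.ext <;> simp
  rw [wirtCLM_apply, e2, e4]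
  linear_combination (h.im * L Complex.I) * Complex.I_sq -
    ((L 1 - Complex.I * L Complex.I) / 2) * e3

/-- `F` has Wirtinger derivatives `∂F/∂z = a` and `∂F/∂z̄ = b`. -/
def HasWirt (F a b : ℍ → ℂ) : Prop :=
  ∀ z : ℍ, HasFDerivAt (F ∘ ofComplex) (wirtCLM (a z) (b z)) (z : ℂ)

lemma HasWirt.congr_deriv {F a b a' b' : ℍ → ℂ} (h : HasWirt F a b) (ha : ∀ z, a z = a' z)
    (hb : ∀ z, b z = b' z) : HasWirt F a' b' := fun z ↦ by
  rw [← ha, ← hb]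
  exact h z

lemma HasWirt.wirtinger_eq {F a b : ℍ → ℂ} (h : HasWirt F a b) (z : ℍ) : wirtinger F z = a z := by
  rw [wirtinger, (h z).fderiv]
  simp
  linear_combination (-(a z) / 2 + b z / 2) * Complex.I_sq

lemma HasWirt.wirtingerBar_eq {F a b : ℍ → ℂ} (h : HasWirt F a b) (z : ℍ) :
    wirtingerBar F z = b z := by
  rw [wirtingerBar, (h z).fderiv]
  simp
  linear_combination (a z / 2 - b z / 2) * Complex.I_sq

lemma hasWirt_of_differentiableAt {F : ℍ → ℂ}
    (h : ∀ z : ℍ, DifferentiableAt ℝ (F ∘ ofComplex) (z : ℂ)) :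
    HasWirt F (wirtinger F) (wirtingerBar F) := fun z ↦ by
  rw [wirtinger, wirtingerBar, ← eq_wirtCLM]
  exact (h z).hasFDerivAt

lemma hasWirt_const (c : ℂ) : HasWirt (fun _ ↦ c) (fun _ ↦ 0) (fun _ ↦ 0) := fun z ↦ by
  refine (hasFDerivAt_const (𝕜 := ℝ) c (z : ℂ)).congr_fderiv ?_
  ext h
  simp

lemma HasDerivH.hasWirt {F F' : ℍ → ℂ} (h : HasDerivH F F') : HasWirt F F' (fun _ ↦ 0) := fun z ↦ by
  refine ((h z).hasFDerivAt.restrictScalars ℝ).congr_fderiv ?_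
  ext x
  simp [mul_comm]

lemma HasWirt.conj {F a b : ℍ → ℂ} (h : HasWirt F a b) :
    HasWirt (fun z ↦ conj (F z)) (fun z ↦ conj (b z)) (fun z ↦ conj (a z)) := fun z ↦ by
  refine ((Complex.conjCLE : ℂ →L[ℝ] ℂ).hasFDerivAt.comp (z : ℂ) (h z)).congr_fderiv ?_
  ext x
  simp
  ring

lemma HasWirt.add {F a b G c d : ℍ → ℂ} (h : HasWirt F a b) (h' : HasWirt G c d) :
    HasWirt (fun z ↦ F z + G z) (fun z ↦ a z + c z) (fun z ↦ b z + d z) := fun z ↦ by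
  refine ((h z).add (h' z)).congr_fderiv ?_
  ext x
  simp
  ring

lemma HasWirt.mul {F a b G c d : ℍ → ℂ} (h : HasWirt F a b) (h' : HasWirt G c d) :
    HasWirt (fun z ↦ F z * G z) (fun z ↦ a z * G z + F z * c z)
      (fun z ↦ b z * G z + F z * d z) := fun z ↦ by
  refine ((h z).mul (h' z)).congr_fderiv ?_
  ext x
  simp
  ring

lemma HasWirt.const_mul {F a b : ℍ → ℂ} (c : ℂ) (h : HasWirt F a b) :
    HasWirt (fun z ↦ c * F z) (fun z ↦ c * a z) (fun z ↦ c * b z) :=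
  ((hasWirt_const c).mul h).congr_deriv (fun z ↦ by ring) (fun z ↦ by ring)

lemma HasWirt.sub {F a b G c d : ℍ → ℂ} (h : HasWirt F a b) (h' : HasWirt G c d) :
    HasWirt (fun z ↦ F z - G z) (fun z ↦ a z - c z) (fun z ↦ b z - d z) := by
  simpa [sub_eq_add_neg] using h.add (h'.const_mul (-1))

lemma HasWirt.sum {ι : Type*} (s : Finset ι) {F a b : ι → ℍ → ℂ}
    (h : ∀ i ∈ s, HasWirt (F i) (a i) (b i)) :
    HasWirt (fun z ↦ ∑ i ∈ s, F i z) (fun z ↦ ∑ i ∈ s, a i z) (fun z ↦ ∑ i ∈ s, b i z) := by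
  classical
  induction s using Finset.induction_on with
  | empty => simpa using hasWirt_const 0
  | insert i s hi ih =>
    simp only [Finset.sum_insert hi]
    exact (h i (Finset.mem_insert_self _ _)).add
      (ih fun j hj ↦ h j (Finset.mem_insert_of_mem hj))

lemma HasWirt.pow {F a b : ℍ → ℂ} (h : HasWirt F a b) (k : ℕ) :
    HasWirt (fun z ↦ F z ^ k) (fun z ↦ k * F z ^ (k - 1) * a z)
      (fun z ↦ k * F z ^ (k - 1) * b z) := by
  induction k with
  | zero => simpa using hasWirt_const 1
  | succ k ih =>
    simp only [pow_succ]
    refine (ih.mul h).congr_deriv (fun z ↦ ?_) (fun z ↦ ?_) <;>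
    · rcases k with _ | k
      · simp
      · simp only [Nat.add_sub_cancel, pow_succ]
        push_cast
        ring

lemma HasWirt.eq_of_zero {F a b : ℍ → ℂ} (h : HasWirt F a b) (ha : ∀ z, a z = 0)
    (hb : ∀ z, b z = 0) (z w : ℍ) : F z = F w := by
  have hd : ∀ z : ℍ, HasFDerivAt (F ∘ ofComplex) (0 : ℂ →L[ℝ] ℂ) (z : ℂ) := fun z ↦ by
    refine (h z).congr_fderiv ?_
    ext x
    simp [ha, hb]
  have := isOpen_im_pos.is_const_of_fderiv_eq_zero (𝕜 := ℝ) (f := F ∘ ofComplex)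
    isPreconnected_im_pos
    (fun z hz ↦ (hd ⟨z, hz⟩).differentiableAt.differentiableWithinAt)
    (fun z hz ↦ (hd ⟨z, hz⟩).fderiv) z.im_pos w.im_pos
  simpa using this

lemma hasWirt_coe : HasWirt (fun z ↦ (z : ℂ)) (fun _ ↦ 1) (fun _ ↦ 0) := hasDerivH_coe.hasWirt

lemma coe_sub_conj_ne_zero (z : ℍ) : (z : ℂ) - conj (z : ℂ) ≠ 0 := fun h ↦ by
  have := congrArg Complex.im h
  simp at this
  have := z.im_ne_zero
  simp_all

lemma pi_I_mul_coe_sub_conj (z : ℍ) :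
    (Real.pi * Complex.I : ℂ) * ((z : ℂ) - conj (z : ℂ)) = logNome z := by
  rw [Complex.sub_conj, logNome]
  push_cast
  simp only [coe_im]
  linear_combination (2 * Real.pi * z.im : ℂ) * Complex.I_sq

lemma logNome_ne_zero (z : ℍ) : logNome z ≠ 0 := by
  rw [← pi_I_mul_coe_sub_conj]
  exact mul_ne_zero (by simp [Real.pi_ne_zero]) (coe_sub_conj_ne_zero z)

/-! ### The generating polynomial of a family -/

/-- `∑ K_r (x - z y) ^ r (x - z̄ y) ^ (n - r)`. -/
def genPoly (n : ℕ) (K : ℕ → ℍ → ℂ) (x y : ℂ) (z : ℍ) : ℂ :=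
  ∑ r ∈ Finset.range (n + 1), K r z * ((x - z * y) ^ r * (x - conj (z : ℂ) * y) ^ (n - r))

/-- With u = x - z y and v = x - z̄ y one has -(z - z̄) y = u - v, so (z - z̄) ∂(u^r)/∂z = r u^r - r
u^(r-1) v. The derivatives are thus again combinations of u^r v^(n-r), with the operators `del` and
`delBar` in the coefficients. -/
lemma hasWirt_genPoly {n : ℕ} {K p q : ℕ → ℍ → ℂ} (hK : ∀ r ≤ n, HasWirt (K r) (p r) (q r))
    (x y : ℂ) : HasWirt (genPoly n K x y)
      (fun z ↦ ((z : ℂ) - conj (z : ℂ))⁻¹ *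
        (∑ r ∈ Finset.range (n + 1), (((z : ℂ) - conj (z : ℂ)) * p r z + r * K r z) *
          ((x - z * y) ^ r * (x - conj (z : ℂ) * y) ^ (n - r)) -
        ∑ r ∈ Finset.range n, ((r : ℂ) + 1) * K (r + 1) z *
          ((x - z * y) ^ r * (x - conj (z : ℂ) * y) ^ (n - r))))
      (fun z ↦ (conj (z : ℂ) - (z : ℂ))⁻¹ *
        (∑ r ∈ Finset.range (n + 1), ((conj (z : ℂ) - (z : ℂ)) * q r z + (n - r : ℕ) * K r z) *
          ((x - z * y) ^ r * (x - conj (z : ℂ) * y) ^ (n - r)) -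
        ∑ r ∈ Finset.range n, ((n - r : ℕ) : ℂ) * K r z *
          ((x - z * y) ^ (r + 1) * (x - conj (z : ℂ) * y) ^ (n - (r + 1))))) := by
  have hu : HasWirt (fun z ↦ x - z * y) (fun _ ↦ -y) (fun _ ↦ 0) :=
    ((hasWirt_const x).sub (hasWirt_coe.mul (hasWirt_const y))).congr_deriv
      (fun z ↦ by ring) (fun z ↦ by ring)
  have hv : HasWirt (fun z ↦ x - conj (z : ℂ) * y) (fun _ ↦ 0) (fun _ ↦ -y) :=
    ((hasWirt_const x).sub (hasWirt_coe.conj.mul (hasWirt_const y))).congr_deriv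
      (fun z ↦ by simp) (fun z ↦ by simp)
  refine (HasWirt.sum (Finset.range (n + 1)) fun r hr ↦ (hK r (by
    have := Finset.mem_range.1 hr
    omega)).mul ((hu.pow r).mul (hv.pow (n - r)))).congr_deriv (fun z ↦ ?_) (fun z ↦ ?_)
  · rw [eq_inv_mul_iff_mul_eq₀ (coe_sub_conj_ne_zero z), Finset.mul_sum, eq_sub_iff_add_eq,
      ← sub_eq_zero, Finset.sum_range_succ', Finset.sum_range_succ' _ n]
    have : ∀ a b c d e : ℂ, (a - d) + c + (b - e) = 0 → a + b + c - (d + e) = 0 := fun a b c d e h ↦ by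
      linear_combination h
    apply this
    rw [← Finset.sum_sub_distrib, ← Finset.sum_add_distrib, Finset.sum_eq_zero]
    · simp
      ring
    · intro r hr
      have hr' : n - r = (n - (r + 1)) + 1 := by
        have := Finset.mem_range.1 hr
        omega
      rw [hr']
      simp only [Nat.add_sub_cancel, pow_succ]
      push_cast
      ring
  · rw [eq_inv_mul_iff_mul_eq₀ (by rw [← neg_sub]; exact neg_ne_zero.2 (coe_sub_conj_ne_zero z)),
      Finset.mul_sum, eq_sub_iff_add_eq,
      ← sub_eq_zero, Finset.sum_range_succ, Finset.sum_range_succ _ n]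
    have : ∀ a b c d e : ℂ, (a - d) + c + (b - e) = 0 → a + b + c - (d + e) = 0 := fun a b c d e h ↦ by
      linear_combination h
    apply this
    rw [← Finset.sum_sub_distrib, ← Finset.sum_add_distrib, Finset.sum_eq_zero]
    · simp
      ring
    · intro r hr
      have hr' : n - r = (n - (r + 1)) + 1 := by
        have := Finset.mem_range.1 hr
        omega
      rw [hr']
      simp only [Nat.add_sub_cancel, pow_succ]
      push_cast
      ring

lemma eq_zero_of_sum_pow {n : ℕ} {c : ℕ → ℂ} (z : ℍ)
    (h : ∀ x y : ℂ, ∑ r ∈ Finset.range (n + 1),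
      c r * ((x - z * y) ^ r * (x - conj (z : ℂ) * y) ^ (n - r)) = 0) {r : ℕ} (hr : r ≤ n) :
    c r = 0 := by
  have hw := coe_sub_conj_ne_zero z
  let P : Polynomial ℂ := ∑ r ∈ Finset.range (n + 1), Polynomial.monomial r (c r)
  have hP : P = 0 := Polynomial.funext fun t ↦ by
    -- This point solves x - z y = t and x - z̄ y = 1, turning the sum into a polynomial in t with
    -- coefficients c r.
    have := h (t + z * ((1 - t) / (z - conj (z : ℂ)))) ((1 - t) / (z - conj (z : ℂ)))
    have e1 : t + z * ((1 - t) / (z - conj (z : ℂ))) - z * ((1 - t) / (z - conj (z : ℂ))) = t := by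
      ring
    have e2 : t + z * ((1 - t) / (z - conj (z : ℂ))) -
        conj (z : ℂ) * ((1 - t) / (z - conj (z : ℂ))) = 1 := by
      field_simp
      ring
    simp only [e1, e2, one_pow, mul_one] at this
    simpa [P, Polynomial.eval_finsetSum] using this
  have := congrArg (fun Q ↦ Polynomial.coeff Q r) hP
  simpa [P, Polynomial.finsetSum_coeff, Polynomial.coeff_monomial, Nat.lt_succ_iff.2 hr] using this

/-! ### Logarithmic expansions and real analyticity -/

/-- `f` has an expansion `∑_{|k| ≤ M} 𝕃 ^ k ∑_{m, n ≥ -N} a^{(k)}_{m,n} q ^ m q̄ ^ n`. -/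
def HasLogExpansion (M N : ℕ) (f : ℍ → ℂ) : Prop :=
  ∃ (a : ℤ → ℤ → ℤ → ℂ) (F : ℤ → ℍ → ℂ),
    (∀ k m n : ℤ, m < -(N : ℤ) ∨ n < -(N : ℤ) → a k m n = 0) ∧
    (∀ k z, HasSum (fun p : ℤ × ℤ => a k p.1 p.2 * nome z ^ p.1 * conj (nome z) ^ p.2) (F k z)) ∧
    ∀ z, f z = ∑ k ∈ Finset.Icc (-(M : ℤ)) M, logNome z ^ k * F k z

lemma HasLogExpansion.add {M N : ℕ} {f g : ℍ → ℂ} (hf : HasLogExpansion M N f)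
    (hg : HasLogExpansion M N g) : HasLogExpansion M N (fun z ↦ f z + g z) := by
  obtain ⟨a, F, ha, hF, hf⟩ := hf
  obtain ⟨b, G, hb, hG, hg⟩ := hg
  refine ⟨fun k m n ↦ a k m n + b k m n, fun k z ↦ F k z + G k z, fun k m n h ↦ ?_, fun k z ↦ ?_,
    fun z ↦ ?_⟩
  · beta_reduce
    rw [ha _ _ _ h, hb _ _ _ h, add_zero]
  · refine (hasSum_congr_fun fun p ↦ ?_).mp ((hF k z).add (hG k z))
    ring
  · beta_reduce
    rw [hf, hg, ← Finset.sum_add_distrib]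
    simp only [mul_add]

lemma HasLogExpansion.const_mul {M N : ℕ} {f : ℍ → ℂ} (c : ℂ) (hf : HasLogExpansion M N f) :
    HasLogExpansion M N (fun z ↦ c * f z) := by
  obtain ⟨a, F, ha, hF, hf⟩ := hf
  refine ⟨fun k m n ↦ c * a k m n, fun k z ↦ c * F k z, fun k m n h ↦ ?_, fun k z ↦ ?_,
    fun z ↦ ?_⟩
  · beta_reduce
    rw [ha _ _ _ h, mul_zero]
  · refine (hasSum_congr_fun fun p ↦ ?_).mp ((hF k z).mul_left c)
    ring
  · beta_reduce
    rw [hf, Finset.mul_sum]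
    exact Finset.sum_congr rfl fun k _ ↦ by ring

lemma hasLogExpansion_zero (M N : ℕ) : HasLogExpansion M N (fun _ ↦ 0) :=
  ⟨fun _ _ _ ↦ 0, fun _ _ ↦ 0, by simp, fun k z ↦ by simp, by simp⟩

lemma HasLogExpansion.sum {M N : ℕ} {ι : Type*} (s : Finset ι) {f : ι → ℍ → ℂ}
    (hf : ∀ i ∈ s, HasLogExpansion M N (f i)) : HasLogExpansion M N (fun z ↦ ∑ i ∈ s, f i z) := by
  classical
  induction s using Finset.induction_on with
  | empty => simpa using hasLogExpansion_zero M N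
  | insert i s hi ih =>
    simp only [Finset.sum_insert hi]
    exact (hf i (Finset.mem_insert_self _ _)).add
      (ih fun j hj ↦ hf j (Finset.mem_insert_of_mem hj))

lemma hasLogExpansion_of_hasSum {M N : ℕ} {k : ℤ} (hk : k ∈ Finset.Icc (-(M : ℤ)) M)
    {a : ℤ → ℤ → ℂ} (ha : ∀ m n : ℤ, m < -(N : ℤ) ∨ n < -(N : ℤ) → a m n = 0) {F : ℍ → ℂ}
    (hF : ∀ z, HasSum (fun p : ℤ × ℤ => a p.1 p.2 * nome z ^ p.1 * conj (nome z) ^ p.2) (F z)) :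
    HasLogExpansion M N (fun z ↦ logNome z ^ k * F z) := by
  refine ⟨fun j m n ↦ if j = k then a m n else 0, fun j z ↦ if j = k then F z else 0,
    fun j m n h ↦ ?_, fun j z ↦ ?_, fun z ↦ ?_⟩
  · beta_reduce
    rw [ha m n h, ite_self]
  · by_cases h : j = k
    · simpa [h] using hF z
    · simp [h]
  · rw [Finset.sum_eq_single_of_mem k hk]
    · simp
    · intro j _ hj
      simp [hj]

lemma hasLogExpansion_of_hasQExpansion {M N : ℕ} {k : ℤ} (hk : k ∈ Finset.Icc (-(M : ℤ)) M)
    {a : ℤ → ℂ} (ha : ∀ m : ℤ, m < -(N : ℤ) → a m = 0) {F : ℍ → ℂ} (hF : HasQExpansion F a) :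
    HasLogExpansion M N (fun z ↦ logNome z ^ k * F z) := by
  refine hasLogExpansion_of_hasSum hk (a := fun m n ↦ if n = 0 then a m else 0)
    (fun m n h ↦ ?_) fun z ↦ ?_
  · split_ifs with h0
    · exact ha m (by omega)
    · rfl
  · have hi : Function.Injective (fun m : ℤ ↦ ((m, 0) : ℤ × ℤ)) := fun _ _ h ↦ (Prod.ext_iff.1 h).1
    rw [← hi.hasSum_iff]
    · simpa [Function.comp_def] using hF z
    · rintro ⟨m, n⟩ h
      have : n ≠ 0 := fun h0 ↦ h ⟨m, by rw [h0]⟩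
      simp [this]

lemma hasLogExpansion_of_conj_hasQExpansion {M N : ℕ} {k : ℤ}
    (hk : k ∈ Finset.Icc (-(M : ℤ)) M) {a : ℤ → ℂ} (ha : ∀ m : ℤ, m < -(N : ℤ) → a m = 0)
    {F : ℍ → ℂ} (hF : HasQExpansion F a) :
    HasLogExpansion M N (fun z ↦ logNome z ^ k * conj (F z)) := by
  refine hasLogExpansion_of_hasSum hk (a := fun m n ↦ if m = 0 then conj (a n) else 0)
    (fun m n h ↦ ?_) fun z ↦ ?_
  · split_ifs with h0
    · rw [ha n (by omega), map_zero]
    · rfl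
  · have hi : Function.Injective (fun n : ℤ ↦ ((0, n) : ℤ × ℤ)) := fun _ _ h ↦ (Prod.ext_iff.1 h).2
    rw [← hi.hasSum_iff]
    · simpa [Function.comp_def] using (hF z).map (starRingEnd ℂ) Complex.continuous_conj
    · rintro ⟨m, n⟩ h
      have : m ≠ 0 := fun h0 ↦ h ⟨n, by rw [h0]⟩
      simp [this]

/-- Real analyticity on the upper half-plane. -/
def IsRealAnalytic (f : ℍ → ℂ) : Prop := AnalyticOnNhd ℝ (f ∘ ofComplex) {z : ℂ | 0 < z.im}

lemma isRealAnalyticModular_of {r s : ℤ} {f : ℍ → ℂ} {M N : ℕ} (h1 : IsRealAnalytic f)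
    (h2 : IsModularOfWeights r s f) (h3 : HasLogExpansion M N f) : IsRealAnalyticModular r s f := by
  obtain ⟨a, F, ha, hF, hf⟩ := h3
  exact ⟨h1, h2, M, N, a, ha, fun z ↦ ⟨fun k _ ↦ (hF k z).summable, by
    simp only [hf, (hF _ z).tsum_eq]⟩⟩

lemma IsRealAnalytic.hasWirt {f : ℍ → ℂ} (h : IsRealAnalytic f) :
    HasWirt f (wirtinger f) (wirtingerBar f) :=
  hasWirt_of_differentiableAt fun z ↦ (h z z.im_pos).differentiableAt

lemma isRealAnalytic_const (c : ℂ) : IsRealAnalytic (fun _ ↦ c) := analyticOnNhd_const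

lemma IsRealAnalytic.add {f g : ℍ → ℂ} (hf : IsRealAnalytic f) (hg : IsRealAnalytic g) :
    IsRealAnalytic (fun z ↦ f z + g z) := AnalyticOnNhd.add hf hg

lemma IsRealAnalytic.mul {f g : ℍ → ℂ} (hf : IsRealAnalytic f) (hg : IsRealAnalytic g) :
    IsRealAnalytic (fun z ↦ f z * g z) := AnalyticOnNhd.mul hf hg

lemma IsRealAnalytic.sum {ι : Type*} (s : Finset ι) {f : ι → ℍ → ℂ}
    (hf : ∀ i ∈ s, IsRealAnalytic (f i)) : IsRealAnalytic (fun z ↦ ∑ i ∈ s, f i z) := by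
  classical
  induction s using Finset.induction_on with
  | empty => simpa using isRealAnalytic_const 0
  | insert i s hi ih =>
    simp only [Finset.sum_insert hi]
    exact (hf i (Finset.mem_insert_self _ _)).add
      (ih fun j hj ↦ hf j (Finset.mem_insert_of_mem hj))

lemma HasDerivH.isRealAnalytic {f f' : ℍ → ℂ} (h : HasDerivH f f') : IsRealAnalytic f :=
  (h.differentiableOn.analyticOnNhd isOpen_im_pos).restrictScalars

lemma IsRealAnalytic.conj {f : ℍ → ℂ} (hf : IsRealAnalytic f) :
    IsRealAnalytic (fun z ↦ conj (f z)) :=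
  fun z hz ↦ ((Complex.conjCLE : ℂ →L[ℝ] ℂ).analyticAt _).comp (hf z hz)

lemma IsRealAnalytic.zpow {f : ℍ → ℂ} (hf : IsRealAnalytic f) (h0 : ∀ z, f z ≠ 0) (k : ℤ) :
    IsRealAnalytic (fun z ↦ f z ^ k) :=
  fun z hz ↦ (hf z hz).zpow (h0 _)

lemma isRealAnalytic_logNome : IsRealAnalytic logNome := by
  have := (isRealAnalytic_const (Real.pi * Complex.I)).mul
    (hasDerivH_coe.isRealAnalytic.add ((isRealAnalytic_const (-1)).mul
      hasDerivH_coe.isRealAnalytic.conj))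
  have e : logNome = fun z : ℍ ↦ (Real.pi * Complex.I) * ((z : ℂ) + -1 * conj (z : ℂ)) := by
    funext z
    rw [← pi_I_mul_coe_sub_conj]
    ring
  rwa [e]

/-! ### Coefficient equations -/

lemma coe_sub_mul_wirtinger_genPoly {n : ℕ} {K : ℕ → ℍ → ℂ} (hK : ∀ r ≤ n, IsRealAnalytic (K r))
    (x y : ℂ) (z : ℍ) : ((z : ℂ) - conj (z : ℂ)) * wirtinger (genPoly n K x y) z =
      ∑ r ∈ Finset.range (n + 1), (del r (K r) z - if r < n then ((r : ℂ) + 1) * K (r + 1) z else 0) *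
        ((x - z * y) ^ r * (x - conj (z : ℂ) * y) ^ (n - r)) := by
  rw [(hasWirt_genPoly (fun r hr ↦ (hK r hr).hasWirt) x y).wirtinger_eq,
    mul_inv_cancel_left₀ (coe_sub_conj_ne_zero z)]
  simp only [sub_mul _ (ite _ _ _), Finset.sum_sub_distrib]
  congr 1
  rw [Finset.sum_range_succ]
  simp only [lt_self_iff_false, if_false, zero_mul, add_zero]
  refine Finset.sum_congr rfl fun r hr ↦ ?_
  rw [if_pos (Finset.mem_range.1 hr)]

lemma coe_sub_mul_wirtingerBar_genPoly {n : ℕ} {K : ℕ → ℍ → ℂ}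
    (hK : ∀ r ≤ n, IsRealAnalytic (K r)) (x y : ℂ) (z : ℍ) :
    (conj (z : ℂ) - (z : ℂ)) * wirtingerBar (genPoly n K x y) z =
      ∑ r ∈ Finset.range (n + 1), (delBar (n - r : ℕ) (K r) z -
        if r = 0 then 0 else ((n - (r - 1) : ℕ) : ℂ) * K (r - 1) z) *
        ((x - z * y) ^ r * (x - conj (z : ℂ) * y) ^ (n - r)) := by
  rw [(hasWirt_genPoly (fun r hr ↦ (hK r hr).hasWirt) x y).wirtingerBar_eq,
    mul_inv_cancel_left₀ (by rw [← neg_sub]; exact neg_ne_zero.2 (coe_sub_conj_ne_zero z))]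
  simp only [sub_mul _ (ite _ _ _), Finset.sum_sub_distrib]
  congr 1
  rw [Finset.sum_range_succ' _ n]
  simp

/-- The system of differential equations for a sequence `K_r = H_{r, n - r}`. -/
structure SolvesSeq (n : ℕ) (f g : ℍ → ℂ) (K : ℕ → ℍ → ℂ) : Prop where
  mem : ∀ r ≤ n, IsRealAnalyticModular r (n - r : ℕ) (K r)
  del_eq : ∀ r < n, ∀ z, del r (K r) z = ((r : ℂ) + 1) * K (r + 1) z
  delBar_eq : ∀ r < n, ∀ z, delBar (n - (r + 1) : ℕ) (K (r + 1)) z = ((n - r : ℕ) : ℂ) * K r z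
  del_top : ∀ z, del n (K n) z = logNome z * f z
  delBar_top : ∀ z, delBar n (K 0) z = -(logNome z * conj (g z))

/-- The system is obtained by comparing coefficients in the basis u^r v^(n-r). The identity πi (z -
z̄) = 𝕃 produces the right-hand sides at the two ends, and the factor z̄ - z in the second operator
explains the minus sign. -/
lemma solvesSeq_of_wirt {n : ℕ} {f g : ℍ → ℂ} {K : ℕ → ℍ → ℂ}
    (hK : ∀ r ≤ n, IsRealAnalyticModular r (n - r : ℕ) (K r))
    (h : ∀ x y, HasWirt (genPoly n K x y) (fun z ↦ Real.pi * Complex.I * (f z * (x - z * y) ^ n))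
      (fun z ↦ Real.pi * Complex.I * (conj (g z) * (x - conj (z : ℂ) * y) ^ n))) :
    SolvesSeq n f g K := by
  have h1 : ∀ z, ∀ r ≤ n, (del r (K r) z - if r < n then ((r : ℂ) + 1) * K (r + 1) z else 0) -
      (if r = n then logNome z * f z else 0) = 0 := fun z r hr ↦ by
    refine eq_zero_of_sum_pow (c := fun r ↦ (del r (K r) z -
      if r < n then ((r : ℂ) + 1) * K (r + 1) z else 0) -
      (if r = n then logNome z * f z else 0)) z (fun x y ↦ ?_) hr
    rw [Finset.sum_congr rfl fun r _ ↦ sub_mul _ _ _, Finset.sum_sub_distrib,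
      ← coe_sub_mul_wirtinger_genPoly (fun r hr ↦ (hK r hr).1), (h x y).wirtinger_eq]
    simp only [ite_mul, zero_mul, Finset.sum_ite_eq', Finset.mem_range, n.lt_succ_self, if_true,
      Nat.sub_self, pow_zero, mul_one, ← pi_I_mul_coe_sub_conj]
    ring
  have h2 : ∀ z, ∀ r ≤ n, (delBar (n - r : ℕ) (K r) z -
      if r = 0 then 0 else ((n - (r - 1) : ℕ) : ℂ) * K (r - 1) z) -
      (if r = 0 then -(logNome z * conj (g z)) else 0) = 0 := fun z r hr ↦ by
    refine eq_zero_of_sum_pow (c := fun r ↦ (delBar (n - r : ℕ) (K r) z -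
      if r = 0 then 0 else ((n - (r - 1) : ℕ) : ℂ) * K (r - 1) z) -
      (if r = 0 then -(logNome z * conj (g z)) else 0)) z (fun x y ↦ ?_) hr
    rw [Finset.sum_congr rfl fun r _ ↦ sub_mul _ _ _, Finset.sum_sub_distrib,
      ← coe_sub_mul_wirtingerBar_genPoly (fun r hr ↦ (hK r hr).1), (h x y).wirtingerBar_eq]
    simp only [ite_mul, zero_mul, Finset.sum_ite_eq', Finset.mem_range, n.succ_pos, if_true,
      Nat.sub_zero, pow_zero, one_mul, ← pi_I_mul_coe_sub_conj]
    ring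
  refine ⟨hK, fun r hr z ↦ ?_, fun r hr z ↦ ?_, fun z ↦ ?_, fun z ↦ ?_⟩
  · have := h1 z r hr.le
    simpa [hr, hr.ne, sub_eq_zero] using this
  · have := h2 z (r + 1) hr
    simpa [sub_eq_zero] using this
  · have := h1 z n le_rfl
    simpa [sub_eq_zero] using this
  · have := h2 z 0 (Nat.zero_le _)
    simpa [sub_eq_zero, add_eq_zero_iff_eq_neg] using this

/-! ### The explicit solution -/

/-- Applied with w = 1 / (z - z̄) = πi / 𝕃, it expresses powers of Y through X - zY and X - z̄Y.
This is where the negative powers of 𝕃 arise. -/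
lemma pow_mul_pow_eq_sum {n k : ℕ} (hk : k ≤ n) {u v w y : ℂ} (hy : y = w * (v - u)) :
    v ^ (n - k) * y ^ k = ∑ r ∈ Finset.range (n + 1),
      w ^ k * ((k.choose r : ℂ) * (-1) ^ r) * (u ^ r * v ^ (n - r)) := by
  have h1 : ∑ r ∈ Finset.range (n + 1), w ^ k * ((k.choose r : ℂ) * (-1) ^ r) * (u ^ r * v ^ (n - r)) =
      ∑ r ∈ Finset.range (k + 1),
        w ^ k * ((k.choose r : ℂ) * (-1) ^ r) * (u ^ r * v ^ (n - r)) := by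
    symm
    refine Finset.sum_subset (Finset.range_mono (by omega)) fun r _ hr ↦ ?_
    rw [Nat.choose_eq_zero_of_lt (by simpa using hr)]
    simp
  rw [h1, hy, mul_pow, sub_eq_neg_add, add_pow, Finset.mul_sum, Finset.mul_sum]
  refine Finset.sum_congr rfl fun r hr ↦ ?_
  have : n - r = (n - k) + (k - r) := by
    have := Finset.mem_range.1 hr
    omega
  rw [this, pow_add, neg_pow u]
  ring

lemma pow_mul_pow_eq_sum' {n k : ℕ} (hk : k ≤ n) {u v w y : ℂ} (hy : y = w * (v - u)) :
    u ^ (n - k) * y ^ k = ∑ r ∈ Finset.range (n + 1),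
      w ^ k * ((k.choose (n - r) : ℂ) * (-1) ^ (k + (n - r))) * (u ^ r * v ^ (n - r)) := by
  -- The relation is symmetric under exchanging u and v and negating w; reversing the summation
  -- index restores the order.
  rw [pow_mul_pow_eq_sum hk (u := v) (v := u) (w := -w) (y := y) (by rw [hy]; ring),
    ← Finset.sum_range_reflect]
  refine Finset.sum_congr rfl fun r hr ↦ ?_
  have h1 : n + 1 - 1 - r = n - r := by omega
  have h2 : n - (n - r) = r := by
    have := Finset.mem_range.1 hr
    omega
  rw [h1, h2, neg_pow w, pow_add]
  ring

/-- The coefficients of `π i (A + conj B + κ Y ^ n)` in the basis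
`(X - z Y) ^ r (X - z̄ Y) ^ (n - r)`, where `A` and `B` are the primitives attached to `φ`, `ψ`. -/
def solSeq (n : ℕ) (φ ψ : ℕ → ℍ → ℂ) (κ : ℂ) (r : ℕ) (z : ℍ) : ℂ :=
  ∑ k ∈ Finset.range (n + 1),
      ((Real.pi * Complex.I) ^ (k + 1) * n.descFactorial k *
          ((k.choose (n - r) : ℂ) * (-1) ^ (k + (n - r))) * (logNome z ^ (-k : ℤ) * φ (k + 1) z) +
        (Real.pi * Complex.I) ^ (k + 1) * n.descFactorial k *
          ((k.choose r : ℂ) * (-1) ^ r) * (logNome z ^ (-k : ℤ) * conj (ψ (k + 1) z))) +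
    (Real.pi * Complex.I) ^ (n + 1) * κ * ((n.choose r : ℂ) * (-1) ^ r) *
      (logNome z ^ (-n : ℤ) * 1)

lemma genPoly_solSeq (n : ℕ) (φ ψ : ℕ → ℍ → ℂ) (κ x y : ℂ) (z : ℍ) :
    genPoly n (solSeq n φ ψ κ) x y z = Real.pi * Complex.I * (ev x y (primPoly n φ z) +
      conj (ev (conj x) (conj y) (primPoly n ψ z)) + κ * y ^ n) := by
  set u := x - z * y with hu
  set v := x - conj (z : ℂ) * y with hv
  set w : ℂ := Real.pi * Complex.I * (logNome z)⁻¹ with hw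
  have hy : y = w * (v - u) := by
    have h1 := pi_I_mul_coe_sub_conj z
    have h2 := logNome_ne_zero z
    rw [hw, hu, hv]
    field_simp
    rw [← h1]
    ring
  have e1 : ev x y (primPoly n φ z) = ∑ k ∈ Finset.range (n + 1), ∑ r ∈ Finset.range (n + 1),
      (n.descFactorial k : ℂ) * φ (k + 1) z *
        (w ^ k * ((k.choose (n - r) : ℂ) * (-1) ^ (k + (n - r))) * (u ^ r * v ^ (n - r))) := by
    rw [ev_primPoly]
    refine Finset.sum_congr rfl fun k hk ↦ ?_
    rw [← Finset.mul_sum, ← pow_mul_pow_eq_sum' (Nat.lt_succ_iff.1 (Finset.mem_range.1 hk)) hy]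
  have e2 : conj (ev (conj x) (conj y) (primPoly n ψ z)) =
      ∑ k ∈ Finset.range (n + 1), ∑ r ∈ Finset.range (n + 1),
      (n.descFactorial k : ℂ) * conj (ψ (k + 1) z) *
        (w ^ k * ((k.choose r : ℂ) * (-1) ^ r) * (u ^ r * v ^ (n - r))) := by
    rw [ev_primPoly, map_sum]
    refine Finset.sum_congr rfl fun k hk ↦ ?_
    rw [← Finset.mul_sum, ← pow_mul_pow_eq_sum (Nat.lt_succ_iff.1 (Finset.mem_range.1 hk)) hy]
    simp [hv]
  have e3 := pow_mul_pow_eq_sum le_rfl (n := n) hy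
  rw [Nat.sub_self, pow_zero, one_mul] at e3
  rw [e1, e2, e3, Finset.sum_comm, Finset.sum_comm (s := Finset.range (n + 1)) (t := Finset.range (n + 1))
    (f := fun k r ↦ (n.descFactorial k : ℂ) * conj (ψ (k + 1) z) *
        (w ^ k * ((k.choose r : ℂ) * (-1) ^ r) * (u ^ r * v ^ (n - r)))), Finset.mul_sum,
    ← Finset.sum_add_distrib, ← Finset.sum_add_distrib, Finset.mul_sum]
  refine Finset.sum_congr rfl fun r _ ↦ ?_
  rw [← Finset.sum_add_distrib, solSeq, add_mul, mul_add, Finset.sum_mul, Finset.mul_sum]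
  congr 1
  · refine Finset.sum_congr rfl fun k _ ↦ ?_
    rw [hw, mul_pow _ (logNome z)⁻¹, zpow_neg, zpow_natCast, inv_pow]
    ring
  · rw [hw, mul_pow _ (logNome z)⁻¹, zpow_neg, zpow_natCast, inv_pow]
    ring

/-- The generating polynomial is holomorphic plus antiholomorphic plus constant in z, so each
Wirtinger derivative sees one primitive only. -/
lemma hasWirt_genPoly_solSeq {n : ℕ} {φ ψ : ℕ → ℍ → ℂ} {f g : ℍ → ℂ}
    (hA : IsPrimitive n f fun z x y ↦ ev x y (primPoly n φ z))
    (hB : IsPrimitive n g fun z x y ↦ ev x y (primPoly n ψ z)) (κ x y : ℂ) :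
    HasWirt (genPoly n (solSeq n φ ψ κ) x y)
      (fun z ↦ Real.pi * Complex.I * (f z * (x - z * y) ^ n))
      (fun z ↦ Real.pi * Complex.I * (conj (g z) * (x - conj (z : ℂ) * y) ^ n)) := by
  have e := funext fun z ↦ genPoly_solSeq n φ ψ κ x y z
  rw [show genPoly n (solSeq n φ ψ κ) x y = _ from e]
  refine ((((hA x y).hasWirt.add (hB (conj x) (conj y)).hasWirt.conj).add
    (hasWirt_const (κ * y ^ n))).const_mul (Real.pi * Complex.I)).congr_deriv
      (fun z ↦ ?_) (fun z ↦ ?_)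
  · simp
  · simp

lemma isRealAnalytic_solSeq {n : ℕ} {φ ψ : ℕ → ℍ → ℂ}
    (hφ : ∀ k, HasDerivH (φ (k + 1)) (φ k)) (hψ : ∀ k, HasDerivH (ψ (k + 1)) (ψ k)) (κ : ℂ)
    (r : ℕ) : IsRealAnalytic (solSeq n φ ψ κ r) := by
  have hl := fun k ↦ isRealAnalytic_logNome.zpow logNome_ne_zero k
  exact (IsRealAnalytic.sum _ fun k _ ↦
    ((isRealAnalytic_const _).mul ((hl _).mul (hφ k).isRealAnalytic)).add
      ((isRealAnalytic_const _).mul ((hl _).mul (hψ k).isRealAnalytic.conj))).add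
    ((isRealAnalytic_const _).mul ((hl _).mul (isRealAnalytic_const 1)))

lemma hasLogExpansion_solSeq {n N : ℕ} {φ ψ : ℕ → ℍ → ℂ} {a b : ℕ → ℤ → ℂ}
    (hφ : ∀ k, HasQExpansion (φ k) (a k)) (ha : ∀ k, ∀ m : ℤ, m < -(N : ℤ) → a k m = 0)
    (hψ : ∀ k, HasQExpansion (ψ k) (b k)) (hb : ∀ k, ∀ m : ℤ, m < -(N : ℤ) → b k m = 0) (κ : ℂ)
    (r : ℕ) : HasLogExpansion n N (solSeq n φ ψ κ r) := by
  have hk : ∀ k ∈ Finset.range (n + 1), (-k : ℤ) ∈ Finset.Icc (-(n : ℤ)) n := fun k hk ↦ by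
    have := Finset.mem_range.1 hk
    rw [Finset.mem_Icc]
    omega
  have hone : HasQExpansion (fun _ ↦ 1) (fun m ↦ if m = 0 then 1 else 0) := fun z ↦ by
    refine (hasSum_congr_fun fun m ↦ ?_).mp (hasSum_ite_eq (0 : ℤ) (1 : ℂ))
    split_ifs with h <;> simp [h]
  refine (HasLogExpansion.sum _ fun k hk' ↦ ?_).add ?_
  · exact ((hasLogExpansion_of_hasQExpansion (hk k hk') (ha _) (hφ _)).const_mul _).add
      ((hasLogExpansion_of_conj_hasQExpansion (hk k hk') (hb _) (hψ _)).const_mul _)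
  · refine (hasLogExpansion_of_hasQExpansion (hk n (by simp)) (fun m hm ↦ ?_) hone).const_mul _
    rw [if_neg (by omega)]

/-- X - zY and X - z̄Y have weights (-1, 0) and (0, -1), and the products of their powers are
linearly independent, so invariance of the sum fixes the weights of each coefficient. -/
lemma isModularOfWeights_of_genPoly {n : ℕ} {K : ℕ → ℍ → ℂ}
    (h : ∀ (γ : SL(2, ℤ)) (z : ℍ) (x y : ℂ), genPoly n K (γ 0 0 * x + γ 0 1 * y)
      (γ 1 0 * x + γ 1 1 * y) (γ • z) = genPoly n K x y z) {r : ℕ} (hr : r ≤ n) :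
    IsModularOfWeights r (n - r : ℕ) (K r) := by
  rw [isModularOfWeights_iff]
  intro γ z
  have hj := aut_ne_zero γ z
  have hj' : conj (aut γ z) ≠ 0 := by simpa using hj
  have := eq_zero_of_sum_pow (n := n) (c := fun r ↦
    K r (γ • z) / (aut γ z ^ r * conj (aut γ z) ^ (n - r)) - K r z) z (fun x y ↦ by
      have h1 := h γ z x y
      rw [← sub_eq_zero, genPoly, genPoly, ← Finset.sum_sub_distrib] at h1
      rw [← h1]
      refine Finset.sum_congr rfl fun r _ ↦ ?_
      have hc := congrArg (starRingEnd ℂ) (linear_smul γ z (conj x) (conj y))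
      simp only [map_sub, map_mul, map_add, map_div₀, Complex.conj_conj, map_intCast] at hc
      rw [linear_smul, hc, div_pow, div_pow]
      field_simp) hr
  rw [sub_eq_zero, div_eq_iff (mul_ne_zero (pow_ne_zero _ hj) (pow_ne_zero _ hj'))] at this
  rw [this, zpow_natCast, zpow_natCast]
  ring

/-! ### Existence of modular solutions -/

lemma ev_cocycle_T {n : ℕ} {f : ℍ → ℂ} (hf : IsWeaklyHolomorphic (n + 2) f)
    {a : ℤ → ℂ} (ha : HasQExpansion f a) :
    ev 1 0 (cocycle n f ModularGroup.T) = -(2 * Real.pi * Complex.I) ^ (n + 1) * a 0 := by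
  obtain ⟨B, hB, hB'⟩ := exists_isPrimitive ha n
  rw [ev_cocycle hf.continuous hB, modular_T_smul, ← hB' UpperHalfPlane.I]
  simp [ModularGroup.T]
  ring

/-- Put G = A + conj B. Conjugating the hypothesis gives conj C^g - C^f as a coboundary, and since p
= (2πi)^(n+1) is imaginary this says that the failure of G to be equivariant is Q|γ - Q for a
constant Q. Periodicity of G makes Q a multiple of Y^n, and G - Q is equivariant. -/
lemma exists_genPoly_equivariant {n : ℕ} (hn : Even n) {f g : ℍ → ℂ}
    (hf : IsWeaklyHolomorphic (n + 2) f) (hg : IsWeaklyHolomorphic (n + 2) g)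
    {P : MvPolynomial (Fin 2) ℂ} (hP : P ∈ homog n)
    (h : ∀ γ : SL(2, ℤ), cocycle n g γ - conjPoly (cocycle n f γ) =
      act P (γ : Matrix (Fin 2) (Fin 2) ℤ) - P) {φ ψ : ℕ → ℍ → ℂ} {a b : ℕ → ℤ → ℂ}
    (hφq : ∀ k, HasQExpansion (φ k) (a k)) (hψq : ∀ k, HasQExpansion (ψ k) (b k))
    (hA : IsPrimitive n f fun z x y ↦ ev x y (primPoly n φ z))
    (hB : IsPrimitive n g fun z x y ↦ ev x y (primPoly n ψ z)) :
    ∃ κ, ∀ (γ : SL(2, ℤ)) (z : ℍ) (x y : ℂ), genPoly n (solSeq n φ ψ κ) (γ 0 0 * x + γ 0 1 * y)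
      (γ 1 0 * x + γ 1 1 * y) (γ • z) = genPoly n (solSeq n φ ψ κ) x y z := by
  obtain ⟨p, hp⟩ : ∃ p : ℂ, p = (2 * Real.pi * Complex.I) ^ (n + 1) := ⟨_, rfl⟩
  have hp0 : p ≠ 0 := hp ▸ pow_ne_zero _ (by simp [Real.pi_ne_zero])
  have hpc : conj p = -p := by
    rw [hp, map_pow, ← hn.add_one.neg_pow]
    simp [map_ofNat]
  obtain ⟨G, hGz⟩ : ∃ G : ℍ → MvPolynomial (Fin 2) ℂ,
      ∀ z, G z = primPoly n φ z + conjPoly (primPoly n ψ z) := ⟨_, fun _ ↦ rfl⟩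
  have hG : ∀ z, G z ∈ homog n := fun z ↦ hGz z ▸
    Submodule.add_mem _ (primPoly_mem_homog _ _ _) (conjPoly_mem_homog (primPoly_mem_homog _ _ _))
  -- The value G(i) accounts for the base point of the cocycles and the second term for the given
  -- coboundary.
  obtain ⟨Q, hQe⟩ : ∃ Q, Q = G UpperHalfPlane.I + p⁻¹ • conjPoly P := ⟨_, rfl⟩
  have hQ : Q ∈ homog n := hQe ▸ Submodule.add_mem _ (hG _) (Submodule.smul_mem _ _ (conjPoly_mem_homog hP))
  have heq : ∀ (γ : SL(2, ℤ)) (z : ℍ) (x y : ℂ),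
      ev (γ 0 0 * x + γ 0 1 * y) (γ 1 0 * x + γ 1 1 * y) (G (γ • z)) - ev x y (G z) =
      ev (γ 0 0 * x + γ 0 1 * y) (γ 1 0 * x + γ 1 1 * y) Q - ev x y Q := fun γ z x y ↦ by
    have h1 := hA.smul_sub_eq hf.2.1 γ x y z UpperHalfPlane.I
    have h2 := congrArg (starRingEnd ℂ)
      (hB.smul_sub_eq hg.2.1 γ (conj x) (conj y) z UpperHalfPlane.I)
    have h3 := congrArg (fun R ↦ conj (ev (conj x) (conj y) R)) (h γ)
    simp only [ev_sub, ev_conjPoly, ev_act, ev_cocycle hf.continuous hA,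
      ev_cocycle hg.continuous hB, map_sub, map_mul, Complex.conj_conj, ← hp, map_neg, hpc, neg_neg] at h2 h3
    simp only [hQe, hGz, ev_add, ev_smul, ev_conjPoly, map_add, map_mul, map_intCast]
    have h4 := congrArg (p⁻¹ * ·) h3
    simp only [mul_sub, ← mul_assoc, mul_neg, inv_mul_cancel₀ hp0] at h4
    linear_combination h1 + h2 + h4
  have hGT : ∀ (z : ℍ) (x y : ℂ), ev (x + y) y (G ((1 : ℝ) +ᵥ z)) = ev x y (G z) := fun z x y ↦ by
    have e1 : ∀ k (z : ℍ), φ k ((1 : ℝ) +ᵥ z) = φ k z := fun k z ↦ (hφq k).vadd_one z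
    have e2 : ∀ k (z : ℍ), ψ k ((1 : ℝ) +ᵥ z) = ψ k z := fun k z ↦ (hψq k).vadd_one z
    have e3 : ∀ x y : ℂ, x + y - ((1 : ℝ) +ᵥ z : ℍ) * y = x - z * y := fun x y ↦ by
      rw [coe_vadd]
      push_cast
      ring
    simp only [hGz, ev_add, ev_conjPoly, ev_primPoly, e1, e2, map_add, e3]
  obtain ⟨κ, hκ⟩ := exists_eq_const_of_T_invariant hQ (ext_ev fun x y ↦ by
    have h1 := heq ModularGroup.T UpperHalfPlane.I x y
    rw [modular_T_smul] at h1
    simp only [ModularGroup.T] at h1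
    simp [ModularGroup.T] at h1 ⊢
    rw [hGT] at h1
    linear_combination -h1)
  have hQy : ∀ x y, ev x y Q = κ * y ^ n := fun x y ↦ by
    have hR : MvPolynomial.C κ * MvPolynomial.X 1 ^ n ∈ homog n := by
      refine C_mul_mem_homog _ ?_
      simpa using (MvPolynomial.isHomogeneous_X ℂ (1 : Fin 2)).pow n
    rw [homog_ext hQ hR fun x ↦ by simp [hκ]]
    simp
  have hgen : ∀ x y z, genPoly n (solSeq n φ ψ (-κ)) x y z =
      Real.pi * Complex.I * (ev x y (G z) - ev x y Q) := fun x y z ↦ by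
    rw [genPoly_solSeq, hQy]
    simp only [hGz, ev_add, ev_conjPoly]
    ring
  refine ⟨-κ, fun γ z x y ↦ ?_⟩
  rw [hgen, hgen]
  congr 1
  linear_combination heq γ z x y

/-- Solvability of the system when the conjugate class of `f` is represented by `g`. -/
theorem exists_solvesSeq {n : ℕ} (hn : Even n) {f g : ℍ → ℂ} (hf : IsWeakCuspForm (n + 2) f)
    (hg : IsWeaklyHolomorphic (n + 2) g)
    (h : Cohomologous n (cocycle n g) (fun γ ↦ conjPoly (cocycle n f γ))) :
    ∃ K, SolvesSeq n f g K := by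
  obtain ⟨hf, a, ha, ha0⟩ := hf
  obtain ⟨P, hP, h⟩ := h
  obtain ⟨N₁, b, hbN, hb⟩ := hg.2.2
  obtain ⟨N₂, a', haN, ha'⟩ := hf.2.2
  rw [ha'.unique ha] at haN
  -- The X^n-coefficient of the cocycle at T is a multiple of the constant term, and a coboundary
  -- has none there; so g inherits cuspidality from f, as periodic primitives require.
  have hb0 : b 0 = 0 := by
    refine coeff_zero_of_coboundary hg hb ?_
    have h1 := congrArg (ev 1 0) (h ModularGroup.T)
    rw [ev_sub, ev_conjPoly, map_one, map_zero, ev_cocycle_T hf ha, ha0, mul_zero, map_zero,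
      sub_zero] at h1
    rw [h1]
    simp [ModularGroup.T]
  obtain ⟨φ, hφ⟩ : ∃ φ : ℕ → ℍ → ℂ, φ = fun k ↦ qSeries (primCoeff a k) := ⟨_, rfl⟩
  obtain ⟨ψ, hψ⟩ : ∃ ψ : ℕ → ℍ → ℂ, ψ = fun k ↦ qSeries (primCoeff b k) := ⟨_, rfl⟩
  have hφd : ∀ k, HasDerivH (φ (k + 1)) (φ k) := by
    rw [hφ]
    exact hasDerivH_qSeries_primCoeff ha ha0
  have hψd : ∀ k, HasDerivH (ψ (k + 1)) (ψ k) := by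
    rw [hψ]
    exact hasDerivH_qSeries_primCoeff hb hb0
  have hφq : ∀ k, HasQExpansion (φ k) (primCoeff a k) := by
    rw [hφ]
    exact hasQExpansion_primCoeff ha ha0
  have hψq : ∀ k, HasQExpansion (ψ k) (primCoeff b k) := by
    rw [hψ]
    exact hasQExpansion_primCoeff hb hb0
  have hA := isPrimitive_primPoly (n := n) fun k _ ↦ hφd k
  have hB := isPrimitive_primPoly (n := n) fun k _ ↦ hψd k
  rw [show φ 0 = f from hφ ▸ qSeries_primCoeff_zero ha] at hA
  rw [show ψ 0 = g from hψ ▸ qSeries_primCoeff_zero hb] at hB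
  clear hφ hψ
  obtain ⟨κ, hκ⟩ := exists_genPoly_equivariant hn hf hg hP h hφq hψq hA hB
  refine ⟨solSeq n φ ψ κ, solvesSeq_of_wirt (fun r hr ↦ ?_) fun x y ↦
    hasWirt_genPoly_solSeq hA hB _ x y⟩
  refine isRealAnalyticModular_of (isRealAnalytic_solSeq hφd hψd _ r)
    (isModularOfWeights_of_genPoly hκ hr)
    (hasLogExpansion_solSeq (N := (max N₁ N₂).toNat) hφq
      (fun k m hm ↦ ?_) hψq (fun k m hm ↦ ?_) _ r)
  · rw [primCoeff, haN m (by omega), zero_div]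
  · rw [primCoeff, hbN m (by omega), zero_div]

/-! ### Uniqueness of solutions -/

lemma genPoly_smul {n : ℕ} {K : ℕ → ℍ → ℂ}
    (hK : ∀ r ≤ n, IsModularOfWeights r (n - r : ℕ) (K r)) (γ : SL(2, ℤ)) (z : ℍ) (x y : ℂ) :
    genPoly n K (γ 0 0 * x + γ 0 1 * y) (γ 1 0 * x + γ 1 1 * y) (γ • z) = genPoly n K x y z := by
  have hj := aut_ne_zero γ z
  have hj' : conj (aut γ z) ≠ 0 := by simpa using hj
  refine Finset.sum_congr rfl fun r hr ↦ ?_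
  have hc := congrArg (starRingEnd ℂ) (linear_smul γ z (conj x) (conj y))
  simp only [map_sub, map_mul, map_add, map_div₀, Complex.conj_conj, map_intCast] at hc
  rw [linear_smul, hc, div_pow, div_pow,
    isModularOfWeights_iff.1 (hK r (Nat.lt_succ_iff.1 (Finset.mem_range.1 hr))), zpow_natCast,
    zpow_natCast]
  field_simp

/-- Both Wirtinger derivatives of the generating polynomial vanish, so it is constant in z.
Modularity of the coefficients then makes it an invariant of V_n, which is zero for n ≥ 1; in degree
0 constants would survive. -/
lemma eq_zero_of_solvesSeq_zero {n : ℕ} (hn : 1 ≤ n) {K : ℕ → ℍ → ℂ}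
    (hK : ∀ r ≤ n, IsRealAnalytic (K r)) (hm : ∀ r ≤ n, IsModularOfWeights r (n - r : ℕ) (K r))
    (h1 : ∀ r < n, ∀ z, del r (K r) z = ((r : ℂ) + 1) * K (r + 1) z)
    (h2 : ∀ r < n, ∀ z, delBar (n - (r + 1) : ℕ) (K (r + 1)) z = ((n - r : ℕ) : ℂ) * K r z)
    (h3 : ∀ z, del n (K n) z = 0) (h4 : ∀ z, delBar n (K 0) z = 0) {r : ℕ} (hr : r ≤ n) (z : ℍ) :
    K r z = 0 := by
  have hw : ∀ x y z w, genPoly n K x y z = genPoly n K x y w := fun x y z w ↦ by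
    refine (hasWirt_genPoly (fun r hr ↦ (hK r hr).hasWirt) x y).eq_of_zero (fun z ↦ ?_)
      (fun z ↦ ?_) z w
    · rw [← (hasWirt_genPoly (fun r hr ↦ (hK r hr).hasWirt) x y).wirtinger_eq]
      refine (mul_eq_zero.1 ((coe_sub_mul_wirtinger_genPoly hK x y z).trans
        (Finset.sum_eq_zero fun r hr ↦ ?_))).resolve_left (coe_sub_conj_ne_zero z)
      rcases (Nat.lt_succ_iff.1 (Finset.mem_range.1 hr)).lt_or_eq with h | rfl
      · rw [h1 r h, if_pos h, sub_self, zero_mul]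
      · rw [h3, if_neg (lt_irrefl _), sub_self, zero_mul]
    · rw [← (hasWirt_genPoly (fun r hr ↦ (hK r hr).hasWirt) x y).wirtingerBar_eq]
      refine (mul_eq_zero.1 ((coe_sub_mul_wirtingerBar_genPoly hK x y z).trans
        (Finset.sum_eq_zero fun r hr ↦ ?_))).resolve_left
          (by rw [← neg_sub]; exact neg_ne_zero.2 (coe_sub_conj_ne_zero z))
      rcases r with _ | r
      · rw [Nat.sub_zero, h4, if_pos rfl, sub_self, zero_mul]
      · have hr' : r < n := by
          have := Finset.mem_range.1 hr
          omega
        rw [h2 r hr', if_neg r.succ_ne_zero, Nat.add_sub_cancel, sub_self, zero_mul]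
  let P : MvPolynomial (Fin 2) ℂ := ∑ r ∈ Finset.range (n + 1),
    MvPolynomial.C (K r UpperHalfPlane.I) *
    ((MvPolynomial.C 1 * MvPolynomial.X 0 +
        MvPolynomial.C (-conj (UpperHalfPlane.I : ℂ)) * MvPolynomial.X 1) ^ (n - r) *
      (MvPolynomial.C 1 * MvPolynomial.X 0 +
        MvPolynomial.C (-(UpperHalfPlane.I : ℂ)) * MvPolynomial.X 1) ^ r)
  have hPe : ∀ x y, ev x y P = genPoly n K x y UpperHalfPlane.I := fun x y ↦ by
    simp only [P, ev_sum, ev_mul, ev_C, ev_pow, ev_add, ev_X_zero, ev_X_one, genPoly, one_mul]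
    refine Finset.sum_congr rfl fun r _ ↦ ?_
    ring
  have hP : P ∈ homog n := Submodule.sum_mem _ fun j hj ↦ C_mul_mem_homog _
    (monomial_mul_mem_homog (by simpa [Nat.lt_succ_iff] using hj) (linear_mem_homog _ _)
      (linear_mem_homog _ _))
  have hP0 : P = 0 := homog_eq_zero_of_invariant hn hP fun γ ↦ ext_ev fun x y ↦ by
    rw [ev_act, hPe, hPe, hw _ _ UpperHalfPlane.I (γ • UpperHalfPlane.I), genPoly_smul hm]
  refine eq_zero_of_sum_pow (c := fun r ↦ K r z) z (fun x y ↦ ?_) hr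
  change genPoly n K x y z = 0
  rw [hw x y z UpperHalfPlane.I, ← hPe, hP0, ev_zero]

lemma del_sub {r : ℤ} {F G a b c d : ℍ → ℂ} (hF : HasWirt F a b) (hG : HasWirt G c d) (z : ℍ) :
    del r (fun z ↦ F z - G z) z = del r F z - del r G z := by
  rw [del, del, del, (hF.sub hG).wirtinger_eq, hF.wirtinger_eq, hG.wirtinger_eq]
  ring

lemma delBar_sub {r : ℤ} {F G a b c d : ℍ → ℂ} (hF : HasWirt F a b) (hG : HasWirt G c d) (z : ℍ) :
    delBar r (fun z ↦ F z - G z) z = delBar r F z - delBar r G z := by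
  rw [delBar, delBar, delBar, (hF.sub hG).wirtingerBar_eq, hF.wirtingerBar_eq, hG.wirtingerBar_eq]
  ring

/-- The sequence `K_r = H_{r, n - r}` of a family. -/
def Family.toSeq {n : ℕ} (H : Family n) (r : ℕ) : ℍ → ℂ :=
  if h : r ≤ n then H r (n - r) (by omega) else 0

lemma Family.toSeq_eq {n : ℕ} (H : Family n) {r s : ℕ} (h : r + s = n) : H.toSeq r = H r s h := by
  subst h
  rw [Family.toSeq, dif_pos (Nat.le_add_right r s)]
  congr 1
  omega

lemma SolvesSystem.toSeq {n : ℕ} {f g : ℍ → ℂ} {H : Family n} (h : SolvesSystem n f g H) :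
    SolvesSeq n f g H.toSeq where
  mem r hr := by
    rw [H.toSeq_eq (s := n - r) (by omega)]
    exact h.mem _ _ _
  del_eq r hr z := by
    rw [H.toSeq_eq (r := r) (s := n - (r + 1) + 1) (by omega),
      H.toSeq_eq (r := r + 1) (s := n - (r + 1)) (by omega)]
    exact h.del_eq _ _ _ z
  delBar_eq r hr z := by
    rw [H.toSeq_eq (r := r) (s := n - (r + 1) + 1) (by omega),
      H.toSeq_eq (r := r + 1) (s := n - (r + 1)) (by omega), h.delBar_eq]
    congr 1
    rw [show n - r = n - (r + 1) + 1 by omega]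
    push_cast
    rfl
  del_top z := by
    rw [H.toSeq_eq (r := n) (s := 0) (by omega)]
    exact h.del_top z
  delBar_top z := by
    rw [H.toSeq_eq (r := 0) (s := n) (by omega)]
    exact h.delBar_top z

lemma SolvesSeq.toFamily {n : ℕ} {f g : ℍ → ℂ} {K : ℕ → ℍ → ℂ} (h : SolvesSeq n f g K) :
    SolvesSystem n f g (fun r _ _ ↦ K r) where
  mem r s hrs := by
    have := h.mem r (by omega)
    rwa [show n - r = s by omega] at this
  del_eq r s hrs z := h.del_eq r (by omega) z
  delBar_eq r s hrs z := by
    have := h.delBar_eq r (by omega) z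
    rw [show n - (r + 1) = s by omega, show n - r = s + 1 by omega] at this
    rw [this]
    push_cast
    rfl
  del_top := h.del_top
  delBar_top := h.delBar_top

theorem SolvesSystem.unique {n : ℕ} (hn : 1 ≤ n) {f g : ℍ → ℂ} {H H' : Family n}
    (h : SolvesSystem n f g H) (h' : SolvesSystem n f g H') : H = H' := by
  have k := h.toSeq
  have k' := h'.toSeq
  have hK : ∀ r ≤ n, IsRealAnalytic (H.toSeq r) := fun r hr ↦ (k.mem r hr).1
  have hK' : ∀ r ≤ n, IsRealAnalytic (H'.toSeq r) := fun r hr ↦ (k'.mem r hr).1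
  have h0 : ∀ r ≤ n, ∀ z, H.toSeq r z - H'.toSeq r z = 0 := fun r hr z ↦ by
    refine eq_zero_of_solvesSeq_zero (K := fun r z ↦ H.toSeq r z - H'.toSeq r z) hn
      (fun r hr ↦ ?_) (fun r hr ↦ ?_) (fun r hr z ↦ ?_) (fun r hr z ↦ ?_) (fun z ↦ ?_)
      (fun z ↦ ?_) hr z
    · simpa [sub_eq_add_neg] using (hK r hr).add ((isRealAnalytic_const (-1)).mul (hK' r hr))
    · simpa [sub_eq_add_neg] using (k.mem r hr).2.1.add ((k'.mem r hr).2.1.const_mul (-1))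
    · rw [del_sub (hK r hr.le).hasWirt (hK' r hr.le).hasWirt, k.del_eq r hr, k'.del_eq r hr]
      ring
    · rw [delBar_sub (hK _ hr).hasWirt (hK' _ hr).hasWirt, k.delBar_eq r hr, k'.delBar_eq r hr]
      ring
    · rw [del_sub (hK _ le_rfl).hasWirt (hK' _ le_rfl).hasWirt, k.del_top, k'.del_top, sub_self]
    · rw [delBar_sub (hK _ n.zero_le).hasWirt (hK' _ n.zero_le).hasWirt, k.delBar_top,
        k'.delBar_top, sub_self]
  funext r s hrs z
  rw [← H.toSeq_eq hrs, ← H'.toSeq_eq hrs]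
  exact sub_eq_zero.1 (h0 r (by omega) z)

/-! ### Laplace equations -/

lemma hasWirt_logNome : HasWirt logNome (fun _ ↦ Real.pi * Complex.I)
    (fun _ ↦ -(Real.pi * Complex.I)) := by
  have e : logNome = fun z : ℍ ↦ (Real.pi * Complex.I) * ((z : ℂ) - conj (z : ℂ)) :=
    funext fun z ↦ (pi_I_mul_coe_sub_conj z).symm
  rw [e]
  exact ((hasWirt_coe.sub hasWirt_coe.conj).const_mul _).congr_deriv (fun z ↦ by simp)
    (fun z ↦ by simp)

lemma hasWirt_inv_logNome : HasWirt (fun z ↦ (logNome z)⁻¹)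
    (fun z ↦ -(Real.pi * Complex.I) / logNome z ^ 2)
    (fun z ↦ Real.pi * Complex.I / logNome z ^ 2) := fun z ↦ by
  have h1 := (hasDerivAt_inv (logNome_ne_zero z)).hasFDerivAt.restrictScalars ℝ
  have h2 : logNome z = (logNome ∘ ofComplex) (z : ℂ) := by simp
  rw [h2] at h1
  refine (h1.comp (z : ℂ) (hasWirt_logNome z)).congr_fderiv ?_
  ext x
  simp
  ring

/-- As (z - z̄) ∂𝕃/∂z = 𝕃, multiplication by 𝕃⁻¹ commutes with the operator once the weight is
raised by one. -/
lemma del_inv_logNome_mul {F a b : ℍ → ℂ} (hF : HasWirt F a b) (r : ℤ) (z : ℍ) :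
    del (r + 1) (fun w ↦ (logNome w)⁻¹ * F w) z = (logNome z)⁻¹ * del r F z := by
  have h := logNome_ne_zero z
  have h0 := coe_sub_conj_ne_zero z
  have hp := pi_I_mul_coe_sub_conj z
  rw [del, del, (hasWirt_inv_logNome.mul hF).wirtinger_eq, hF.wirtinger_eq]
  field_simp
  push_cast
  linear_combination (-F z) * hp

lemma delBar_inv_logNome_mul {F a b : ℍ → ℂ} (hF : HasWirt F a b) (s : ℤ) (z : ℍ) :
    delBar (s + 1) (fun w ↦ (logNome w)⁻¹ * F w) z = (logNome z)⁻¹ * delBar s F z := by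
  have h := logNome_ne_zero z
  have h0 := coe_sub_conj_ne_zero z
  have hp := pi_I_mul_coe_sub_conj z
  rw [delBar, delBar, (hasWirt_inv_logNome.mul hF).wirtingerBar_eq, hF.wirtingerBar_eq]
  field_simp
  push_cast
  linear_combination (-F z) * hp

lemma delBar_const_mul {F a b : ℍ → ℂ} (hF : HasWirt F a b) (c : ℂ) (s : ℤ) (z : ℍ) :
    delBar s (fun w ↦ c * F w) z = c * delBar s F z := by
  rw [delBar, delBar, (hF.const_mul c).wirtingerBar_eq, hF.wirtingerBar_eq]
  ring

/-- For s ≥ 1 going up and back down multiplies by (r + 1) s, and -(r + 1) s + r (s - 1) = -n. For s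
= 0 the operator `delBar` of weight -1 kills 𝕃 f because f is holomorphic. After division by 𝕃 the
same computation has constant term (r + 1) s, and the result is zero. -/
theorem SolvesSystem.isLaplaceEigenFamily {n : ℕ} {f f' g : ℍ → ℂ} (hf : HasDerivH f f')
    {H : Family n} (h : SolvesSystem n f g H) : IsLaplaceEigenFamily n H := by
  intro r s hrs z
  have hw : ∀ r s h', HasWirt (H r s h') (wirtinger (H r s h')) (wirtingerBar (H r s h')) :=
    fun r s h' ↦ IsRealAnalytic.hasWirt (h.mem r s h').1
  have hdel : del (r + 1 : ℤ) (fun w ↦ (logNome w)⁻¹ * H r s hrs w) =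
      fun z ↦ (logNome z)⁻¹ * del r (H r s hrs) z :=
    funext fun z ↦ del_inv_logNome_mul (hw r s hrs) r z
  rw [laplacian, laplacian, hdel]
  rcases s with _ | s
  · obtain rfl : r = n := by omega
    have h1 : del (r : ℤ) (H r 0 hrs) = fun z ↦ logNome z * f z := funext h.del_top
    have h2 : (fun z ↦ (logNome z)⁻¹ * (logNome z * f z)) = f :=
      funext fun z ↦ inv_mul_cancel_left₀ (logNome_ne_zero z) _
    rw [h1, h2]
    constructor
    · rw [delBar, (hasWirt_logNome.mul hf.hasWirt).wirtingerBar_eq, ← pi_I_mul_coe_sub_conj]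
      push_cast
      ring
    · rw [delBar, hf.hasWirt.wirtingerBar_eq]
      simp
  · have h1 : del (r : ℤ) (H r (s + 1) hrs) =
        fun z ↦ ((r : ℂ) + 1) * H (r + 1) s (by omega) z := funext (h.del_eq r s hrs)
    have h2 := h.delBar_eq r s (by omega) z
    have e : ((s + 1 : ℕ) : ℤ) - 1 = s := by push_cast; ring
    have e2 : ((s + 1 : ℕ) : ℤ) + 1 - 1 = s + 1 := by push_cast; ring
    rw [h1, e, e2, delBar_inv_logNome_mul ((hw _ _ _).const_mul _), delBar_const_mul (hw _ _ _), h2]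
    subst hrs
    constructor <;>
    · push_cast
      ring

/-! ### The class of the conjugate form -/

lemma existsUnique_reduced_bolCongruent {n : ℕ} (hn : Even n) {f : ℍ → ℂ}
    (hf : IsWeaklyHolomorphic (n + 2) f) : ∃! f₀, IsReduced n f₀ ∧ BolCongruent n f f₀ := by
  obtain ⟨g, ⟨hg, hgc⟩, huniq⟩ := existsUnique_reduced_cohomologous hn (isCocycle_cocycle hf)
    (cocycle_mem_homog n f)
  exact ⟨g, ⟨hg, (bolCongruent_iff hf hg.1).2 hgc⟩, fun g' ⟨hg', hc⟩ ↦
    huniq g' ⟨hg', (bolCongruent_iff hf hg'.1).1 hc⟩⟩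

lemma existsUnique_reduced_represents {n : ℕ} (hn : Even n) {f : ℍ → ℂ}
    (hf : IsWeaklyHolomorphic (n + 2) f) :
    ∃! g, IsReduced n g ∧ RepresentsSingleValued n (conjCoeff f) g := by
  obtain ⟨g, ⟨hg, hgc⟩, huniq⟩ := existsUnique_reduced_cohomologous hn (isCocycle_cocycle hf).conj
    (fun γ ↦ conjPoly_mem_homog (cocycle_mem_homog n f γ))
  exact ⟨g, ⟨hg, (representsSingleValued_conjCoeff_iff hn hf).2 ⟨hg.1, hgc⟩⟩, fun g' ⟨hg', hc⟩ ↦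
    huniq g' ⟨hg', ((representsSingleValued_conjCoeff_iff hn hf).1 hc).2⟩⟩

lemma represents_iff_bolCongruent {n : ℕ} (hn : Even n) {f f₁ g g₁ : ℍ → ℂ}
    (hf : IsWeaklyHolomorphic (n + 2) f) (hff : BolCongruent n f f₁)
    (hg : RepresentsSingleValued n (conjCoeff f) g) :
    RepresentsSingleValued n (conjCoeff f₁) g₁ ↔ BolCongruent n g g₁ := by
  have hf₁ := hff.isWeaklyHolomorphic hf
  have hc := (bolCongruent_iff hf hf₁).1 hff
  rw [representsSingleValued_conjCoeff_iff hn hf] at hg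
  rw [representsSingleValued_conjCoeff_iff hn hf₁]
  constructor
  · rintro ⟨h1, h2⟩
    exact (bolCongruent_iff hg.1 h1).2 ((h2.trans hc.conj).trans hg.2.symm)
  · intro h
    have h1 := h.isWeaklyHolomorphic hg.1
    exact ⟨h1, (((bolCongruent_iff hg.1 h1).1 h).trans hg.2).trans hc.conj.symm⟩

lemma BolCongruent.isWeakCuspForm {n : ℕ} {f f₁ : ℍ → ℂ} (hf : IsWeakCuspForm (n + 2) f)
    (h : BolCongruent n f f₁) : IsWeakCuspForm (n + 2) f₁ := by
  obtain ⟨hw, a, ha, ha0⟩ := hf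
  have h1 := h.isWeaklyHolomorphic hw
  obtain ⟨u, hu, hu'⟩ := h
  obtain ⟨_, b, -, hb⟩ := hu.2.2
  have := ha.add ((isWeaklyHolomorphic_of_isBolImage hu hu').2.1 b hb)
  simp only [add_sub_cancel] at this
  exact ⟨h1, _, this, by simp [ha0]⟩

lemma exists_solvesSystem {n : ℕ} (hn : Even n) {f f₁ g : ℍ → ℂ} (hf : IsWeakCuspForm (n + 2) f)
    (hff : BolCongruent n f f₁) (hg : RepresentsSingleValued n (conjCoeff f) g) :
    ∃ H : Family n, SolvesSystem n f₁ g H := by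
  have hg' := (representsSingleValued_conjCoeff_iff hn hf.1).1 hg
  have hc := (bolCongruent_iff hf.1 (hff.isWeaklyHolomorphic hf.1)).1 hff
  obtain ⟨K, hK⟩ := exists_solvesSeq hn (hff.isWeakCuspForm hf) hg'.1 (hg'.2.trans hc.conj.symm)
  exact ⟨_, hK.toFamily⟩

lemma bolCongruent_refl (n : ℕ) (f : ℍ → ℂ) : BolCongruent n f f :=
  ⟨0, isWeaklyHolomorphic_zero _, fun z ↦ by simp [Pi.zero_comp]⟩

/-! ### Odd weights -/

lemma odd_add_two {n : ℕ} (hn : Odd n) : Odd ((n : ℤ) + 2) := by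
  obtain ⟨m, rfl⟩ := hn
  exact ⟨m + 1, by push_cast; ring⟩

lemma isReduced_zero (n : ℕ) : IsReduced n 0 :=
  ⟨isWeaklyHolomorphic_zero _, 0, fun z ↦ by simp, by simp⟩

lemma conjCoeff_zero : conjCoeff 0 = 0 := funext fun z ↦ by simp [conjCoeff]

lemma representsSingleValued_zero (n : ℕ) : RepresentsSingleValued n 0 0 :=
  ⟨isWeaklyHolomorphic_zero _, 0, Submodule.zero_mem _, fun γ ↦ by
    simp [realFrobenius, cocycle_zero, act_zero]⟩

lemma solvesSystem_zero (n : ℕ) : SolvesSystem n 0 0 (fun _ _ _ _ ↦ 0) where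
  mem r s _ := isRealAnalyticModular_of (M := 0) (N := 0) (isRealAnalytic_const 0)
    (fun _ _ ↦ by simp) (hasLogExpansion_zero 0 0)
  del_eq r s _ z := by
    rw [del, (hasWirt_const 0).wirtinger_eq]
    simp
  delBar_eq r s _ z := by
    rw [delBar, (hasWirt_const 0).wirtingerBar_eq]
    simp
  del_top z := by
    rw [del, (hasWirt_const 0).wirtinger_eq]
    simp
  delBar_top z := by
    rw [delBar, (hasWirt_const 0).wirtingerBar_eq]
    simp

/-! ### The theorem for weakly holomorphic cusp forms, and the case of real coefficients -/

theorem singleValued_weakCuspForm {n : ℕ} {f : ℍ → ℂ} (hf : IsWeakCuspForm ((n : ℤ) + 2) f) :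
    (∃! f₀ : ℍ → ℂ, IsReduced n f₀ ∧ BolCongruent n f f₀) ∧
    (∃! g₀ : ℍ → ℂ, IsReduced n g₀ ∧ RepresentsSingleValued n (conjCoeff f) g₀) ∧
    (∀ f₁ g g₁ : ℍ → ℂ, BolCongruent n f f₁ → RepresentsSingleValued n (conjCoeff f) g →
      (RepresentsSingleValued n (conjCoeff f₁) g₁ ↔ BolCongruent n g g₁)) ∧
    ∀ f₁ g : ℍ → ℂ, BolCongruent n f f₁ → RepresentsSingleValued n (conjCoeff f) g →
      (∃ H : Family n, SolvesSystem n f₁ g H) ∧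
      (1 ≤ n → ∀ H H' : Family n, SolvesSystem n f₁ g H → SolvesSystem n f₁ g H' → H = H') ∧
      ∀ H : Family n, SolvesSystem n f₁ g H → IsLaplaceEigenFamily n H := by
  have last : ∀ f₁ g : ℍ → ℂ, BolCongruent n f f₁ →
      (1 ≤ n → ∀ H H' : Family n, SolvesSystem n f₁ g H → SolvesSystem n f₁ g H' → H = H') ∧
      ∀ H : Family n, SolvesSystem n f₁ g H → IsLaplaceEigenFamily n H := fun f₁ g h ↦
    ⟨fun h1 H H' hH hH' ↦ hH.unique h1 hH', fun H hH ↦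
      hH.isLaplaceEigenFamily (hasDerivH_of_differentiableOn (h.isWeaklyHolomorphic hf.1).1)⟩
  rcases n.even_or_odd with hn | hn
  · exact ⟨existsUnique_reduced_bolCongruent hn hf.1, existsUnique_reduced_represents hn hf.1,
      fun f₁ g g₁ h hg ↦ represents_iff_bolCongruent hn hf.1 h hg,
      fun f₁ g h hg ↦ ⟨exists_solvesSystem hn hf h hg, last f₁ g h⟩⟩
  · have h0 : ∀ u, IsWeaklyHolomorphic ((n : ℤ) + 2) u → u = 0 := fun u hu ↦
      hu.eq_zero_of_odd (odd_add_two hn)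
    obtain rfl := h0 f hf.1
    rw [conjCoeff_zero]
    refine ⟨⟨0, ⟨isReduced_zero n, bolCongruent_refl n 0⟩, fun u hu ↦ h0 u hu.1.1⟩,
      ⟨0, ⟨isReduced_zero n, representsSingleValued_zero n⟩, fun u hu ↦ h0 u hu.1.1⟩,
      fun f₁ g g₁ h hg ↦ ?_, fun f₁ g h hg ↦ ⟨?_, last f₁ g h⟩⟩
    · obtain rfl := h0 f₁ (h.isWeaklyHolomorphic hf.1)
      obtain rfl := h0 g hg.1
      rw [conjCoeff_zero]
      refine ⟨fun h ↦ ?_, fun h ↦ ?_⟩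
      · obtain rfl := h0 g₁ h.1
        exact bolCongruent_refl n 0
      · obtain rfl := h0 g₁ (h.isWeaklyHolomorphic hf.1)
        exact representsSingleValued_zero n
    · obtain rfl := h0 f₁ (h.isWeaklyHolomorphic hf.1)
      obtain rfl := h0 g hg.1
      exact ⟨_, solvesSystem_zero n⟩

theorem singleValued_of_conjCoeff_eq {n : ℕ} (hn : 1 ≤ n) {f : ℍ → ℂ}
    (hf : IsWeakCuspForm ((n : ℤ) + 2) f) (hc : conjCoeff f = f) :
    (∃! g : ℍ → ℂ, IsReduced n g ∧ RepresentsSingleValued n f g) ∧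
    ∀ g : ℍ → ℂ, RepresentsSingleValued n f g → (∃! H : Family n, SolvesSystem n f g H) ∧
      ∀ H : Family n, SolvesSystem n f g H → IsLaplaceEigenFamily n H := by
  have h := singleValued_weakCuspForm hf
  rw [hc] at h
  refine ⟨h.2.1, fun g hg ↦ ?_⟩
  obtain ⟨⟨H, hH⟩, hu, hL⟩ := h.2.2.2 f g (bolCongruent_refl n f) hg
  exact ⟨⟨H, hH, fun H' hH' ↦ hu hn H' H hH' hH⟩, hL⟩

/-! ### Fourier coefficients of Hecke operators -/

lemma sum_zpow_rootOfUnity {d : ℕ} (hd : d ≠ 0) (j : ℤ) :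
    ∑ b ∈ Finset.range d, (Complex.exp (2 * Real.pi * Complex.I / d) ^ b) ^ j =
      if (d : ℤ) ∣ j then (d : ℂ) else 0 := by
  have hζ := Complex.isPrimitiveRoot_exp d hd
  set ζ := Complex.exp (2 * Real.pi * Complex.I / d)
  have e : ∀ b : ℕ, (ζ ^ b) ^ j = (ζ ^ j) ^ b := fun b ↦ by
    rw [← zpow_natCast, ← zpow_natCast, ← zpow_mul, ← zpow_mul, mul_comm]
  simp only [e]
  split_ifs with h
  · rw [(hζ.zpow_eq_one_iff_dvd j).2 h]
    simp
  · have h1 : ζ ^ j - 1 ≠ 0 := fun h' ↦ h ((hζ.zpow_eq_one_iff_dvd j).1 (sub_eq_zero.1 h'))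
    have h2 : (ζ ^ j) ^ d = 1 := by rw [← e, hζ.pow_eq_one, one_zpow]
    have h3 := mul_geom_sum (ζ ^ j) d
    rw [h2, sub_self] at h3
    exact (mul_eq_zero.1 h3).resolve_left h1

/-- The sum over b is a sum over d-th roots of unity, which retains the indices j = l d; these
contribute to q^(α l). -/
lemma hasQExpansion_sum_translates {f : ℍ → ℂ} {a : ℤ → ℂ} (hf : HasQExpansion f a) {α d : ℕ}
    (hα : α ≠ 0) (hd : d ≠ 0) :
    HasQExpansion (fun z ↦ ∑ b ∈ Finset.range d,
      f (ofComplex (((α : ℂ) * (z : ℂ) + (b : ℂ)) / (d : ℂ))))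
      (fun e ↦ if (α : ℤ) ∣ e then d * a (e / α * d) else 0) := fun z ↦ by
  have hd' : (d : ℂ) ≠ 0 := by exact_mod_cast hd
  set r := Complex.exp (2 * Real.pi * Complex.I * (α * z / d)) with hr
  have hrd : ∀ l : ℤ, r ^ (l * d) = nome z ^ (α * l) := fun l ↦ by
    rw [hr, nome, ← Complex.exp_int_mul, ← Complex.exp_int_mul]
    congr 1
    push_cast
    field_simp
  have hcoe : ∀ b : ℕ, ((ofComplex (((α : ℂ) * (z : ℂ) + (b : ℂ)) / (d : ℂ)) : ℍ) : ℂ) =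
      ((α : ℂ) * (z : ℂ) + (b : ℂ)) / (d : ℂ) := fun b ↦ by
    refine coe_ofComplex ?_
    have h1 : (((α : ℂ) * (z : ℂ) + (b : ℂ)) / (d : ℂ)).im = α * z.im / d := by
      rw [← Complex.ofReal_natCast d, Complex.div_ofReal_im]
      simp
    rw [h1]
    have := z.im_pos
    positivity
  have hn : ∀ b : ℕ, nome (ofComplex (((α : ℂ) * (z : ℂ) + (b : ℂ)) / (d : ℂ))) =
      r * Complex.exp (2 * Real.pi * Complex.I / d) ^ b := fun b ↦ by
    rw [nome, hcoe, hr, ← Complex.exp_nat_mul, ← Complex.exp_add]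
    congr 1
    field_simp
  have h1 : HasSum (fun j : ℤ ↦ a j * r ^ j * if (d : ℤ) ∣ j then (d : ℂ) else 0)
      (∑ b ∈ Finset.range d, f (ofComplex (((α : ℂ) * (z : ℂ) + (b : ℂ)) / (d : ℂ)))) := by
    refine (hasSum_congr_fun fun j ↦ ?_).mp (hasSum_sum fun b _ ↦ hf (ofComplex
      (((α : ℂ) * (z : ℂ) + (b : ℂ)) / (d : ℂ))))
    rw [← sum_zpow_rootOfUnity hd, Finset.mul_sum]
    refine Finset.sum_congr rfl fun b _ ↦ ?_
    rw [hn, mul_zpow]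
    ring
  have hi : Function.Injective (fun l : ℤ ↦ l * d) :=
    mul_left_injective₀ (by exact_mod_cast hd)
  rw [← hi.hasSum_iff (fun j hj ↦ by
    rw [if_neg, mul_zero]
    rintro ⟨l, rfl⟩
    exact hj ⟨l, mul_comm _ _⟩)] at h1
  have hi' : Function.Injective (fun l : ℤ ↦ (α : ℤ) * l) :=
    mul_right_injective₀ (by exact_mod_cast hα)
  rw [← hi'.hasSum_iff (fun e he ↦ by
    beta_reduce
    rw [if_neg, zero_mul]
    rintro ⟨l, rfl⟩
    exact he ⟨l, rfl⟩)]
  refine (hasSum_congr_fun fun l ↦ ?_).mp h1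
  have hα' : (α : ℤ) ≠ 0 := by exact_mod_cast hα
  simp only [Function.comp_apply, dvd_mul_left, if_true, dvd_mul_right, hrd,
    Int.mul_ediv_cancel_left _ hα']
  ring

lemma HasQExpansion.sum {ι : Type*} (s : Finset ι) {f : ι → ℍ → ℂ} {a : ι → ℤ → ℂ}
    (h : ∀ i ∈ s, HasQExpansion (f i) (a i)) :
    HasQExpansion (fun z ↦ ∑ i ∈ s, f i z) (fun m ↦ ∑ i ∈ s, a i m) := fun z ↦ by
  refine (hasSum_congr_fun fun j ↦ ?_).mp (hasSum_sum fun i hi ↦ h i hi z)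
  rw [Finset.sum_mul]

/-- A Hecke eigenvalue is a Fourier coefficient. -/
lemma hecke_eigenvalue_mul {k : ℤ} {f : ℍ → ℂ} {a : ℤ → ℂ} (hf : HasQExpansion f a) {m : ℕ}
    (hm : 1 ≤ m) {c : ℂ} (h : ∀ z, hecke k m f z = c * f z) : c * a 1 = a m := by
  have hm0 : (m : ℂ) ≠ 0 := by exact_mod_cast (by omega : m ≠ 0)
  have h1 := (HasQExpansion.sum m.divisorsAntidiagonal fun p hp ↦
    (hasQExpansion_sum_translates hf (α := p.1) (d := p.2)
      (Nat.ne_zero_of_mem_divisorsAntidiagonal hp).1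
      (Nat.ne_zero_of_mem_divisorsAntidiagonal hp).2).const_mul ((p.2 : ℂ) ^ k)⁻¹).const_mul
    ((m : ℂ) ^ (k - 1))
  have h2 : (fun z ↦ c * f z) = fun z ↦ hecke k m f z := funext fun z ↦ (h z).symm
  have h3 := hf.const_mul c
  rw [h2] at h3
  have h4 := congrFun (h3.unique h1) 1
  -- Only α = 1 divides the index 1; that term is m^(k-1) · m^(-k) · m · a m = a m.
  rw [h4, Finset.sum_eq_single_of_mem (1, m) (by simp; omega)]
  · simp [zpow_sub₀ hm0]
    field_simp
  · rintro ⟨α, d⟩ hp hne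
    have hmul := (Nat.mem_divisorsAntidiagonal.1 hp).1
    simp only at hmul ⊢
    rw [if_neg, mul_zero]
    intro hdvd
    have : α = 1 := by
      have := Int.natCast_dvd_natCast.1 (by simpa using hdvd : (α : ℤ) ∣ ((1 : ℕ) : ℤ))
      exact Nat.dvd_one.1 this
    subst this
    exact hne (by rw [← hmul, one_mul])

open MeasureTheory
open scoped ENNReal

/-! ### A measurable weight adapted to the fundamental domain -/

/-- The fundamental domain is not compact, but an orbit has a point of maximal height, so only a
compact truncation matters and proper discontinuity applies. -/
lemma finite_setOf_smul_mem_fd (z : ℍ) : {γ : SL(2, ℤ) | γ • z ∈ ModularGroup.fd}.Finite := by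
  obtain ⟨g, hg⟩ := ModularGroup.exists_max_im z
  have h := ProperlyDiscontinuousSMul.finite_disjoint_inter_image (Γ := 𝒮ℒ) (T := ℍ)
    (K := {z}) (L := ModularGroup.truncatedFundamentalDomain (g • z).im) isCompact_singleton
    (ModularGroup.isCompact_truncatedFundamentalDomain _)
  have hinj : Function.Injective (fun γ : SL(2, ℤ) ↦
      (⟨Matrix.SpecialLinearGroup.mapGL ℝ γ, γ, rfl⟩ : 𝒮ℒ)) := fun γ γ' hγ ↦
    Matrix.SpecialLinearGroup.mapGL_injective (congrArg Subtype.val hγ)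
  refine (h.preimage hinj.injOn).subset fun γ hγ ↦ ?_
  have hmem : γ • z ∈ ModularGroup.truncatedFundamentalDomain (g • z).im := ⟨hγ, hg γ⟩
  exact ⟨γ • z, Set.mem_image_of_mem _ rfl, hmem⟩

/-- The number of translates of a point which lie in the standard fundamental domain. -/
def fdCount (z : ℍ) : ℝ≥0∞ := ∑' γ : SL(2, ℤ), ModularGroup.fd.indicator 1 (γ • z)

lemma fdCount_ne_top (z : ℍ) : fdCount z ≠ ∞ := by
  have hs : Function.support (fun γ : SL(2, ℤ) ↦
      (ModularGroup.fd.indicator 1 (γ • z) : ℝ≥0∞)) ⊆ (finite_setOf_smul_mem_fd z).toFinset :=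
    fun γ hγ ↦ by
      simp only [Set.Finite.coe_toFinset]
      by_contra h
      exact hγ (Set.indicator_of_notMem (by simpa using h) _)
  rw [fdCount, tsum_eq_sum' hs]
  refine ENNReal.sum_ne_top.2 fun γ _ ↦ ?_
  by_cases h : γ • z ∈ ModularGroup.fd
  · simp only [Set.indicator_of_mem h, Pi.one_apply, ne_eq, ENNReal.one_ne_top, not_false_eq_true]
  · simp only [Set.indicator_of_notMem h, ne_eq, ENNReal.zero_ne_top, not_false_eq_true]

lemma one_le_fdCount (z : ℍ) : 1 ≤ fdCount z := by
  obtain ⟨γ, hγ⟩ := ModularGroup.exists_smul_mem_fd z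
  refine le_trans ?_ (ENNReal.le_tsum γ)
  simp only [Set.indicator_of_mem hγ, Pi.one_apply, le_refl]

lemma fdCount_smul (γ : SL(2, ℤ)) (z : ℍ) : fdCount (γ • z) = fdCount z := by
  simp only [fdCount, ← mul_smul]
  exact (Equiv.mulRight γ).tsum_eq (fun g ↦ (ModularGroup.fd.indicator 1 (g • z) : ℝ≥0∞))

lemma measurable_fd_indicator : Measurable (ModularGroup.fd.indicator 1 : ℍ → ℝ≥0∞) :=
  measurable_one.indicator ModularGroup.isClosed_fd.measurableSet

lemma measurable_SL_smul (γ : SL(2, ℤ)) : Measurable (fun z : ℍ ↦ γ • z) :=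
  (continuous_const_smul (Matrix.SpecialLinearGroup.mapGL ℝ γ)).measurable

instance : Countable SL(2, ℤ) :=
  have : Countable (Matrix (Fin 2) (Fin 2) ℤ) := inferInstanceAs (Countable (Fin 2 → Fin 2 → ℤ))
  Subtype.countable

lemma measurable_fdCount : Measurable fdCount :=
  .tsum fun γ ↦ measurable_fd_indicator.comp (measurable_SL_smul γ)

lemma volume_fd_lt_top : volume ModularGroup.fd < ∞ := by
  rw [volume_eq_lintegral]
  set h : ℝ → ℝ := fun y ↦ y ^ (-2 : ℝ)
  have hh : IntegrableOn h (Set.Ioi (1 / 2)) :=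
    integrableOn_Ioi_rpow_of_lt (by norm_num) (by norm_num)
  have hsub : ((↑) '' ModularGroup.fd : Set ℂ) ⊆
      Complex.measurableEquivRealProd ⁻¹' (Set.Icc (-(1 / 2)) (1 / 2) ×ˢ Set.Ioi (1 / 2)) := by
    rintro _ ⟨z, hz, rfl⟩
    have h1 := hz.2
    have h2 := ModularGroup.three_le_four_mul_im_sq_of_mem_fd hz
    have h3 := z.im_pos
    refine ⟨abs_le.1 h1, ?_⟩
    change 1 / 2 < z.im
    nlinarith
  refine (lintegral_mono_set hsub).trans_lt ?_
  have e := Complex.volume_preserving_equiv_real_prod.setLIntegral_comp_preimage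
    (f := fun p : ℝ × ℝ ↦ ((((1 / ‖p.2‖₊) ^ 2 : NNReal)) : ℝ≥0∞))
    ((measurableSet_Icc (a := (-(1 / 2) : ℝ)) (b := 1 / 2)).prod
      (measurableSet_Ioi (a := (1 / 2 : ℝ)))) (by fun_prop)
  simp only [Complex.measurableEquivRealProd_apply] at e
  rw [e, Measure.volume_eq_prod,
    setLIntegral_prod _ (by fun_prop)]
  simp only [lintegral_const, Measure.restrict_apply MeasurableSet.univ, Set.univ_inter,
    Real.volume_Icc]
  refine ENNReal.mul_lt_top ?_ ENNReal.ofReal_lt_top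
  refine lt_of_le_of_lt (setLIntegral_mono' measurableSet_Ioi fun y hy ↦ ?_)
    (hasFiniteIntegral_iff_enorm.1 hh.2)
  have hy0 : (0 : ℝ) < y := lt_trans (by norm_num) hy
  rw [enorm_eq_nnnorm]
  refine ENNReal.coe_le_coe.2 (NNReal.coe_le_coe.1 ?_)
  simp only [h, NNReal.coe_pow, NNReal.coe_div, NNReal.coe_one, coe_nnnorm, Real.norm_eq_abs,
    abs_of_pos hy0, abs_of_pos (Real.rpow_pos_of_pos hy0 _)]
  rw [Real.rpow_neg hy0.le]
  norm_cast
  simp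

/-- A weight on the upper half-plane whose translates under the modular group add up to one. -/
def fdWeight (z : ℍ) : ℝ := (ModularGroup.fd.indicator 1 z / fdCount z).toReal

lemma fdWeight_nonneg (z : ℍ) : 0 ≤ fdWeight z := ENNReal.toReal_nonneg

lemma measurable_fdWeight : Measurable fdWeight :=
  (measurable_fd_indicator.div measurable_fdCount).ennreal_toReal

/-- Dividing the indicator of the closed domain by the invariant count gives an exact partition of
unity, with no exceptional set for boundary points or stabilisers. It serves to unfold integrals. -/
lemma hasSum_fdWeight (z : ℍ) : HasSum (fun γ : SL(2, ℤ) ↦ fdWeight (γ • z)) 1 := by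
  have h1 : ∑' γ : SL(2, ℤ), ((ModularGroup.fd.indicator 1 (γ • z) : ℝ≥0∞) / fdCount (γ • z)) =
      1 := by
    simp only [fdCount_smul, div_eq_mul_inv, ENNReal.tsum_mul_right]
    exact ENNReal.mul_inv_cancel (zero_lt_one.trans_le (one_le_fdCount z)).ne' (fdCount_ne_top z)
  have h2 := ENNReal.hasSum_toReal (h1.trans_ne ENNReal.one_ne_top)
  rwa [← ENNReal.tsum_toReal_eq fun γ ↦ ?_, h1, ENNReal.toReal_one] at h2
  exact ne_top_of_le_ne_top (h1.trans_ne ENNReal.one_ne_top) (ENNReal.le_tsum γ)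

lemma fdWeight_le_one (z : ℍ) : fdWeight z ≤ 1 := by
  have := (hasSum_fdWeight z).summable.le_tsum 1 fun γ _ ↦ fdWeight_nonneg _
  rwa [(hasSum_fdWeight z).tsum_eq, one_smul] at this

lemma integrable_fdWeight : Integrable fdWeight := by
  have h1 : Integrable (ModularGroup.fd.indicator fun _ ↦ (1 : ℝ)) :=
    (integrable_indicator_iff ModularGroup.isClosed_fd.measurableSet).2
      (integrableOn_const volume_fd_lt_top.ne)
  refine h1.mono' measurable_fdWeight.aestronglyMeasurable (Eventually.of_forall fun z ↦ ?_)
  rw [Real.norm_of_nonneg (fdWeight_nonneg z)]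
  by_cases h : z ∈ ModularGroup.fd
  · simpa [h] using fdWeight_le_one z
  · simp [h, fdWeight]

/-- A nonempty open subset of the upper half-plane has positive volume. -/
lemma volume_ne_zero_of_isOpen {s : Set ℍ} (hs : IsOpen s) (hne : s.Nonempty) : volume s ≠ 0 := by
  rw [volume_eq_lintegral]
  have ho : IsOpen ((↑) '' s : Set ℂ) := isOpenEmbedding_coe.isOpenMap _ hs
  intro h0
  rw [lintegral_eq_zero_iff (by fun_prop)] at h0
  have h1 := (ae_restrict_iff' ho.measurableSet).1 h0
  have h2 : ∀ᵐ x : ℂ, x ∉ ((↑) '' s : Set ℂ) := by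
    filter_upwards [h1] with x hx hxs
    obtain ⟨z, hz, rfl⟩ := hxs
    have := hx ⟨z, hz, rfl⟩
    simp [z.im_pos.ne'] at this
  have h3 : volume ((↑) '' s : Set ℂ) = 0 := by
    have := ae_iff.1 h2
    simp only [not_not] at this
    exact this
  exact ho.measure_ne_zero volume (hne.image _) h3

/-! ### Integral matrices of fixed determinant and Hecke operators -/

/-- An integral matrix of determinant `m ≠ 0` as an invertible real matrix. -/
def fixedDetGL (m : ℕ) [NeZero m] (δ : FixedDetMatrix (Fin 2) ℤ (m : ℤ)) : GL (Fin 2) ℝ :=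
  .mkOfDetNeZero (δ.1.map (Int.castRingHom ℝ)) (by
    rw [← RingHom.mapMatrix_apply, ← RingHom.map_det, δ.2]
    simpa using NeZero.ne m)

section FixedDet

variable {m : ℕ} [NeZero m]

lemma coe_fixedDetGL (δ : FixedDetMatrix (Fin 2) ℤ (m : ℤ)) :
    (fixedDetGL m δ : Matrix (Fin 2) (Fin 2) ℝ) = δ.1.map (Int.castRingHom ℝ) := rfl

lemma fixedDetGL_apply (δ : FixedDetMatrix (Fin 2) ℤ (m : ℤ)) (i j : Fin 2) :
    (fixedDetGL m δ) i j = (δ.1 i j : ℝ) := rfl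

lemma det_fixedDetGL (δ : FixedDetMatrix (Fin 2) ℤ (m : ℤ)) :
    (fixedDetGL m δ).det.val = (m : ℝ) := by
  rw [Matrix.GeneralLinearGroup.val_det_apply, coe_fixedDetGL, ← RingHom.mapMatrix_apply,
    ← RingHom.map_det, δ.2]
  simp

lemma fixedDetGL_smul (γ : SL(2, ℤ)) (δ : FixedDetMatrix (Fin 2) ℤ (m : ℤ)) :
    fixedDetGL m (γ • δ) = Matrix.SpecialLinearGroup.mapGL ℝ γ * fixedDetGL m δ := by
  refine Units.ext ?_
  rw [Units.val_mul, coe_fixedDetGL, coe_fixedDetGL, FixedDetMatrices.smul_coe, Matrix.map_mul]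
  rfl

/-- The adjugate as an involution on the integral matrices of determinant `m`. -/
def fixedDetAdj (m : ℕ) :
    FixedDetMatrix (Fin 2) ℤ (m : ℤ) ≃ FixedDetMatrix (Fin 2) ℤ (m : ℤ) :=
  Function.Involutive.toPerm (fun δ ↦ ⟨δ.1.adjugate, by simp [Matrix.det_adjugate, δ.2]⟩)
    fun δ ↦ by
      ext i j
      fin_cases i <;> fin_cases j <;> simp [Matrix.adjugate_fin_two]

lemma fixedDetGL_adj_mul (δ : FixedDetMatrix (Fin 2) ℤ (m : ℤ)) :
    fixedDetGL m (fixedDetAdj m δ) * fixedDetGL m δ =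
      .scalar (Fin 2) (Units.mk0 (m : ℝ) (by exact_mod_cast NeZero.ne m)) := by
  refine Units.ext ?_
  rw [Units.val_mul, coe_fixedDetGL, coe_fixedDetGL, ← Matrix.map_mul]
  have : (fixedDetAdj m δ).1 * δ.1 = (m : ℤ) • 1 := by
    change δ.1.adjugate * δ.1 = _
    rw [Matrix.adjugate_mul, δ.2]
  rw [this]
  ext i j
  rw [Matrix.map_apply, Matrix.smul_apply]
  fin_cases i <;> fin_cases j <;> simp [← Matrix.diagonal_natCast]

lemma fixedDetGL_adj_smul (δ : FixedDetMatrix (Fin 2) ℤ (m : ℤ)) (z : ℍ) :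
    fixedDetGL m (fixedDetAdj m δ) • fixedDetGL m δ • z = z := by
  rw [← mul_smul, fixedDetGL_adj_mul, glScalar_smul]

lemma slash_scalar (k : ℤ) (f : ℍ → ℂ) (u : ℝˣ) :
    f ∣[k] (Matrix.GeneralLinearGroup.scalar (Fin 2) u) = (u.val : ℂ) ^ (k - 2) • f := by
  ext z
  have hu : (u.val : ℂ) ≠ 0 := by exact_mod_cast u.ne_zero
  have hdet : (Matrix.GeneralLinearGroup.scalar (Fin 2) u).det.val = u.val ^ 2 := by
    simp [sq]
  have hpos : 0 < u.val ^ 2 := sq_pos_of_ne_zero u.ne_zero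
  rw [ModularForm.slash_apply, σ, hdet, if_pos hpos, glScalar_smul, denom_scalar,
    abs_of_nonneg (by positivity)]
  simp only [ContinuousAlgEquiv.refl_apply, Pi.smul_apply, smul_eq_mul, Complex.ofReal_pow]
  rw [mul_assoc, mul_comm, ← zpow_natCast, ← zpow_mul, ← zpow_add₀ hu]
  congr 2
  push_cast
  ring

end FixedDet

/-- The index set of the upper triangular representatives for the integral matrices of
determinant `m`. -/
abbrev HeckeIndex (m : ℕ) : Type :=
  (m.divisorsAntidiagonal.sigma fun p ↦ Finset.range p.2 : Finset (Σ _ : ℕ × ℕ, ℕ))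

lemma HeckeIndex.mul_eq {m : ℕ} (p : HeckeIndex m) : p.1.1.1 * p.1.1.2 = m :=
  (Nat.mem_divisorsAntidiagonal.1 (Finset.mem_sigma.1 p.2).1).1

lemma HeckeIndex.lt {m : ℕ} (p : HeckeIndex m) : p.1.2 < p.1.1.2 :=
  Finset.mem_range.1 (Finset.mem_sigma.1 p.2).2

lemma HeckeIndex.pos {m : ℕ} (p : HeckeIndex m) : 0 < p.1.1.1 :=
  Nat.pos_of_ne_zero (Nat.ne_zero_of_mem_divisorsAntidiagonal (Finset.mem_sigma.1 p.2).1).1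

/-- The upper triangular representatives for the integral matrices of determinant `m`. -/
def heckeRep {m : ℕ} (p : HeckeIndex m) : FixedDetMatrix (Fin 2) ℤ (m : ℤ) :=
  ⟨!![(p.1.1.1 : ℤ), p.1.2; 0, p.1.1.2], by
    rw [Matrix.det_fin_two_of, mul_zero, sub_zero]
    exact_mod_cast p.mul_eq⟩

lemma slash_heckeRep {m : ℕ} [NeZero m] (k : ℤ) (f : ℍ → ℂ) (p : HeckeIndex m) (z : ℍ) :
    (f ∣[k] fixedDetGL m (heckeRep p)) z = (m : ℂ) ^ (k - 1) * (((p.1.1.2 : ℂ) ^ k)⁻¹ *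
      f (ofComplex (((p.1.1.1 : ℂ) * (z : ℂ) + (p.1.2 : ℂ)) / (p.1.1.2 : ℂ)))) := by
  have hm : (0 : ℝ) < m := by exact_mod_cast Nat.pos_of_ne_zero (NeZero.ne m)
  have hsmul : fixedDetGL m (heckeRep p) • z =
      ofComplex (((p.1.1.1 : ℂ) * (z : ℂ) + (p.1.2 : ℂ)) / (p.1.1.2 : ℂ)) := by
    have h := coe_smul_of_det_pos (g := fixedDetGL m (heckeRep p)) (by rwa [det_fixedDetGL]) z
    have h' : num (fixedDetGL m (heckeRep p)) z / denom (fixedDetGL m (heckeRep p)) z =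
        ((p.1.1.1 : ℂ) * (z : ℂ) + (p.1.2 : ℂ)) / (p.1.1.2 : ℂ) := by
      rw [num, denom]
      simp only [fixedDetGL_apply]
      simp [heckeRep]
    rw [← h', ← h, ofComplex_apply]
  rw [ModularForm.slash_apply, σ, det_fixedDetGL, if_pos hm, hsmul, abs_of_pos hm]
  have hden : denom (fixedDetGL m (heckeRep p)) z = (p.1.1.2 : ℂ) := by
    rw [denom]
    simp only [fixedDetGL_apply]
    simp [heckeRep]
  rw [hden, zpow_neg]
  simp only [ContinuousAlgEquiv.refl_apply, Complex.ofReal_natCast]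
  ring

lemma sum_slash_heckeRep {m : ℕ} [NeZero m] (k : ℤ) (f : ℍ → ℂ) (z : ℍ) :
    ∑ p : HeckeIndex m, (f ∣[k] fixedDetGL m (heckeRep p)) z = hecke k m f z := by
  simp only [slash_heckeRep, hecke, Finset.mul_sum]
  rw [Finset.sum_coe_sort (m.divisorsAntidiagonal.sigma fun p ↦ Finset.range p.2)
    (fun p : (Σ _ : ℕ × ℕ, ℕ) ↦ (m : ℂ) ^ (k - 1) * (((p.1.2 : ℂ) ^ k)⁻¹ *
      f (ofComplex (((p.1.1 : ℂ) * (z : ℂ) + (p.2 : ℂ)) / (p.1.2 : ℂ))))), Finset.sum_sigma]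

/-- Hermite normal form, by reduction with S and T. -/
lemma exists_smul_heckeRep {m : ℕ} (hm : m ≠ 0) (δ : FixedDetMatrix (Fin 2) ℤ (m : ℤ)) :
    ∃ (p : HeckeIndex m) (γ : SL(2, ℤ)), γ • heckeRep p = δ := by
  induction δ using FixedDetMatrices.induction_on (Nat.cast_ne_zero.2 hm) with
  | h0 A hc ha hb hlt =>
    have hdet := A.2
    rw [Matrix.det_fin_two, hc, mul_zero, sub_zero] at hdet
    have hd : 0 < A.1 1 1 := by
      refine pos_of_mul_pos_right (a := A.1 0 0) ?_ ha.le
      rw [hdet]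
      exact_mod_cast Nat.pos_of_ne_zero hm
    rw [abs_of_nonneg hb, abs_of_pos hd] at hlt
    lift A.1 0 0 to ℕ using ha.le with a ha'
    lift A.1 0 1 to ℕ using hb with b hb'
    lift A.1 1 1 to ℕ using hd.le with d hd'
    refine ⟨⟨⟨(a, d), b⟩, ?_⟩, 1, ?_⟩
    · rw [Finset.mem_sigma, Nat.mem_divisorsAntidiagonal, Finset.mem_range]
      exact ⟨⟨by exact_mod_cast hdet, hm⟩, by exact_mod_cast hlt⟩
    · rw [one_smul]
      ext i j
      fin_cases i <;> fin_cases j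
      exacts [ha', hb', hc.symm, hd']
  | hS B h =>
    obtain ⟨p, γ, rfl⟩ := h
    exact ⟨p, ModularGroup.S * γ, mul_smul _ _ _⟩
  | hT B h =>
    obtain ⟨p, γ, rfl⟩ := h
    exact ⟨p, ModularGroup.T * γ, mul_smul _ _ _⟩

/-- The zero lower-left entries and positivity of the diagonal make g unipotent, and the range 0 ≤ b
< d excludes nontrivial translations. -/
lemma eq_of_smul_heckeRep_eq {m : ℕ} {p p' : HeckeIndex m} {g : SL(2, ℤ)}
    (h : g • heckeRep p = heckeRep p') : p = p' ∧ g = 1 := by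
  have h0 := congrArg Subtype.val h
  rw [FixedDetMatrices.smul_coe] at h0
  have e := fun i j ↦ congrFun₂ h0 i j
  have ha := p.pos
  have ha' := p'.pos
  have hd := p.lt
  have hd' := p'.lt
  have e00 := e 0 0
  have e10 := e 1 0
  have e01 := e 0 1
  have e11 := e 1 1
  simp only [heckeRep, Matrix.mul_apply, Fin.sum_univ_two, Matrix.of_apply, Matrix.cons_val', Matrix.cons_val_zero,
    Matrix.cons_val_one, Matrix.cons_val_fin_one, mul_zero, add_zero] at e00 e10 e01 e11
  have hg10 : g 1 0 = 0 := (mul_eq_zero.1 e10).resolve_right (by exact_mod_cast ha.ne')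
  have hdet := g.det_coe
  rw [Matrix.det_fin_two, hg10, mul_zero, sub_zero] at hdet
  have hg00 : g 0 0 = 1 := by
    rcases Int.eq_one_or_neg_one_of_mul_eq_one hdet with h | h
    · exact h
    · rw [h] at e00
      omega
  have hg11 : g 1 1 = 1 := by simpa [hg00] using hdet
  rw [hg00, one_mul] at e00 e01
  rw [hg10, hg11, one_mul, zero_mul, zero_add] at e11
  have hg01 : g 0 1 = 0 := by
    have h1 : |g 0 1 * (p.1.1.2 : ℤ)| < p.1.1.2 := by
      rw [abs_lt]
      constructor <;> omega
    rw [abs_mul, Nat.abs_cast] at h1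
    by_contra hne
    have := Int.one_le_abs hne
    nlinarith
  rw [hg01, zero_mul, add_zero] at e01
  constructor
  · obtain ⟨⟨⟨a, d⟩, b⟩, hp⟩ := p
    obtain ⟨⟨⟨a', d'⟩, b'⟩, hp'⟩ := p'
    simp only [Nat.cast_inj] at e00 e01 e11
    subst e00 e01 e11
    rfl
  · ext i j
    fin_cases i <;> fin_cases j <;> simp [hg00, hg01, hg10, hg11]

/-- The integral matrices of determinant `m` as a disjoint union of left cosets. -/
def heckeEquiv {m : ℕ} (hm : m ≠ 0) :
    HeckeIndex m × SL(2, ℤ) ≃ FixedDetMatrix (Fin 2) ℤ (m : ℤ) :=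
  Equiv.ofBijective (fun x ↦ x.2 • heckeRep x.1) ⟨fun x y hxy ↦ by
      have h : (y.2⁻¹ * x.2) • heckeRep x.1 = heckeRep y.1 := by
        rw [mul_smul]
        exact inv_smul_eq_iff.2 hxy
      obtain ⟨h1, h2⟩ := eq_of_smul_heckeRep_eq h
      exact Prod.ext h1 (inv_mul_eq_one.1 h2).symm,
    fun δ ↦ by
      obtain ⟨p, γ, h⟩ := exists_smul_heckeRep hm δ
      exact ⟨(p, γ), h⟩⟩

lemma hasSum_fintype_prod {ι β E : Type*} [Fintype ι] [AddCommMonoid E] [TopologicalSpace E]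
    [ContinuousAdd E] {F : ι × β → E} {G : ι → E} (h : ∀ i, HasSum (fun b ↦ F (i, b)) (G i)) :
    HasSum F (∑ i, G i) := by
  classical
  have h1 : ∀ i, HasSum (fun x : ι × β ↦ if x.1 = i then F x else 0) (G i) := fun i ↦ by
    refine ((Prod.mk_right_injective i).hasSum_iff fun x hx ↦ if_neg ?_).1 ?_
    · rintro rfl
      exact hx ⟨x.2, rfl⟩
    · simpa [Function.comp_def] using h i
  have h2 := hasSum_sum (s := Finset.univ) fun i _ ↦ h1 i
  simpa using h2

/-! ### Hecke eigenvalues of cusp forms are real -/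

section Reality

variable {k : ℤ} (f : CuspForm 𝒮ℒ k) {m : ℕ} [NeZero m]

/-- The Petersson pairing of a function with its translate by an integral matrix. -/
def heckeKernel (k : ℤ) (m : ℕ) [NeZero m] (f : ℍ → ℂ)
    (δ : FixedDetMatrix (Fin 2) ℤ (m : ℤ)) (z : ℍ) : ℂ :=
  petersson k f (f ∣[k] fixedDetGL m δ) z

lemma heckeKernel_smul_left (γ : SL(2, ℤ)) (δ : FixedDetMatrix (Fin 2) ℤ (m : ℤ)) :
    heckeKernel k m f (γ • δ) = heckeKernel k m f δ := by
  ext z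
  rw [heckeKernel, heckeKernel, fixedDetGL_smul, SlashAction.slash_mul,
    SlashInvariantFormClass.slash_action_eq f _ (⟨γ, rfl⟩ :
      Matrix.SpecialLinearGroup.mapGL ℝ γ ∈ 𝒮ℒ)]

lemma petersson_slash_fixedDetGL (f f' : ℍ → ℂ) (δ : FixedDetMatrix (Fin 2) ℤ (m : ℤ)) (z : ℍ) :
    petersson k (f ∣[k] fixedDetGL m δ) (f' ∣[k] fixedDetGL m δ) z =
      (m : ℂ) ^ (k - 2) * petersson k f f' (fixedDetGL m δ • z) := by
  have hm : (0 : ℝ) < m := by exact_mod_cast Nat.pos_of_ne_zero (NeZero.ne m)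
  rw [petersson_slash, σ, det_fixedDetGL, if_pos hm, abs_of_pos hm]
  simp

/-- Slashing both entries by δ turns the pair (f, f|adj δ) into (f|δ, f) up to scalars, because
adj(δ) δ is the scalar m; Hermitian symmetry of the pairing gives the conjugate. This is the local
form of self-adjointness. -/
lemma heckeKernel_adj (f : ℍ → ℂ) (δ : FixedDetMatrix (Fin 2) ℤ (m : ℤ)) (z : ℍ) :
    heckeKernel k m f (fixedDetAdj m δ) (fixedDetGL m δ • z) = conj (heckeKernel k m f δ z) := by
  have hm : (m : ℂ) ^ (k - 2) ≠ 0 := zpow_ne_zero _ (by exact_mod_cast NeZero.ne m)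
  refine mul_left_cancel₀ hm ?_
  rw [heckeKernel, ← petersson_slash_fixedDetGL, ← SlashAction.slash_mul, fixedDetGL_adj_mul,
    slash_scalar, heckeKernel, ← petersson_symm]
  simp only [petersson, Pi.smul_apply, smul_eq_mul, Units.val_mk0, Complex.ofReal_natCast]
  ring

/-- The square of the norm is the product of the pointwise Petersson norms of f and of f|δ, both
bounded independently of δ because f is cuspidal. -/
lemma exists_norm_heckeKernel_le (k : ℤ) (f : CuspForm 𝒮ℒ k) (m : ℕ) [NeZero m] :
    ∃ B : ℝ, 0 ≤ B ∧ ∀ δ z, ‖heckeKernel k m f δ z‖ ≤ B := by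
  obtain ⟨C, hC⟩ := CuspFormClass.petersson_bounded_left k 𝒮ℒ f f
  have hC0 : 0 ≤ C := (norm_nonneg _).trans (hC UpperHalfPlane.I)
  refine ⟨√(C * ((m : ℝ) ^ (k - 2) * C)), Real.sqrt_nonneg _, fun δ z ↦ Real.le_sqrt_of_sq_le ?_⟩
  have h1 : ‖heckeKernel k m f δ z‖ ^ 2 = ‖petersson k f f z‖ *
      ‖petersson k (f ∣[k] fixedDetGL m δ) (f ∣[k] fixedDetGL m δ) z‖ := by
    simp only [heckeKernel, petersson, norm_mul, RCLike.norm_conj]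
    ring
  rw [h1, petersson_slash_fixedDetGL, norm_mul, norm_zpow, RCLike.norm_natCast]
  gcongr
  · exact hC z
  · exact hC _

lemma continuous_heckeKernel (δ : FixedDetMatrix (Fin 2) ℤ (m : ℤ)) :
    Continuous (heckeKernel k m f δ) :=
  petersson_continuous k (CuspFormClass.holo f).continuous
    ((CuspFormClass.holo f).slash k (fixedDetGL m δ)).continuous

/-- The unfolded integrand of the Petersson product of a form with its image under a Hecke
operator. -/
def heckeIntegrand (k : ℤ) (m : ℕ) [NeZero m] (f : ℍ → ℂ)
    (δ : FixedDetMatrix (Fin 2) ℤ (m : ℤ)) (z : ℍ) : ℂ :=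
  (fdWeight z * fdWeight (fixedDetGL m δ • z) : ℝ) * heckeKernel k m f δ z

lemma hasSum_fdWeight_fixedDetGL (m : ℕ) [NeZero m] (z : ℍ) :
    HasSum (fun δ ↦ fdWeight (fixedDetGL m δ • z)) (Fintype.card (HeckeIndex m) : ℝ) := by
  rw [← (heckeEquiv (NeZero.ne m)).hasSum_iff]
  have : (Fintype.card (HeckeIndex m) : ℝ) = ∑ _ : HeckeIndex m, (1 : ℝ) := by simp
  rw [this]
  refine hasSum_fintype_prod fun p ↦ ?_
  convert hasSum_fdWeight (fixedDetGL m (heckeRep p) • z) using 2 with γ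
  change fdWeight (fixedDetGL m (γ • heckeRep p) • z) = _
  rw [fixedDetGL_smul, mul_smul]
  rfl

/-- The kernel depends only on the left coset of δ. Within a coset the second weight sums to one,
leaving the sum over coset representatives that defines the Hecke operator. -/
lemma hasSum_heckeIntegrand (z : ℍ) :
    HasSum (fun δ ↦ heckeIntegrand k m f δ z)
      (fdWeight z * (conj (f z) * hecke k m f z * z.im ^ k)) := by
  have e : (fdWeight z * (conj (f z) * hecke k m f z * z.im ^ k) : ℂ) =
      ∑ p : HeckeIndex m, fdWeight z * heckeKernel k m f (heckeRep p) z := by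
    rw [← sum_slash_heckeRep, Finset.mul_sum, Finset.sum_mul, Finset.mul_sum]
    rfl
  rw [← (heckeEquiv (NeZero.ne m)).hasSum_iff, e]
  refine hasSum_fintype_prod fun p ↦ ?_
  have h := ((Complex.hasSum_ofReal.2 (hasSum_fdWeight (fixedDetGL m (heckeRep p) • z))).mul_left
    (fdWeight z * heckeKernel k m f (heckeRep p) z : ℂ))
  rw [Complex.ofReal_one, mul_one] at h
  refine (hasSum_congr_fun fun γ ↦ ?_).mp h
  change _ = heckeIntegrand k m f (γ • heckeRep p) z
  rw [heckeIntegrand, heckeKernel_smul_left, fixedDetGL_smul, mul_smul]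
  push_cast
  have : γ • fixedDetGL m (heckeRep p) • z =
    Matrix.SpecialLinearGroup.mapGL ℝ γ • fixedDetGL m (heckeRep p) • z := rfl
  rw [this]
  ring

lemma norm_heckeIntegrand_le {f : ℍ → ℂ} {B : ℝ} (hB : ∀ δ z, ‖heckeKernel k m f δ z‖ ≤ B)
    (δ : FixedDetMatrix (Fin 2) ℤ (m : ℤ)) (z : ℍ) :
    ‖heckeIntegrand k m f δ z‖ ≤ fdWeight z * fdWeight (fixedDetGL m δ • z) * B := by
  rw [heckeIntegrand, norm_mul, Complex.norm_real,
    Real.norm_of_nonneg (mul_nonneg (fdWeight_nonneg _) (fdWeight_nonneg _))]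
  exact mul_le_mul_of_nonneg_left (hB δ z) (mul_nonneg (fdWeight_nonneg _) (fdWeight_nonneg _))

lemma integrable_heckeIntegrand (δ : FixedDetMatrix (Fin 2) ℤ (m : ℤ)) :
    Integrable (heckeIntegrand k m f δ) := by
  obtain ⟨B, hB0, hB⟩ := exists_norm_heckeKernel_le k f m
  refine (integrable_fdWeight.mul_const B).mono' ?_ (Eventually.of_forall fun z ↦
    (norm_heckeIntegrand_le hB δ z).trans ?_)
  · refine Measurable.aestronglyMeasurable ?_
    refine Measurable.mul ?_ (continuous_heckeKernel f δ).measurable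
    exact Complex.measurable_ofReal.comp (measurable_fdWeight.mul
      (measurable_fdWeight.comp (continuous_const_smul (fixedDetGL m δ)).measurable))
  · have := mul_le_mul_of_nonneg_left (fdWeight_le_one (fixedDetGL m δ • z)) (fdWeight_nonneg z)
    rw [mul_one] at this
    exact mul_le_mul_of_nonneg_right this hB0

lemma summable_integral_norm_heckeIntegrand (m : ℕ) [NeZero m] :
    Summable fun δ ↦ ∫ z, ‖heckeIntegrand k m f δ z‖ := by
  obtain ⟨B, hB0, hB⟩ := exists_norm_heckeKernel_le k f m
  refine summable_of_sum_le (c := ∫ z, fdWeight z * (Fintype.card (HeckeIndex m) * B))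
    (fun δ ↦ integral_nonneg fun z ↦ norm_nonneg _) fun u ↦ ?_
  rw [← integral_finsetSum _ fun δ _ ↦ (integrable_heckeIntegrand f δ).norm]
  refine integral_mono (integrable_finsetSum _ fun δ _ ↦ (integrable_heckeIntegrand f δ).norm)
    (integrable_fdWeight.mul_const _) fun z ↦ ?_
  refine (Finset.sum_le_sum fun δ _ ↦ norm_heckeIntegrand_le hB δ z).trans ?_
  simp only [mul_assoc]
  rw [← Finset.mul_sum, ← Finset.sum_mul]
  have := sum_le_hasSum u (fun δ _ ↦ fdWeight_nonneg _) (hasSum_fdWeight_fixedDetGL m z)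
  exact mul_le_mul_of_nonneg_left (mul_le_mul_of_nonneg_right this hB0) (fdWeight_nonneg z)

/-- The substitution z ↦ δz preserves the measure and exchanges the two weights, which is why the
integrand carries a weight at both points. -/
lemma integral_heckeIntegrand_adj (f : ℍ → ℂ) (δ : FixedDetMatrix (Fin 2) ℤ (m : ℤ)) :
    ∫ z, heckeIntegrand k m f (fixedDetAdj m δ) z = conj (∫ z, heckeIntegrand k m f δ z) := by
  rw [← integral_smul_eq_self _ (g := fixedDetGL m δ), ← integral_conj]
  congr 1 with z
  rw [heckeIntegrand, heckeIntegrand, heckeKernel_adj, fixedDetGL_adj_smul, map_mul,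
    Complex.conj_ofReal, mul_comm (fdWeight z)]

/-- The Petersson norm of a cusp form, as an integral over the upper half-plane. -/
def peterssonNorm (k : ℤ) (f : ℍ → ℂ) : ℝ := ∫ z, fdWeight z * (‖f z‖ ^ 2 * z.im ^ k)

lemma petersson_self (k : ℤ) (f : ℍ → ℂ) (z : ℍ) :
    petersson k f f z = (‖f z‖ ^ 2 * z.im ^ k : ℝ) := by
  rw [petersson, ← Complex.normSq_eq_conj_mul_self, Complex.normSq_eq_norm_sq]
  push_cast
  rfl

/-- If the integral vanished, invariance of |f|² y^k would make its product with every translate of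
the weight vanish almost everywhere. The translates sum to one, so f = 0 almost everywhere, against
continuity. -/
lemma peterssonNorm_ne_zero {f : CuspForm 𝒮ℒ k} (hf : (f : ℍ → ℂ) ≠ 0) :
    peterssonNorm k f ≠ 0 := by
  have hcont : Continuous f := (CuspFormClass.holo f).continuous
  have hnn : ∀ z : ℍ, 0 ≤ ‖f z‖ ^ 2 * z.im ^ k := fun z ↦ by have := z.im_pos; positivity
  obtain ⟨C, hC⟩ := CuspFormClass.petersson_bounded_left k 𝒮ℒ f f
  have hint : Integrable fun z ↦ fdWeight z * (‖f z‖ ^ 2 * z.im ^ k) := by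
    refine (integrable_fdWeight.mul_const C).mono' ?_ (Eventually.of_forall fun z ↦ ?_)
    · refine (measurable_fdWeight.mul (Measurable.mul (by fun_prop) ?_)).aestronglyMeasurable
      exact (continuous_im.zpow₀ k fun z ↦ Or.inl z.im_ne_zero).measurable
    · have h := hC z
      rw [petersson_self, Complex.norm_real, Real.norm_of_nonneg (hnn z)] at h
      rw [Real.norm_of_nonneg (mul_nonneg (fdWeight_nonneg z) (hnn z))]
      exact mul_le_mul_of_nonneg_left h (fdWeight_nonneg z)
  intro h0
  rw [peterssonNorm, integral_eq_zero_iff_of_nonneg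
    (fun z ↦ mul_nonneg (fdWeight_nonneg z) (hnn z)) hint] at h0
  have h1 : ∀ᵐ z : ℍ, ∀ γ : SL(2, ℤ), fdWeight (γ • z) * (‖f z‖ ^ 2 * z.im ^ k) = 0 := by
    refine ae_all_iff.2 fun γ ↦ ?_
    have h2 := (measurePreserving_smul (Matrix.SpecialLinearGroup.mapGL ℝ γ)
      (volume : Measure ℍ)).quasiMeasurePreserving.ae h0
    filter_upwards [h2] with z hz
    have h3 := SlashInvariantFormClass.petersson_smul (k := k) (f := f) (f' := f) (τ := z)
      (⟨γ, rfl⟩ : Matrix.SpecialLinearGroup.mapGL ℝ γ ∈ 𝒮ℒ)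
    rw [petersson_self, petersson_self, Complex.ofReal_inj] at h3
    simp only [Pi.zero_apply] at hz
    rw [h3] at hz
    exact hz
  have h2 : ∀ᵐ z : ℍ, z ∉ {z : ℍ | f z ≠ 0} := by
    filter_upwards [h1] with z hz hfz
    have hpos : ‖f z‖ ^ 2 * z.im ^ k ≠ 0 :=
      mul_ne_zero (pow_ne_zero _ (norm_ne_zero_iff.2 hfz)) (zpow_ne_zero _ z.im_ne_zero)
    have h3 := hasSum_fdWeight z
    simp only [fun γ ↦ (mul_eq_zero.1 (hz γ)).resolve_right hpos] at h3
    exact zero_ne_one (hasSum_zero.unique h3)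
  have h3 : (volume : Measure ℍ) {z : ℍ | f z ≠ 0} = 0 := by
    have := ae_iff.1 h2
    simp only [not_not] at this
    exact this
  refine volume_ne_zero_of_isOpen (isOpen_ne_fun hcont continuous_const) ?_ h3
  exact Function.ne_iff.1 hf

/-- The Hecke operators are self-adjoint for the Petersson product; hence their eigenvalues on
cusp forms are real. -/
lemma conj_hecke_eigenvalue {f : CuspForm 𝒮ℒ k} (hf : (f : ℍ → ℂ) ≠ 0) {c : ℂ}
    (h : ∀ z, hecke k m f z = c * f z) : conj c = c := by
  have : Countable (FixedDetMatrix (Fin 2) ℤ (m : ℤ)) :=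
    (heckeEquiv (NeZero.ne m)).symm.injective.countable
  have h1 := hasSum_integral_of_summable_integral_norm
    (fun δ ↦ integrable_heckeIntegrand f (m := m) δ) (summable_integral_norm_heckeIntegrand f m)
  have h2 : ∫ z, ∑' δ, heckeIntegrand k m f δ z = c * peterssonNorm k f := by
    rw [peterssonNorm, ← integral_complex_ofReal, ← integral_const_mul]
    congr 1 with z
    rw [(hasSum_heckeIntegrand f z).tsum_eq, h z, Complex.ofReal_mul, ← petersson_self, petersson]
    ring
  rw [h2] at h1
  -- Reindexing by the adjugate conjugates every term, so the sum c · ‖f‖² equals its own conjugate.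
  have h3 := (fixedDetAdj m).hasSum_iff.2 h1
  simp only [Function.comp_def, integral_heckeIntegrand_adj] at h3
  have h4 := (Complex.hasSum_conj'.2 h1).unique h3
  rw [map_mul, Complex.conj_ofReal] at h4
  exact mul_right_cancel₀ (by exact_mod_cast peterssonNorm_ne_zero hf) h4

end Reality

/-- The Fourier coefficients of a normalised Hecke eigenform are real. -/
lemma IsNormalizedHeckeEigenform.conjCoeff_eq {k : ℤ} {f : CuspForm 𝒮ℒ k}
    (h : IsNormalizedHeckeEigenform f) : conjCoeff f = f := by
  have ha := hasQExpansion_cuspForm f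
  set a : ℤ → ℂ := fun m ↦ if 0 ≤ m then (qExpansion 1 f).coeff m.toNat else 0 with ha'
  have ha1 : a 1 = 1 := by simpa [ha'] using h.1
  have hf : (f : ℍ → ℂ) ≠ 0 := fun h0 ↦ by
    have := congrFun (ha.unique (b := 0) fun z ↦ by simp [h0]) 1
    rw [ha1] at this
    exact one_ne_zero this
  have hreal : ∀ m : ℤ, conj (a m) = a m := fun m ↦ by
    rcases lt_trichotomy m 0 with hm | rfl | hm
    · simp [ha', not_le.2 hm]
    · obtain ⟨b, hb, hb0⟩ := (cuspForm_isWeakCuspForm f).2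
      rw [ha.unique hb, hb0, map_zero]
    · lift m to ℕ using hm.le
      have hm' : 1 ≤ m := by omega
      have : NeZero m := ⟨by omega⟩
      obtain ⟨c, hc⟩ := h.2 m hm'
      rw [← hecke_eigenvalue_mul ha hm' hc, ha1, mul_one, conj_hecke_eigenvalue hf hc]
  funext z
  have h1 := HasQExpansion.conjCoeff ha z
  simp only [hreal] at h1
  exact h1.unique (ha z)

lemma IsNormalizedHeckeEigenform.one_le {n : ℕ} {f : CuspForm 𝒮ℒ ((n : ℤ) + 2)}
    (h : IsNormalizedHeckeEigenform f) : 1 ≤ n := by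
  by_contra hn
  obtain rfl : n = 0 := by omega
  have hrank : Module.rank ℂ (CuspForm 𝒮ℒ (((0 : ℕ) : ℤ) + 2)) = 0 :=
    CuspForm.rank_eq_zero_of_weight_lt_twelve (by norm_num)
  have := rank_zero_iff.1 hrank
  have h0 : f = 0 := Subsingleton.elim _ _
  have h1 := h.1
  rw [h0, FunLike.coe_zero, qExpansion_zero] at h1
  simp at h1

end RealAnalyticCuspForms

end

theorem theorem1 (n : ℕ) :
    (∀ f : CuspForm 𝒮ℒ ((n : ℤ) + 2), RealAnalyticCuspForms.IsNormalizedHeckeEigenform f →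
      (∃! g : ℍ → ℂ, RealAnalyticCuspForms.IsReduced n g ∧
        RealAnalyticCuspForms.RepresentsSingleValued n f g) ∧
      ∀ g : ℍ → ℂ, RealAnalyticCuspForms.RepresentsSingleValued n f g →
        (∃! H : RealAnalyticCuspForms.Family n, RealAnalyticCuspForms.SolvesSystem n f g H) ∧
        ∀ H : RealAnalyticCuspForms.Family n, RealAnalyticCuspForms.SolvesSystem n f g H →
          RealAnalyticCuspForms.IsLaplaceEigenFamily n H) ∧
    (∀ f : ℍ → ℂ, RealAnalyticCuspForms.IsWeakCuspForm ((n : ℤ) + 2) f →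
      (∃! f₀ : ℍ → ℂ, RealAnalyticCuspForms.IsReduced n f₀ ∧
        RealAnalyticCuspForms.BolCongruent n f f₀) ∧
      (∃! g₀ : ℍ → ℂ, RealAnalyticCuspForms.IsReduced n g₀ ∧
        RealAnalyticCuspForms.RepresentsSingleValued n (RealAnalyticCuspForms.conjCoeff f) g₀) ∧
      (∀ f₁ g g₁ : ℍ → ℂ, RealAnalyticCuspForms.BolCongruent n f f₁ →
        RealAnalyticCuspForms.RepresentsSingleValued n (RealAnalyticCuspForms.conjCoeff f) g →
        (RealAnalyticCuspForms.RepresentsSingleValued n (RealAnalyticCuspForms.conjCoeff f₁) g₁ ↔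
          RealAnalyticCuspForms.BolCongruent n g g₁)) ∧
      ∀ f₁ g : ℍ → ℂ, RealAnalyticCuspForms.BolCongruent n f f₁ →
        RealAnalyticCuspForms.RepresentsSingleValued n (RealAnalyticCuspForms.conjCoeff f) g →
        (∃ H : RealAnalyticCuspForms.Family n, RealAnalyticCuspForms.SolvesSystem n f₁ g H) ∧
        (1 ≤ n → ∀ H H' : RealAnalyticCuspForms.Family n,
          RealAnalyticCuspForms.SolvesSystem n f₁ g H →
          RealAnalyticCuspForms.SolvesSystem n f₁ g H' → H = H') ∧
        ∀ H : RealAnalyticCuspForms.Family n, RealAnalyticCuspForms.SolvesSystem n f₁ g H →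
          RealAnalyticCuspForms.IsLaplaceEigenFamily n H) := by
  open RealAnalyticCuspForms in
  -- Part (1) is part (2) with f^c = f; a nonzero cusp form excludes weight 2, so n ≥ 1 and
  -- uniqueness is available.
  exact ⟨fun f hf ↦
    singleValued_of_conjCoeff_eq hf.one_le (cuspForm_isWeakCuspForm f) hf.conjCoeff_eq,
    fun f hf ↦ singleValued_weakCuspForm hf⟩
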